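/- **Setting.** Let $\Omega=\prod_{d\in\{x,y,z\}}[-L_d/2,L_d/2]$, periodic in $x,y$ and free in $z$, let $N$ charges $q_j\in\mathbb R$ sit at $\mathbf r_j\in\Omega$, and let $\sum_{\ell=0}^m w_\ell e^{-r^2/s_\ell^2}$ be a sum of Gaussians with $w_\ell>0$ and $0<s_0<\dots<s_m$. For $g$ on $\frac{2\pi}{L_x}\mathbb Z\times\frac{2\pi}{L_y}\mathbb Z\times\mathbb R$ put $\mathcal L[g]=\frac1{2\pi L_xL_y}\sum_{k_x,k_y}\int_{\mathbb R}g(\mathbf k)\,dk_z$. With $\hat\tau(\mathbf k)=\frac{\sqrt\pi}{4}\sum_{\ell=0}^m w_\ell s_\ell^3|\mathbf k|^2e^{-s_\ell^2|\mathbf k|^2/4}$ the mid-range potential is $$\Phi(\mathbf r_i)=4\pi\sum_{j}q_j\,\mathcal L\big[\hat\tau(\mathbf k)|\mathbf k|^{-2}e^{i\mathbf k\cdot(\mathbf r_i-\mathbf r_j)}\big].$$ Let $h_d,H_d,\mathcal S>0$, with $\mathcal P_d=2H_d/h_d+1$ an odd integer, and consider the Gaussian window $W(\mathbf r)=\prod_d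 e^{-\mathcal S(r_d/H_d)^2}$ with Fourier transform $\widehat W(\mathbf k)=\prod_d\sqrt{\pi/\mathcal S}\,H_de^{-k_d^2H_d^2/(4\mathcal S)}$. Let $W_*$ be its periodization in $x,y$ only. Put $\rho(\mathbf k)=\sum_jq_je^{-i\mathbf k\cdot\mathbf r_j}$, $\widehat S=\hat\tau|\mathbf k|^{-2}|\widehat W|^{-2}\widehat W\rho$ and $S(\mathbf r)=\mathcal L[\widehat S(\mathbf k)e^{i\mathbf k\cdot\mathbf r}]$. Let $L_z^*=\lambda_z(L_z+\delta_z)$ with $\lambda_z\ge1$ and $\delta_z\ge2H_z$, and let $$\Phi^{*}(\mathbf r_i)=4\pi\int_{-L_z^*/2}^{L_z^*/2}\int_{-L_y/2}^{L_y/2}\int_{-L_x/2}^{L_x/2}S(\mathbf r)\,W_*(\mathbf r_i-\mathbf r)\,dx\,dy\,dz .$$ For $\mathbf u\in[-\frac12,\frac12]^3$ (so that $\mathbf r_i-\mathbf u\circ\mathbf h$ is a nearest grid point of $\mathbf r_i$) let $$\mathcal T_{\mathcal P}(\mathbf r_i)=4\pi h_xh_yh_z\sum_{|n_d|\le(\mathcal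 P_d-1)/2}S(\mathbf r_i-\mathbf u\circ\mathbf h+\mathbf n\circ\mathbf h)\,W(\mathbf u\circ\mathbf h-\mathbf n\circ\mathbf h).$$ The padding error is $\mathcal E^{\mathrm{padd}}=\Phi-\Phi^*$. The gathering error is $\mathcal E^{\mathrm{gath}}=\Phi^*-\mathcal T_{\mathcal P}$ or, measured against the full integral, $\Phi-\mathcal T_{\mathcal P}$. Finally let $\mu_d^\ell=s_\ell^2-H_d^2/\mathcal S$ and let $\Lambda=\sup_{\mathbf k}|\rho(\mathbf k)|$ be the supremum of the structure factor over $\frac{2\pi}{L_x}\mathbb Z\times\frac{2\pi}{L_y}\mathbb Z\times\mathbb R$, so that $\Lambda\le\sum_j|q_j|$. **Theorem.** Assume $H_d^2/\mathcal S<s_\ell^2$ for all $\ell$ and $d$. Then for all $i$ $$|\mathcal E^{\mathrm{padd}}(\mathbf r_i)|\le K\Lambda\,\operatorname{erfc}\!\Big[\frac{\lambda_z(L_z+\delta_z)}{2\sqrt{\mu_z^m}}\Big],$$ $$|\mathcal E^{\mathrm{gath}}(\mathbf r_i)|\le K\Lambda\Big(\max_d\sum_{\ell=0}^mw_\ell\exp\Big(-\frac{\pi^2\mu_d^\ell(\mathcal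 P_d-1)^2}{4s_\ell^2\mathcal S}\Big)+\operatorname{erfc}\sqrt{\mathcal S}\Big).$$ The second bound holds for both forms of $\mathcal E^{\mathrm{gath}}$, and also if in $\mathcal T_{\mathcal P}$ the window is replaced by its truncation to $\prod_d[-H_d,H_d]$. The constant $K$ depends only on $L_x,L_y,L_z$, on $m,w_\ell,s_\ell$ and on a number $\varepsilon>0$ such that $\mu_d^\ell\ge\varepsilon$ for all $\ell,d$ and, for the second bound only, $(\mathcal P_d-1)^2\ge\varepsilon\mathcal S$ for all $d$. In particular $K$ does not depend on $N$, the charges, the positions, $\lambda_z$, $\delta_z$, $\mathcal S$, $H_d$, $h_d$ or $\mathbf u$. -/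

import Mathlib

noncomputable section

namespace SpectralSOG

/-! Points and wave vectors are elements of `Fin 3 → ℝ`; the coordinates `0, 1` are the periodic
directions `x, y` and the coordinate `2` is the free direction `z`. -/

/-- The complementary error function. -/
def erfc (x : ℝ) : ℝ := 2 / √Real.pi * ∫ t in Set.Ioi x, Real.exp (-t ^ 2)

/-- The box `[-a₀/2, a₀/2] × [-a₁/2, a₁/2] × [-a₂/2, a₂/2]`. -/
def box (a : Fin 3 → ℝ) : Set (Fin 3 → ℝ) := {x | ∀ d, |x d| ≤ a d / 2}

/-- The plane wave `exp (i k · x)`. -/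
def planeWave (k x : Fin 3 → ℝ) : ℂ :=
  Complex.exp (Complex.I * ((∑ d, k d * x d : ℝ) : ℂ))

/-- The wave vector `(2π n₁ / L_x, 2π n₂ / L_y, κ)`. -/
def waveVec (L : Fin 3 → ℝ) (n : ℤ × ℤ) (κ : ℝ) : Fin 3 → ℝ :=
  ![2 * Real.pi * n.1 / L 0, 2 * Real.pi * n.2 / L 1, κ]

/-- The doubly periodic summation operator: a sum over the periodic modes and an integral over
the free one, divided by `2π L_x L_y`. -/
def mixedSum (L : Fin 3 → ℝ) (g : (Fin 3 → ℝ) → ℂ) : ℂ :=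
  1 / ((2 * Real.pi * L 0 * L 1 : ℝ) : ℂ) * ∑' n : ℤ × ℤ, ∫ κ : ℝ, g (waveVec L n κ)

/-- The structure factor `∑ⱼ qⱼ exp (-i k · rⱼ)`. -/
def structureFactor {N : ℕ} (q : Fin N → ℝ) (r : Fin N → Fin 3 → ℝ) (k : Fin 3 → ℝ) : ℂ :=
  ∑ j, (q j : ℂ) * planeWave (-k) (r j)

/-- The supremum of the modulus of the structure factor over all wave vectors. It is at most
`∑ⱼ |qⱼ|`. -/
def structureSup (L : Fin 3 → ℝ) {N : ℕ} (q : Fin N → ℝ) (r : Fin N → Fin 3 → ℝ) : ℝ :=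
  ⨆ p : (ℤ × ℤ) × ℝ, ‖structureFactor q r (waveVec L p.1 p.2)‖

/-- The quotient `τ̂(k) / |k|²`, where `τ̂(k) = (√π / 4) ∑ w s³ |k|² exp (-s² |k|² / 4)` is the
Fourier transform of the mid-range screening function; the factor `|k|²` is cancelled. -/
def midMultiplier {m : ℕ} (w s : Fin (m + 1) → ℝ) (k : Fin 3 → ℝ) : ℝ :=
  √Real.pi / 4 * ∑ l, w l * s l ^ 3 * Real.exp (-(s l ^ 2 * ∑ d, k d ^ 2) / 4)

/-- The mid-range potential `4π ∑ⱼ qⱼ 𝓛[τ̂(k) / |k|² exp (i k · (x - rⱼ))]`. -/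
def midPotential (L : Fin 3 → ℝ) {m : ℕ} (w s : Fin (m + 1) → ℝ) {N : ℕ} (q : Fin N → ℝ)
    (r : Fin N → Fin 3 → ℝ) (x : Fin 3 → ℝ) : ℂ :=
  4 * Real.pi * ∑ j, (q j : ℂ) *
    mixedSum L fun k => (midMultiplier w s k : ℂ) * planeWave k (x - r j)

/-- The Gaussian window before truncation, in three dimensions. -/
def gaussWindow (S : ℝ) (H : Fin 3 → ℝ) (x : Fin 3 → ℝ) : ℝ :=
  ∏ d, Real.exp (-S * (x d / H d) ^ 2)

/-- The Gaussian window truncated to its support `∏ [-H_d, H_d]`. -/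
def truncGaussWindow (S : ℝ) (H : Fin 3 → ℝ) (x : Fin 3 → ℝ) : ℝ :=
  ∏ d, if |x d| ≤ H d then Real.exp (-S * (x d / H d) ^ 2) else 0

/-- The Fourier transform of `gaussWindow S H`. -/
def gaussWindowHat (S : ℝ) (H : Fin 3 → ℝ) (k : Fin 3 → ℝ) : ℝ :=
  ∏ d, √(Real.pi / S) * H d * Real.exp (-(k d ^ 2 * H d ^ 2) / (4 * S))

/-- The window, made periodic in the two periodic directions. -/
def periodicWindow (L : Fin 3 → ℝ) (S : ℝ) (H : Fin 3 → ℝ) (x : Fin 3 → ℝ) : ℝ :=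
  ∑' n : ℤ × ℤ, gaussWindow S H (x + ![n.1 * L 0, n.2 * L 1, 0])

/-- The Fourier transform of the gridded charges, `∑ⱼ qⱼ Ŵ(k) exp (-i k · rⱼ)`. -/
def gridHat (S : ℝ) (H : Fin 3 → ℝ) {N : ℕ} (q : Fin N → ℝ) (r : Fin N → Fin 3 → ℝ)
    (k : Fin 3 → ℝ) : ℂ :=
  ∑ j, (q j : ℂ) * (gaussWindowHat S H k : ℂ) * planeWave (-k) (r j)

/-- The result of the scaling step, `τ̂(k) / |k|² · |Ŵ(k)|⁻² · Ŝ_grid(k)`. -/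
def scalHat {m : ℕ} (w s : Fin (m + 1) → ℝ) (S : ℝ) (H : Fin 3 → ℝ) {N : ℕ} (q : Fin N → ℝ)
    (r : Fin N → Fin 3 → ℝ) (k : Fin 3 → ℝ) : ℂ :=
  (midMultiplier w s k : ℂ) * ((|gaussWindowHat S H k| ^ 2)⁻¹ : ℝ) * gridHat S H q r k

/-- The inverse Fourier transform of `scalHat`. -/
def scal (L : Fin 3 → ℝ) {m : ℕ} (w s : Fin (m + 1) → ℝ) (S : ℝ) (H : Fin 3 → ℝ) {N : ℕ}
    (q : Fin N → ℝ) (r : Fin N → Fin 3 → ℝ) (x : Fin 3 → ℝ) : ℂ :=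
  mixedSum L fun k => scalHat w s S H q r k * planeWave k x

/-- The gathering integral over one period in `x, y` with the free direction confined to
`[-A/2, A/2]`. -/
def confinedPotential (L : Fin 3 → ℝ) {m : ℕ} (w s : Fin (m + 1) → ℝ) (S : ℝ)
    (H : Fin 3 → ℝ) {N : ℕ} (q : Fin N → ℝ) (r : Fin N → Fin 3 → ℝ) (A : ℝ)
    (x : Fin 3 → ℝ) : ℂ :=
  4 * Real.pi * ∫ y in box ![L 0, L 1, A],
    scal L w s S H q r y * (periodicWindow L S H (x - y) : ℂ)

/-- The indices of the grid points in the support of the window, `|n_d| ≤ (P_d - 1) / 2`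
(the `P_d` are odd). -/
def gridIndices (P : Fin 3 → ℕ) : Finset (Fin 3 → ℤ) :=
  Fintype.piFinset fun d => Finset.Icc (-(((P d - 1) / 2 : ℕ) : ℤ)) (((P d - 1) / 2 : ℕ) : ℤ)

/-- The gathering sum at `x`: the trapezoidal rule on the grid of mesh `h` through the grid point
`x - u ∘ h`, over the indices in `gridIndices P`, with window `V`. The grid point with index `n` is
`x - u ∘ h + n ∘ h`, and its displacement to `x` is `u ∘ h - n ∘ h`. -/
def gatherSum (L : Fin 3 → ℝ) {m : ℕ} (w s : Fin (m + 1) → ℝ) (S : ℝ) (H : Fin 3 → ℝ) {N : ℕ}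
    (q : Fin N → ℝ) (r : Fin N → Fin 3 → ℝ) (V : (Fin 3 → ℝ) → ℝ) (h : Fin 3 → ℝ)
    (P : Fin 3 → ℕ) (u x : Fin 3 → ℝ) : ℂ :=
  4 * Real.pi * ((∏ d, h d : ℝ) : ℂ) * ∑ n ∈ gridIndices P,
    scal L w s S H q r (fun d => x d - u d * h d + n d * h d) *
      (V (fun d => u d * h d - n d * h d) : ℂ)

/-- `μ = s² - H² / S` for a single Gaussian and a single direction. -/
def mu (s S H : ℝ) : ℝ := s ^ 2 - H ^ 2 / S

/-- `max_d ∑ w exp (-π² μ_d (P_d - 1)² / (4 s² S)) + erfc √S`. -/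
def gatherRate {m : ℕ} (w s : Fin (m + 1) → ℝ) (S : ℝ) (H : Fin 3 → ℝ) (P : Fin 3 → ℕ) : ℝ :=
  (⨆ d : Fin 3, ∑ l, w l *
      Real.exp (-(Real.pi ^ 2 * mu (s l) S (H d) * ((P d : ℝ) - 1) ^ 2) / (4 * s l ^ 2 * S)))
    + erfc (√S)

end SpectralSOG

end

noncomputable section

namespace SpectralSOG

open MeasureTheory Set
open scoped FourierTransform

/-! Write a_d = H_d²/S and μ_d = s² - a_d. Dividing one Gaussian of the multiplier by the
transformed window leaves a product over d of the weights exp(-μ_d k_d²/4)/√(π a_d). Hence the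
mid-range potential, the confined potential and the gathering sum are all integrals over wave
vectors of this same quotient, times the structure factor, times a product of one-dimensional
factors B_d(k_d). Only the B_d differ: the transformed window times a phase for Φ, a trapezoidal sum
times a phase for the gathering sum, and a window transform restricted to an interval in z for Φ*.

Gathering. The difference of two triple products telescopes, so one direction suffices. Omitting
grid points beyond H costs a Gaussian tail, namely erfc √S plus a boundary term. By Poisson
summation the remaining error is the sum of the transformed window over nonzero shifts 2πn/h.
Multiplying by the weight and completing the square gives exp(-X n²), with X = π² μ (2M)²/(4 s² S)
and M = H/h, times a Gaussian in k whose width depends only on s; its integral over the wave numbers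
is bounded uniformly in the shift (`GaussBounded`). The boundary term is absorbed by one of the two
rates (`exists_cutoff_term_le`).

Padding. In x and y the periodized window makes the integral over one period exact. In z, what is
lost is the integral over |z| > b = A/2, where A is the confined length, of the window times the
damped inverse transform of the structure factor. To keep Λ instead of the sum of the |q_j|, no
triangle inequality over the charges is allowed: multiplying the coefficients of an exponential sum
by the Fourier transform of a probability density does not increase its supremum. With Gaussian and
Cauchy densities this yields the decay exp(-z²/μ + 2|z|B/μ), where B bounds the z-coordinates of the
charges (`norm_dampedTransform_le_exp`). Part of the window's own decay absorbs the linear term,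
which leads to the first padding bound. Using only the window's decay leads to a second bound by
erfc √S, which transfers the gathering estimate from Φ to Φ*. -/

/-! ### The complementary error function. -/

lemma integrable_exp_neg_sq : Integrable fun t : ℝ => Real.exp (-t ^ 2) := by
  simpa using integrable_exp_neg_mul_sq (b := 1) one_pos

lemma erfc_nonneg (x : ℝ) : 0 ≤ erfc x := by
  unfold erfc
  have : 0 ≤ ∫ t in Ioi x, Real.exp (-t ^ 2) := integral_nonneg fun t => (Real.exp_pos _).le
  positivity

lemma erfc_antitone : Antitone erfc := by
  intro x y hxy
  unfold erfc
  gcongr ?_ * ?_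
  exact setIntegral_mono_set integrable_exp_neg_sq.integrableOn
    (ae_of_all _ fun t => (Real.exp_pos _).le) (Ioi_subset_Ioi hxy).eventuallyLE

/-- Keep only the piece (x, x + δ] of the integral, on which the integrand is at least its value at
the right end. The choice δ = 1 is convenient for padding, while δ = 1/(1 + x) gives the sharp
order. -/
lemma mul_exp_le_erfc {x δ : ℝ} (hx : 0 ≤ x) (hδ : 0 ≤ δ) :
    2 / √Real.pi * (δ * Real.exp (-(x + δ) ^ 2)) ≤ erfc x := by
  unfold erfc
  gcongr ?_ * ?_
  have h1 : ∫ t in Ioc x (x + δ), Real.exp (-(x + δ) ^ 2) = δ * Real.exp (-(x + δ) ^ 2) := by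
    simp [hδ]
  rw [← h1]
  refine le_trans (setIntegral_mono_on ?_ integrable_exp_neg_sq.integrableOn measurableSet_Ioc
    (g := fun t => Real.exp (-t ^ 2)) ?_) ?_
  · simp
  · intro t ht
    have : 0 ≤ t := hx.trans ht.1.le
    have := ht.2
    gcongr
  · exact setIntegral_mono_set integrable_exp_neg_sq.integrableOn
      (ae_of_all _ fun t => (Real.exp_pos _).le) Ioc_subset_Ioi_self.eventuallyLE

lemma exp_neg_add_one_sq_le_erfc {x : ℝ} (hx : 0 ≤ x) :
    2 / √Real.pi * Real.exp (-(x + 1) ^ 2) ≤ erfc x := by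
  simpa using mul_exp_le_erfc hx zero_le_one

/-- A lower bound of the correct order for the complementary error function. -/
lemma exp_neg_sq_div_le_erfc {x : ℝ} (hx : 0 ≤ x) :
    2 / √Real.pi * Real.exp (-3) * (Real.exp (-x ^ 2) / (1 + x)) ≤ erfc x := by
  refine le_trans ?_ (mul_exp_le_erfc (δ := 1 / (1 + x)) hx (by positivity))
  -- With δ = 1/(1 + x) one has x δ ≤ 1 and δ ≤ 1, so the square exceeds x² by at most 2 + 1.
  have : Real.exp (-3) * Real.exp (-x ^ 2) ≤ Real.exp (-(x + 1 / (1 + x)) ^ 2) := by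
    rw [← Real.exp_add]
    apply Real.exp_le_exp.2
    have h1 : 1 / (1 + x) ≤ 1 := by rw [div_le_one (by positivity)]; linarith
    have h2 : x * (1 / (1 + x)) ≤ 1 := by
      rw [mul_one_div, div_le_one (by positivity)]; linarith
    have h3 : 0 ≤ 1 / (1 + x) := by positivity
    nlinarith
  rw [mul_assoc]
  refine mul_le_mul_of_nonneg_left ?_ (by positivity)
  calc Real.exp (-3) * (Real.exp (-x ^ 2) / (1 + x))
      = 1 / (1 + x) * (Real.exp (-3) * Real.exp (-x ^ 2)) := by ring
    _ ≤ _ := by gcongr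

/-! ### One-dimensional Gaussians, their tails, transforms and Poisson summation. -/

/-- The one-dimensional Gaussian window of variance parameter `a`. -/
def gaussOne (a t : ℝ) : ℝ := Real.exp (-t ^ 2 / a)

/-- The Fourier transform of `gaussOne a`. -/
def gaussOneHat (a k : ℝ) : ℝ := √(Real.pi * a) * Real.exp (-a * k ^ 2 / 4)

lemma gaussOne_pos (a t : ℝ) : 0 < gaussOne a t := Real.exp_pos _

lemma gaussOne_neg (a t : ℝ) : gaussOne a (-t) = gaussOne a t := by simp [gaussOne]

lemma continuous_gaussOne (a : ℝ) : Continuous (gaussOne a) := by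
  unfold gaussOne; fun_prop

lemma continuous_gaussOneHat (a : ℝ) : Continuous (gaussOneHat a) := by
  unfold gaussOneHat; fun_prop

lemma gaussOne_le {a s t : ℝ} (ha : 0 < a) (hs : 0 ≤ s) (h : s ≤ |t|) :
    gaussOne a t ≤ gaussOne a s := by
  unfold gaussOne
  have : s ^ 2 ≤ t ^ 2 := by rw [← sq_abs t]; gcongr
  gcongr

lemma gaussOne_eq_exp_neg_mul (a t : ℝ) : gaussOne a t = Real.exp (-a⁻¹ * t ^ 2) := by
  unfold gaussOne; ring_nf

lemma integrable_gaussOne {a : ℝ} (ha : 0 < a) : Integrable (gaussOne a) := by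
  have := integrable_exp_neg_mul_sq (inv_pos.2 ha)
  refine this.congr (ae_of_all _ fun t => (gaussOne_eq_exp_neg_mul a t).symm)

lemma integral_gaussOne {a : ℝ} : ∫ t, gaussOne a t = √(Real.pi * a) := by
  simp_rw [gaussOne_eq_exp_neg_mul, integral_gaussian]
  simp

lemma setIntegral_gaussOne_Ioi {a : ℝ} (ha : 0 < a) (T : ℝ) :
    ∫ t in Ioi T, gaussOne a t = √(Real.pi * a) / 2 * erfc (T / √a) := by
  have hsa : 0 < √a := Real.sqrt_pos.2 ha
  have h := integral_comp_mul_left_Ioi (fun t => Real.exp (-t ^ 2)) T (inv_pos.2 hsa)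
  have e : ∀ t, gaussOne a t = Real.exp (-((√a)⁻¹ * t) ^ 2) := by
    intro t
    unfold gaussOne
    rw [mul_pow, inv_pow, Real.sq_sqrt ha.le]
    ring_nf
  simp_rw [e, h, erfc, Real.sqrt_mul Real.pi_pos.le]
  have : √Real.pi ≠ 0 := by positivity
  rw [inv_inv, div_eq_inv_mul T, smul_eq_mul]
  field_simp

lemma setIntegral_gaussOne_abs_gt {a T : ℝ} (ha : 0 < a) (hT : 0 ≤ T) :
    ∫ t in {t | T < |t|}, gaussOne a t = √(Real.pi * a) * erfc (T / √a) := by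
  have e : {t : ℝ | T < |t|} = Iio (-T) ∪ Ioi T := by
    ext t; simp only [mem_ofPred_eq, lt_abs, mem_union, mem_Iio, mem_Ioi, lt_neg]; tauto
  have hd : Disjoint (Iio (-T)) (Ioi T) := by
    rw [Set.disjoint_left]; intro t h1 h2; simp at h1 h2; linarith
  rw [e, setIntegral_union hd measurableSet_Ioi (integrable_gaussOne ha).integrableOn
    (integrable_gaussOne ha).integrableOn]
  have h1 : ∫ t in Iio (-T), gaussOne a t = ∫ t in Ioi T, gaussOne a t := by
    rw [← integral_Iic_eq_integral_Iio, ← integral_comp_neg_Ioi]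
    simp [gaussOne_neg]
  rw [h1, setIntegral_gaussOne_Ioi ha]
  ring

/-- The Fourier transform of the one-dimensional Gaussian. -/
lemma integral_cexp_mul_gaussOne {a : ℝ} (ha : 0 < a) (k : ℝ) :
    ∫ t : ℝ, Complex.exp (Complex.I * (k * t : ℝ)) * (gaussOne a t : ℂ) = gaussOneHat a k := by
  have hb : 0 < ((a⁻¹ : ℝ) : ℂ).re := by simpa using ha
  have h := fourierIntegral_gaussian hb (k : ℂ)
  have e : ∀ t : ℝ, Complex.exp (Complex.I * (k * t : ℝ)) * (gaussOne a t : ℂ) =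
      Complex.exp (Complex.I * k * t) * Complex.exp (-((a⁻¹ : ℝ) : ℂ) * t ^ 2) := by
    intro t
    rw [gaussOne_eq_exp_neg_mul]
    push_cast
    ring_nf
  simp_rw [e, h, gaussOneHat]
  push_cast
  congr 1
  · rw [Real.sqrt_eq_rpow, Complex.ofReal_cpow (by positivity)]
    push_cast
    rw [div_inv_eq_mul]
  · congr 1
    have : (a : ℂ) ≠ 0 := by exact_mod_cast ha.ne'
    field_simp

/-- Poisson summation for the shifted Gaussian on a grid of mesh `h`. -/
lemma tsum_cexp_mul_gaussOne {a h : ℝ} (ha : 0 < a) (hh : 0 < h) (k u : ℝ) :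
    (h : ℂ) * ∑' n : ℤ, Complex.exp (Complex.I * (k * ((n - u) * h) : ℝ)) *
        (gaussOne a ((n - u) * h) : ℂ) =
      ∑' n : ℤ, (gaussOneHat a (k - 2 * Real.pi * n / h) : ℂ) *
        Complex.exp (-(2 * Real.pi * n * u : ℝ) * Complex.I) := by
  have hp := Real.pi_pos
  have hA : 0 < ((h ^ 2 / (Real.pi * a) : ℝ) : ℂ).re := by
    rw [Complex.ofReal_re]; positivity
  have hah : (a : ℂ) ≠ 0 := by exact_mod_cast ha.ne'
  have hhh : (h : ℂ) ≠ 0 := by exact_mod_cast hh.ne'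
  have hpp : (Real.pi : ℂ) ≠ 0 := by exact_mod_cast hp.ne'
  -- The parameters are the coefficients of n² and n in -(n - u)² h²/a + i k (n - u) h; the terms
  -- free of n come out as a common factor.
  have key := Complex.tsum_exp_neg_quadratic hA
    ((u * h ^ 2 / (Real.pi * a) : ℝ) + Complex.I * (k * h / (2 * Real.pi) : ℝ))
  have e1 : ∀ n : ℤ, Complex.exp (Complex.I * (k * ((n - u) * h) : ℝ)) *
      (gaussOne a ((n - u) * h) : ℂ) =
      Complex.exp (-Complex.I * k * u * h - u ^ 2 * h ^ 2 / a) *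
      Complex.exp (-Real.pi * ((h ^ 2 / (Real.pi * a) : ℝ) : ℂ) * n ^ 2 + 2 * Real.pi *
        ((u * h ^ 2 / (Real.pi * a) : ℝ) + Complex.I * (k * h / (2 * Real.pi) : ℝ)) * n) := by
    intro n
    rw [gaussOne, Complex.ofReal_exp, ← Complex.exp_add, ← Complex.exp_add]
    congr 1
    push_cast
    field_simp
    ring
  simp_rw [e1, tsum_mul_left, key, ← tsum_mul_left]
  congr 1
  ext n
  have e2 : (h : ℂ) * (1 / ((h ^ 2 / (Real.pi * a) : ℝ) : ℂ) ^ (1 / 2 : ℂ)) =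
      (√(Real.pi * a) : ℂ) := by
    have : ((h ^ 2 / (Real.pi * a) : ℝ) : ℂ) ^ (1 / 2 : ℂ) = ((h / √(Real.pi * a) : ℝ) : ℂ) := by
      have h0 : (0 : ℝ) ≤ h ^ 2 / (Real.pi * a) := by positivity
      have := Complex.ofReal_cpow h0 (1 / 2)
      rw [← Real.sqrt_eq_rpow, Real.sqrt_div (by positivity), Real.sqrt_sq hh.le] at this
      rw [this]
      push_cast
      rfl
    rw [this]
    push_cast
    have : (√(Real.pi * a) : ℂ) ≠ 0 := by
      exact_mod_cast (Real.sqrt_pos.2 (by positivity : 0 < Real.pi * a)).ne'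
    field_simp
  calc _ = ((h : ℂ) * (1 / ((h ^ 2 / (Real.pi * a) : ℝ) : ℂ) ^ (1 / 2 : ℂ))) *
        (Complex.exp (-Complex.I * k * u * h - u ^ 2 * h ^ 2 / a) *
        Complex.exp (-Real.pi / ((h ^ 2 / (Real.pi * a) : ℝ) : ℂ) * (n + Complex.I *
        ((u * h ^ 2 / (Real.pi * a) : ℝ) + Complex.I * (k * h / (2 * Real.pi) : ℝ))) ^ 2)) := by
        ring
    _ = _ := by
        rw [e2, gaussOneHat, Complex.ofReal_mul, Complex.ofReal_exp, mul_assoc (√_ : ℂ),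
          ← Complex.exp_add, ← Complex.exp_add]
        congr 2
        push_cast
        field_simp
        ring_nf
        simp only [Complex.I_sq, Complex.I_pow_four, Complex.I_pow_three]
        ring

/-! ### Riemann sums of Gaussians over grid tails. -/

lemma antitoneOn_gaussOne {a : ℝ} (ha : 0 < a) : AntitoneOn (gaussOne a) (Ici 0) := by
  intro x hx y hy hxy
  exact gaussOne_le ha hx (hxy.trans (le_abs_self y))

/-- Integral comparison for a decreasing function: each term but the first is at most the integral
over the cell to its left. -/
lemma sum_range_gaussOne_le {a h b : ℝ} (ha : 0 < a) (hh : 0 < h) (hb : 0 ≤ b) (J : ℕ) :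
    h * ∑ j ∈ Finset.range (J + 1), gaussOne a (b + j * h) ≤
      h * gaussOne a b + ∫ t in b..(b + J * h), gaussOne a t := by
  have hi : ∀ c d : ℝ, IntervalIntegrable (gaussOne a) volume c d := fun c d =>
    (continuous_gaussOne a).intervalIntegrable c d
  induction J with
  | zero => simp
  | succ J ih =>
    rw [Finset.sum_range_succ, mul_add,
      ← intervalIntegral.integral_add_adjacent_intervals (hi b (b + J * h)) (hi _ _), ← add_assoc]
    refine add_le_add ih ?_
    have hle : b + J * h ≤ b + ((J + 1 : ℕ) : ℝ) * h := by push_cast; linarith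
    have : ∫ t in (b + J * h)..(b + ((J + 1 : ℕ) : ℝ) * h),
        gaussOne a (b + ((J + 1 : ℕ) : ℝ) * h) = h * gaussOne a (b + ((J + 1 : ℕ) : ℝ) * h) := by
      rw [intervalIntegral.integral_const, smul_eq_mul]
      push_cast
      ring
    rw [← this]
    refine intervalIntegral.integral_mono_on hle (by simp) (hi _ _) fun t ht => ?_
    have h0 : 0 ≤ t := le_trans (by positivity) ht.1
    exact antitoneOn_gaussOne ha h0 (h0.trans ht.2) ht.2

lemma sum_gaussOne_right_le {a h H u : ℝ} (ha : 0 < a) (hh : 0 < h) (hH : 0 ≤ H) (s : Finset ℤ)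
    (hs : ∀ n ∈ s, H ≤ (n - u) * h) :
    h * ∑ n ∈ s, gaussOne a ((n - u) * h) ≤
      h * gaussOne a H + √(Real.pi * a) / 2 * erfc (H / √a) := by
  -- The first index whose grid point is at or beyond H. The finite set `s` lies in the arithmetic
  -- progression starting there, and enlarging the set only adds positive terms.
  set n₁ : ℤ := ⌈H / h + u⌉
  have hb : H ≤ (n₁ - u) * h := by
    have := Int.le_ceil (H / h + u)
    rw [← div_le_iff₀ hh]
    linarith
  set J : ℕ := s.sup fun n => (n - n₁).toNat
  have hsub : s ⊆ (Finset.range (J + 1)).image fun j : ℕ => n₁ + (j : ℤ) := by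
    intro n hn
    have h1 : n₁ ≤ n := by
      apply Int.ceil_le.2
      have := (div_le_iff₀ hh).2 (hs n hn)
      linarith
    have h2 : (n - n₁).toNat ≤ J := Finset.le_sup (f := fun n : ℤ => (n - n₁).toNat) hn
    refine Finset.mem_image.2 ⟨(n - n₁).toNat, Finset.mem_range.2 (by omega), by omega⟩
  calc h * ∑ n ∈ s, gaussOne a ((n - u) * h)
      ≤ h * ∑ n ∈ (Finset.range (J + 1)).image fun j : ℕ => n₁ + (j : ℤ),
          gaussOne a ((n - u) * h) := by
        gcongr
        exact fun _ _ _ => (gaussOne_pos _ _).le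
    _ = h * ∑ j ∈ Finset.range (J + 1), gaussOne a ((n₁ - u) * h + j * h) := by
        rw [Finset.sum_image (by intro i _ j _ hij; simpa using hij)]
        congr 1
        refine Finset.sum_congr rfl fun j _ => ?_
        congr 1
        push_cast
        ring
    _ ≤ h * gaussOne a ((n₁ - u) * h) +
          ∫ t in ((n₁ - u) * h)..((n₁ - u) * h + J * h), gaussOne a t :=
        sum_range_gaussOne_le ha hh (hH.trans hb) J
    _ ≤ h * gaussOne a H + ∫ t in Ioi H, gaussOne a t := by
        gcongr
        · exact gaussOne_le ha hH (hb.trans (le_abs_self _))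
        · rw [intervalIntegral.integral_of_le (by nlinarith [Nat.cast_nonneg (α := ℝ) J])]
          refine setIntegral_mono_set (integrable_gaussOne ha).integrableOn
            (ae_of_all _ fun t => (gaussOne_pos _ _).le) (LE.le.eventuallyLE ?_)
          exact fun t ht => lt_of_le_of_lt hb ht.1
    _ = _ := by rw [setIntegral_gaussOne_Ioi ha]

/-- Riemann sums of a Gaussian over grid points of modulus at least `H`. -/
lemma sum_gaussOne_tail_le {a h H u : ℝ} (ha : 0 < a) (hh : 0 < h) (hH : 0 ≤ H) (s : Finset ℤ)
    (hs : ∀ n ∈ s, H ≤ |(n - u) * h|) :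
    h * ∑ n ∈ s, gaussOne a ((n - u) * h) ≤
      2 * h * gaussOne a H + √(Real.pi * a) * erfc (H / √a) := by
  rw [← Finset.sum_filter_add_sum_filter_not s fun n : ℤ => H ≤ (n - u) * h]
  have h1 := sum_gaussOne_right_le ha hh hH (s.filter fun n : ℤ => H ≤ (n - u) * h)
    (fun n hn => (Finset.mem_filter.1 hn).2)
  -- The left tail becomes a right tail under n ↦ -n, u ↦ -u. One boundary term per side accounts
  -- for the factor 2 in the final bound.
  have h2 := sum_gaussOne_right_le ha hh hH (u := -u)
    ((s.filter fun n : ℤ => ¬ H ≤ (n - u) * h).image fun n => -n) (by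
      intro n hn
      obtain ⟨m, hm, rfl⟩ := Finset.mem_image.1 hn
      obtain ⟨hm1, hm2⟩ := Finset.mem_filter.1 hm
      have := (le_abs.1 (hs m hm1)).resolve_left hm2
      push_cast
      linarith)
  rw [Finset.sum_image (by intro i _ j _ hij; simpa using hij)] at h2
  have h3 : ∀ n : ℤ, gaussOne a ((((-n : ℤ) : ℝ) - -u) * h) = gaussOne a ((n - u) * h) := by
    intro n
    rw [← gaussOne_neg]
    congr 1
    push_cast
    ring
  simp_rw [h3] at h2
  rw [mul_add]
  linarith

lemma summable_gaussOne_grid {a h : ℝ} (ha : 0 < a) (hh : 0 < h) (u : ℝ) :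
    Summable fun n : ℤ => gaussOne a ((n - u) * h) := by
  refine summable_of_sum_le (c := (2 * h * gaussOne a 0 + √(Real.pi * a) * erfc (0 / √a)) / h)
    (fun _ => (gaussOne_pos _ _).le) fun s => ?_
  rw [le_div_iff₀ hh, mul_comm]
  exact sum_gaussOne_tail_le ha hh le_rfl s fun _ _ => abs_nonneg _

lemma tsum_gaussOne_grid_le {a h : ℝ} (ha : 0 < a) (hh : 0 < h) (u : ℝ) :
    ∑' n : ℤ, gaussOne a ((n - u) * h) ≤
      (2 * h * gaussOne a 0 + √(Real.pi * a) * erfc (0 / √a)) / h := by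
  refine (summable_gaussOne_grid ha hh u).tsum_le_of_sum_le fun s => ?_
  rw [le_div_iff₀ hh, mul_comm]
  exact sum_gaussOne_tail_le ha hh le_rfl s fun _ _ => abs_nonneg _

lemma summable_gaussOneHat_shift {a h : ℝ} (ha : 0 < a) (hh : 0 < h) (k : ℝ) :
    Summable fun n : ℤ => gaussOneHat a (k - 2 * Real.pi * n / h) := by
  have hp := Real.pi_pos
  have h1 := (summable_gaussOne_grid (a := 4 / a) (h := 2 * Real.pi / h) (by positivity)
    (by positivity) (k * h / (2 * Real.pi))).mul_left √(Real.pi * a)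
  refine h1.congr fun n => ?_
  unfold gaussOneHat gaussOne
  congr 2
  field_simp
  ring

/-! ### The truncated trapezoidal rule for a plane wave times a window. -/

lemma norm_planePhase (x : ℝ) : ‖Complex.exp (Complex.I * (x : ℂ))‖ = 1 := by
  rw [mul_comm]; exact Complex.norm_exp_ofReal_mul_I x

/-- A one-dimensional window which agrees with the Gaussian, except that it may vanish at points of
modulus at least `H`. -/
def IsGaussCutoff (a H : ℝ) (v : ℝ → ℝ) : Prop :=
  ∀ t, v t = gaussOne a t ∨ (v t = 0 ∧ H ≤ |t|)

/-- The truncated trapezoidal rule applied to a plane wave times a window. -/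
def trapezoid (h u : ℝ) (N : ℕ) (v : ℝ → ℝ) (k : ℝ) : ℂ :=
  (h : ℂ) * ∑ n ∈ Finset.Icc (-(N : ℤ)) N,
    Complex.exp (Complex.I * (k * ((n - u) * h) : ℝ)) * (v ((n - u) * h) : ℂ)

lemma continuous_trapezoid (h u : ℝ) (N : ℕ) (v : ℝ → ℝ) : Continuous (trapezoid h u N v) := by
  unfold trapezoid; fun_prop

/-- The part of the trapezoidal error due to the truncation of the grid. -/
lemma norm_trapezoid_sub_tsum_le {a h H u : ℝ} {N : ℕ} {v : ℝ → ℝ} (ha : 0 < a) (hh : 0 < h)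
    (hN : N * h = H) (hu : |u| ≤ 1 / 2) (hv : IsGaussCutoff a H v) (k : ℝ) :
    ‖trapezoid h u N v k - (h : ℂ) * ∑' n : ℤ,
        Complex.exp (Complex.I * (k * ((n - u) * h) : ℝ)) * (gaussOne a ((n - u) * h) : ℂ)‖ ≤
      2 * h * gaussOne a H + √(Real.pi * a) * erfc (H / √a) := by
  classical
  have hH : 0 ≤ H := hN ▸ by positivity
  set e : ℤ → ℂ := fun n => Complex.exp (Complex.I * (k * ((n - u) * h) : ℝ))
  set g : ℤ → ℝ := fun n => gaussOne a ((n - u) * h)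
  -- The window extended by zero off the index range. It differs from the Gaussian only at grid
  -- points of modulus at least H: outside the range |n| ≥ N + 1, and |u| ≤ 1/2 keeps |n - u| ≥ N.
  set V : ℤ → ℝ := fun n => if n ∈ Finset.Icc (-(N : ℤ)) N then v ((n - u) * h) else 0
  have hg : Summable g := summable_gaussOne_grid ha hh u
  have he : ∀ n, ‖e n‖ = 1 := fun n => norm_planePhase _
  have hV : ∀ n, V n = g n ∨ (V n = 0 ∧ H ≤ |(n - u) * h|) := by
    intro n
    by_cases hn : n ∈ Finset.Icc (-(N : ℤ)) N
    · simp only [V, if_pos hn]; exact hv _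
    · simp only [V, if_neg hn]
      refine Or.inr ⟨trivial, ?_⟩
      rw [← hN, abs_mul, abs_of_pos hh]
      gcongr
      have h1 : (N : ℝ) + 1 ≤ |(n : ℝ)| := by
        have : (N : ℤ) + 1 ≤ |n| := by
          rw [Finset.mem_Icc, ← abs_le] at hn; omega
        exact_mod_cast this
      have := abs_sub_abs_le_abs_sub (n : ℝ) u
      linarith
  have hVle : ∀ n, |V n - g n| ≤ g n := by
    intro n
    rcases hV n with h1 | h1
    · simp [h1, (gaussOne_pos a _).le, g]
    · simp [h1, abs_of_pos (gaussOne_pos a _), g]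
  have h1 : trapezoid h u N v k = (h : ℂ) * ∑' n : ℤ, e n * (V n : ℂ) := by
    rw [trapezoid, tsum_eq_sum (s := Finset.Icc (-(N : ℤ)) N)]
    · congr 1
      exact Finset.sum_congr rfl fun n hn => by simp only [V, if_pos hn, e]
    · intro n hn; simp only [V, if_neg hn]; simp
  have hs1 : Summable fun n : ℤ => e n * (V n : ℂ) := by
    refine summable_of_ne_finset_zero (s := Finset.Icc (-(N : ℤ)) N) fun n hn => ?_
    simp only [V, if_neg hn]; simp
  have hs2 : Summable fun n : ℤ => e n * (g n : ℂ) := by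
    refine Summable.of_norm_bounded hg fun n => ?_
    rw [norm_mul, he, one_mul, Complex.norm_real, Real.norm_of_nonneg (gaussOne_pos _ _).le]
  rw [h1, ← mul_sub, ← hs1.tsum_sub hs2, norm_mul, Complex.norm_real, Real.norm_of_nonneg hh.le]
  have hs3 : Summable fun n => |V n - g n| :=
    Summable.of_nonneg_of_le (fun _ => abs_nonneg _) hVle hg
  have h2 : ‖∑' n, (e n * (V n : ℂ) - e n * (g n : ℂ))‖ ≤ ∑' n, |V n - g n| := by
    have e1 : ∀ n, ‖e n * (V n : ℂ) - e n * (g n : ℂ)‖ = |V n - g n| := by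
      intro n
      rw [← mul_sub, norm_mul, he, one_mul, ← Complex.ofReal_sub, Complex.norm_real,
        Real.norm_eq_abs]
    simp_rw [← e1] at hs3 ⊢
    exact norm_tsum_le_tsum_norm hs3
  refine (mul_le_mul_of_nonneg_left h2 hh.le).trans ?_
  rw [mul_comm, ← le_div_iff₀ hh]
  refine hs3.tsum_le_of_sum_le fun s => ?_
  rw [le_div_iff₀ hh, mul_comm]
  refine le_trans ?_ (sum_gaussOne_tail_le ha hh hH (u := u)
    (s.filter fun n : ℤ => H ≤ |(n - u) * h|) fun n hn => (Finset.mem_filter.1 hn).2)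
  gcongr
  rw [Finset.sum_filter]
  refine Finset.sum_le_sum fun n _ => ?_
  split_ifs with hn
  · exact hVle n
  · rcases hV n with h3 | h3
    · simp [h3]
    · exact absurd h3.2 hn

/-- The error of the truncated trapezoidal rule: truncation and aliasing. -/
lemma norm_trapezoid_sub_gaussOneHat_le {a h H u : ℝ} {N : ℕ} {v : ℝ → ℝ} (ha : 0 < a)
    (hh : 0 < h) (hN : N * h = H) (hu : |u| ≤ 1 / 2) (hv : IsGaussCutoff a H v) (k : ℝ) :
    ‖trapezoid h u N v k - gaussOneHat a k‖ ≤
      (2 * h * gaussOne a H + √(Real.pi * a) * erfc (H / √a)) +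
        ∑' n : ℤ, if n = 0 then 0 else gaussOneHat a (k - 2 * Real.pi * n / h) := by
  have h1 := norm_trapezoid_sub_tsum_le ha hh hN hu hv k
  rw [tsum_cexp_mul_gaussOne ha hh] at h1
  set F : ℤ → ℂ := fun n => (gaussOneHat a (k - 2 * Real.pi * n / h) : ℂ) *
        Complex.exp (-(2 * Real.pi * n * u : ℝ) * Complex.I)
  have hF : ∀ n, ‖F n‖ = gaussOneHat a (k - 2 * Real.pi * n / h) := by
    intro n
    simp only [F]
    rw [norm_mul, ← Complex.ofReal_neg, Complex.norm_exp_ofReal_mul_I, mul_one, Complex.norm_real,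
      Real.norm_of_nonneg (by unfold gaussOneHat; positivity)]
  have hsn : Summable fun n => ‖F n‖ := by
    simp_rw [hF]; exact summable_gaussOneHat_shift ha hh k
  have hs : Summable F := hsn.of_norm
  have h2 : ‖∑' n, F n - gaussOneHat a k‖ ≤
      ∑' n : ℤ, if n = 0 then 0 else gaussOneHat a (k - 2 * Real.pi * n / h) := by
    -- The zeroth dual term is the exact transform; all the others are aliases.
    rw [hs.tsum_eq_add_tsum_ite 0]
    have : F 0 = gaussOneHat a k := by simp [F]
    rw [this, add_sub_cancel_left]
    have e : ∀ n : ℤ, ‖if n = 0 then 0 else F n‖ =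
        if n = 0 then 0 else gaussOneHat a (k - 2 * Real.pi * n / h) := by
      intro n; split_ifs <;> simp [hF]
    simp_rw [← e]
    refine norm_tsum_le_tsum_norm (Summable.of_nonneg_of_le (fun _ => norm_nonneg _) ?_ hsn)
    intro n; split_ifs <;> simp
  calc _ = ‖(trapezoid h u N v k - ∑' n, F n) + (∑' n, F n - gaussOneHat a k)‖ := by
        congr 1; ring
    _ ≤ _ := (norm_add_le _ _).trans (add_le_add h1 h2)

/-! ### Measures of wave numbers and uniform Gaussian bounds. -/

/-- The measure of wave numbers in direction `d`: counting measure on `2π ℤ / L_d` in the periodic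
directions and Lebesgue measure in the free one. -/
def modeMeasure (L : Fin 3 → ℝ) (d : Fin 3) : Measure ℝ :=
  if d = 2 then volume else Measure.map (fun n : ℤ => 2 * Real.pi * n / L d) Measure.count

lemma measurableEmbedding_waveNumber {l : ℝ} (hl : 0 < l) :
    MeasurableEmbedding fun n : ℤ => 2 * Real.pi * n / l := by
  refine (measurable_of_countable _).measurableEmbedding ?_
  intro n m hnm
  have hp := Real.pi_pos
  have h1 : 2 * Real.pi * (n : ℝ) / l = 2 * Real.pi * m / l := hnm
  field_simp at h1
  exact_mod_cast h1

lemma sigmaFinite_modeMeasure {L : Fin 3 → ℝ} (hL : ∀ d, 0 < L d) (d : Fin 3) :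
    SigmaFinite (modeMeasure L d) := by
  unfold modeMeasure
  split_ifs
  · infer_instance
  · exact (measurableEmbedding_waveNumber (hL d)).sigmaFinite_map

/-- Shifted Gaussians are integrable with a bound which does not depend on the shift. -/
def GaussBounded (ν : Measure ℝ) : Prop :=
  ∀ b : ℝ, 0 < b → ∃ C : ℝ, 0 ≤ C ∧ ∀ c : ℝ,
    Integrable (fun k => gaussOne b (k - c)) ν ∧ ∫ k, gaussOne b (k - c) ∂ν ≤ C

lemma gaussBounded_volume : GaussBounded volume := by
  intro b hb
  refine ⟨√(Real.pi * b), by positivity, fun c => ⟨(integrable_gaussOne hb).comp_sub_right c, ?_⟩⟩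
  rw [integral_sub_right_eq_self (gaussOne b) c, integral_gaussOne]

/-- In a periodic direction the integral is a sum over a grid of mesh 2π/L_d, bounded by the tail
estimate with cutoff 0. Independence of the shift is essential, because aliasing recenters the
Gaussian at a point that moves with n. -/
lemma gaussBounded_modeMeasure {L : Fin 3 → ℝ} (hL : ∀ d, 0 < L d) (d : Fin 3) :
    GaussBounded (modeMeasure L d) := by
  unfold modeMeasure
  split_ifs
  · exact gaussBounded_volume
  · intro b hb
    have hp := Real.pi_pos
    have hl := hL d
    have hh : 0 < 2 * Real.pi / L d := by positivity
    refine ⟨(2 * (2 * Real.pi / L d) * gaussOne b 0 + √(Real.pi * b) * erfc (0 / √b)) /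
      (2 * Real.pi / L d), ?_, fun c => ?_⟩
    · have := (gaussOne_pos b 0).le
      have := erfc_nonneg (0 / √b)
      positivity
    · have e : ∀ n : ℤ, gaussOne b (2 * Real.pi * n / L d - c) =
          gaussOne b ((n - c * L d / (2 * Real.pi)) * (2 * Real.pi / L d)) := by
        intro n
        congr 1
        field_simp
      have hi : Integrable (fun n : ℤ => gaussOne b (2 * Real.pi * n / L d - c))
          Measure.count := by
        rw [integrable_count_iff]
        simp_rw [e]
        exact (summable_gaussOne_grid hb hh _).norm
      constructor
      · rw [(measurableEmbedding_waveNumber hl).integrable_map_iff]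
        exact hi
      · rw [(measurableEmbedding_waveNumber hl).integral_map, integral_countable hi]
        simp only [measureReal_def, Measure.count_singleton, ENNReal.toReal_one, one_smul, e]
        exact tsum_gaussOne_grid_le hb hh _

/-- Passing to the positive part of f allows the comparison to be made with nonnegative integrals,
where sum and integral commute freely. In the application f is a norm minus a multiple of a Gaussian
and may be negative. -/
lemma integral_le_tsum_integral {X : Type*} [MeasurableSpace X] {ν : Measure X} {f : X → ℝ}
    {φ : ℤ → X → ℝ} (hf : Integrable f ν) (hφ : ∀ n, Integrable (φ n) ν)
    (hφ0 : ∀ n x, 0 ≤ φ n x) (hs : ∀ x, Summable fun n => φ n x)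
    (hle : ∀ x, f x ≤ ∑' n, φ n x) (hsum : Summable fun n => ∫ x, φ n x ∂ν) :
    ∫ x, f x ∂ν ≤ ∑' n, ∫ x, φ n x ∂ν := by
  have h0 : 0 ≤ ∑' n, ∫ x, φ n x ∂ν := tsum_nonneg fun n => integral_nonneg (hφ0 n)
  refine (integral_mono hf hf.pos_part fun x => le_max_left _ _).trans ?_
  rw [← ENNReal.ofReal_le_ofReal_iff h0,
    ofReal_integral_eq_lintegral_ofReal hf.pos_part (ae_of_all _ fun x => le_max_right _ _),
    ENNReal.ofReal_tsum_of_nonneg (fun n => integral_nonneg (hφ0 n)) hsum]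
  simp_rw [fun n => ofReal_integral_eq_lintegral_ofReal (hφ n) (ae_of_all _ (hφ0 n))]
  rw [← lintegral_tsum fun n => (hφ n).aemeasurable.ennreal_ofReal]
  refine lintegral_mono fun x => ?_
  rw [← ENNReal.ofReal_tsum_of_nonneg (fun n => hφ0 n x) (hs x)]
  exact ENNReal.ofReal_le_ofReal (max_le (hle x) (tsum_nonneg fun n => hφ0 n x))

lemma GaussBounded.integrable_of_norm_le {ν : Measure ℝ} (hν : GaussBounded ν) {b C : ℝ}
    (hb : 0 < b) {f : ℝ → ℂ} (hf : Continuous f) (hle : ∀ k, ‖f k‖ ≤ C * gaussOne b k) :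
    Integrable f ν := by
  obtain ⟨_, _, h⟩ := hν b hb
  have := (h 0).1
  simp only [sub_zero] at this
  exact (this.const_mul C).mono' hf.aestronglyMeasurable (ae_of_all _ hle)

/-! ### Mode weights and the trapezoidal error integrated over one direction. -/

/-- The weight `exp (-μ k² / 4) / √(π a)` of a mode, the quotient of `exp (-s² k² / 4)` by
`gaussOneHat a k` when `μ + a = s²`. -/
def modeWeight (μ a k : ℝ) : ℝ := Real.exp (-μ * k ^ 2 / 4) / √(Real.pi * a)

lemma continuous_modeWeight (μ a : ℝ) : Continuous (modeWeight μ a) := by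
  unfold modeWeight; fun_prop

lemma modeWeight_nonneg (μ a k : ℝ) : 0 ≤ modeWeight μ a k := by
  unfold modeWeight; positivity

lemma modeWeight_eq {μ : ℝ} (a k : ℝ) :
    modeWeight μ a k = gaussOne (4 / μ) k / √(Real.pi * a) := by
  unfold modeWeight gaussOne
  rw [div_div_eq_mul_div]
  ring_nf

lemma modeWeight_le {μ ε : ℝ} (hε : ε ≤ μ) (a k : ℝ) :
    modeWeight μ a k ≤ (√(Real.pi * a))⁻¹ * gaussOne (4 / ε) k := by
  rw [← div_eq_inv_mul, ← modeWeight_eq]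
  unfold modeWeight
  have := mul_le_mul_of_nonneg_right hε (sq_nonneg k)
  gcongr ?_ / _
  apply Real.exp_le_exp.2
  linarith

/-- Completing the square in k. The Gaussian that remains has a width fixed by s alone, and the
prefactor, evaluated at c = 2πn/h, is the aliasing decay. -/
lemma modeWeight_mul_gaussOneHat {μ a s : ℝ} (ha : 0 < a) (hs : s ≠ 0) (h : μ + a = s ^ 2)
    (k c : ℝ) :
    modeWeight μ a k * gaussOneHat a (k - c) =
      Real.exp (-(μ * a / s ^ 2) * c ^ 2 / 4) * gaussOne (4 / s ^ 2) (k - a / s ^ 2 * c) := by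
  have h1 : √(Real.pi * a) ≠ 0 := (Real.sqrt_pos.2 (mul_pos Real.pi_pos ha)).ne'
  unfold modeWeight gaussOneHat gaussOne
  rw [div_mul_eq_mul_div, mul_left_comm, mul_div_assoc, mul_div_cancel₀ _ h1, ← Real.exp_add,
    ← Real.exp_add]
  congr 1
  obtain rfl : μ = s ^ 2 - a := by linarith
  field_simp
  ring

lemma modeWeight_mul_gaussOneHat_self {μ a s : ℝ} (ha : 0 < a) (hs : s ≠ 0) (h : μ + a = s ^ 2)
    (k : ℝ) : modeWeight μ a k * gaussOneHat a k = gaussOne (4 / s ^ 2) k := by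
  simpa using modeWeight_mul_gaussOneHat ha hs h k 0

lemma summable_exp_neg_mul_int_sq {c : ℝ} (hc : 0 < c) :
    Summable fun n : ℤ => Real.exp (-c * (n : ℝ) ^ 2) := by
  refine (summable_gaussOne_grid (a := c⁻¹) (h := 1) (by positivity) one_pos 0).congr fun n => ?_
  rw [gaussOne_eq_exp_neg_mul]
  simp

lemma gaussOneHat_nonneg (a k : ℝ) : 0 ≤ gaussOneHat a k := by
  unfold gaussOneHat; positivity

lemma gaussOneHat_le (a k : ℝ) (ha : 0 < a) : gaussOneHat a k ≤ √(Real.pi * a) := by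
  unfold gaussOneHat
  refine mul_le_of_le_one_right (by positivity) (Real.exp_le_one_iff.2 ?_)
  nlinarith [mul_nonneg ha.le (sq_nonneg k)]

lemma norm_trapezoid_le (h u : ℝ) (N : ℕ) (v : ℝ → ℝ) (k : ℝ) :
    ‖trapezoid h u N v k‖ ≤ |h| * ∑ n ∈ Finset.Icc (-(N : ℤ)) N, |v ((n - u) * h)| := by
  unfold trapezoid
  rw [norm_mul, Complex.norm_real, Real.norm_eq_abs]
  gcongr
  refine (norm_sum_le _ _).trans (Finset.sum_le_sum fun n _ => ?_)
  rw [norm_mul, norm_planePhase, one_mul, Complex.norm_real, Real.norm_eq_abs]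

lemma GaussBounded.integrable_modeWeight_mul {ν : Measure ℝ} (hν : GaussBounded ν) {μ a : ℝ}
    (hμ : 0 < μ) {f : ℝ → ℂ} (hf : Continuous f) {C : ℝ} (hC : ∀ k, ‖f k‖ ≤ C) :
    Integrable (fun k => (modeWeight μ a k : ℂ) * f k) ν := by
  refine hν.integrable_of_norm_le (b := 4 / μ) (C := (√(Real.pi * a))⁻¹ * C) (by positivity)
    ((Complex.continuous_ofReal.comp (continuous_modeWeight μ a)).mul hf) fun k => ?_
  rw [norm_mul, Complex.norm_real, Real.norm_of_nonneg (modeWeight_nonneg _ _ _), mul_right_comm]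
  refine mul_le_mul (modeWeight_le le_rfl a k) (hC k) (norm_nonneg _) ?_
  have := (gaussOne_pos (4 / μ) k).le
  positivity

/-- The error of the trapezoidal rule, integrated over the wave numbers of one direction. -/
theorem GaussBounded.exists_trapezoid_error_le {ν : Measure ℝ} (hν : GaussBounded ν) {s ε : ℝ}
    (hs : 0 < s) (hε : 0 < ε) :
    ∃ C : ℝ, 0 ≤ C ∧ ∀ (a μ h H u S : ℝ) (N : ℕ) (v : ℝ → ℝ), 0 < a → ε ≤ μ → μ + a = s ^ 2 →
      0 < h → 0 < H → N * h = H → S = H ^ 2 / a → ε * S ≤ (2 * N) ^ 2 → |u| ≤ 1 / 2 →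
      IsGaussCutoff a H v →
      ∫ k, ‖(modeWeight μ a k : ℂ) * (trapezoid h u N v k - gaussOneHat a k)‖ ∂ν ≤
        C * (Real.exp (-(Real.pi ^ 2 * μ * (2 * N) ^ 2) / (4 * s ^ 2 * S)) +
          (2 * h * gaussOne a H / √(Real.pi * a) + erfc √S)) := by
  have hp := Real.pi_pos
  obtain ⟨C1, hC1, h1⟩ := hν (4 / ε) (by positivity)
  obtain ⟨C2, hC2, h2⟩ := hν (4 / s ^ 2) (by positivity)
  -- A lower bound for the aliasing exponent X, obtained from μ ≥ ε and (2N)² ≥ ε S. It gives X n² ≥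
  -- X + κ (n² - 1) for n ≠ 0, so exp(-X) factors out of the alias sum and the remaining series
  -- depends only on s and ε.
  set κ := Real.pi ^ 2 * ε ^ 2 / (4 * s ^ 2) with hκ
  have hκ0 : 0 < κ := by positivity
  set ψ : ℤ → ℝ := fun n => Real.exp (-κ * (n : ℝ) ^ 2 + κ)
  have hψ : Summable ψ := by
    simp only [ψ, Real.exp_add]
    exact (summable_exp_neg_mul_int_sq hκ0).mul_right _
  set C3 := ∑' n, ψ n
  have hC3 : 0 ≤ C3 := tsum_nonneg fun n => (Real.exp_pos _).le
  refine ⟨C1 + C2 * C3, by positivity, ?_⟩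
  intro a μ h H u S N v ha hεμ hμa hh hH hN hS hεS hu hv
  have hμ : 0 < μ := hε.trans_le hεμ
  have hS0 : 0 < S := by rw [hS]; positivity
  have hsa : 0 < √(Real.pi * a) := by positivity
  have hHa : H / √a = √S := by
    rw [hS, Real.sqrt_div (by positivity), Real.sqrt_sq hH.le]
  set X := Real.pi ^ 2 * μ * (2 * N) ^ 2 / (4 * s ^ 2 * S) with hX
  have hXκ : κ ≤ X := by
    rw [hκ, hX, div_le_div_iff₀ (by positivity) (by positivity)]
    have : ε * (ε * S) ≤ μ * (2 * N) ^ 2 := by gcongr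
    have h3 : 0 ≤ Real.pi ^ 2 * (4 * s ^ 2) := by positivity
    nlinarith [mul_le_mul_of_nonneg_left this h3]
  set R := 2 * h * gaussOne a H / √(Real.pi * a) + erfc √S
  have hR : 0 ≤ R := by
    have := (gaussOne_pos a H).le
    have := erfc_nonneg √S
    positivity
  set G : ℝ → ℂ := fun k => (modeWeight μ a k : ℂ) * (trapezoid h u N v k - gaussOneHat a k)
  set φ : ℤ → ℝ → ℝ := fun n k => if n = 0 then 0 else
    modeWeight μ a k * gaussOneHat a (k - 2 * Real.pi * n / h)
  -- Inserting h = H/N and a = H²/S turns the prefactor of the completed square into exp(-X n²).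
  have hφ : ∀ n k, φ n k = if n = 0 then 0 else Real.exp (-X * (n : ℝ) ^ 2) *
      gaussOne (4 / s ^ 2) (k - a / s ^ 2 * (2 * Real.pi * n / h)) := by
    intro n k
    simp only [φ]
    split_ifs
    · rfl
    · rw [modeWeight_mul_gaussOneHat ha hs.ne' hμa]
      congr 2
      rw [hX, hS, ← hN]
      have hN0 : (N : ℝ) ≠ 0 := by
        rintro h0; rw [h0, zero_mul] at hN; exact hH.ne hN
      field_simp
  have hφi : ∀ n, Integrable (φ n) ν := by
    intro n
    by_cases hn : n = 0
    · simp [φ, hn]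
    · rw [funext (hφ n)]
      simp only [hn, if_false]
      exact (h2 _).1.const_mul _
  have hφ0 : ∀ n k, 0 ≤ φ n k := by
    intro n k
    simp only [φ]
    split_ifs
    · exact le_rfl
    · exact mul_nonneg (modeWeight_nonneg _ _ _) (gaussOneHat_nonneg _ _)
  have hφs : ∀ k, Summable fun n => φ n k := by
    intro k
    refine Summable.of_nonneg_of_le (fun n => hφ0 n k) (fun n => ?_)
      ((summable_gaussOneHat_shift ha hh k).mul_left (modeWeight μ a k))
    simp only [φ]
    split_ifs
    · exact mul_nonneg (modeWeight_nonneg _ _ _) (gaussOneHat_nonneg _ _)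
    · exact le_rfl
  have hφint : ∀ n, ∫ k, φ n k ∂ν ≤ Real.exp (-X) * C2 * ψ n := by
    intro n
    by_cases hn : n = 0
    · simp only [φ, hn, if_true, integral_zero]
      positivity
    · simp_rw [hφ, hn, if_false, integral_const_mul]
      have h3 : Real.exp (-X * (n : ℝ) ^ 2) ≤ Real.exp (-X) * ψ n := by
        rw [← Real.exp_add]
        apply Real.exp_le_exp.2
        have h4 : (1 : ℝ) ≤ (n : ℝ) ^ 2 := by
          have : 1 ≤ n ^ 2 := by have := sq_pos_of_ne_zero hn; omega
          exact_mod_cast this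
        nlinarith
      calc _ ≤ (Real.exp (-X) * ψ n) * C2 := by
            gcongr
            · exact integral_nonneg fun k => (gaussOne_pos _ _).le
            · exact (h2 _).2
        _ = _ := by ring
  have hφsum : Summable fun n => ∫ k, φ n k ∂ν :=
    Summable.of_nonneg_of_le (fun n => integral_nonneg (hφ0 n)) hφint (hψ.mul_left _)
  have hGi : Integrable G ν := by
    refine hν.integrable_modeWeight_mul hμ ((continuous_trapezoid h u N v).sub
      (Complex.continuous_ofReal.comp (continuous_gaussOneHat a)))
      (C := |h| * ∑ n ∈ Finset.Icc (-(N : ℤ)) N, |v ((n - u) * h)| + √(Real.pi * a)) fun k => ?_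
    refine (norm_sub_le _ _).trans (add_le_add (norm_trapezoid_le _ _ _ _ _) ?_)
    simp only [Complex.norm_real]
    rw [Real.norm_of_nonneg (gaussOneHat_nonneg _ _)]
    exact gaussOneHat_le a k ha
  have hg1 := (h1 0).1
  have hg2 := (h1 0).2
  simp only [sub_zero] at hg1 hg2
  -- The truncation error does not depend on k; it is moved to the left as a multiple of a fixed
  -- Gaussian, leaving exactly the alias series on the right.
  have hpt : ∀ k, ‖G k‖ - R * gaussOne (4 / ε) k ≤ ∑' n, φ n k := by
    intro k
    have h3 := norm_trapezoid_sub_gaussOneHat_le ha hh hN hu hv k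
    simp only [G, norm_mul, Complex.norm_real]
    rw [Real.norm_of_nonneg (modeWeight_nonneg _ _ _), sub_le_iff_le_add']
    refine (mul_le_mul_of_nonneg_left h3 (modeWeight_nonneg μ a k)).trans ?_
    rw [mul_add, ← tsum_mul_left]
    refine add_le_add ?_ (le_of_eq (tsum_congr fun n => by simp only [φ]; split_ifs <;> simp))
    have h4 : 2 * h * gaussOne a H + √(Real.pi * a) * erfc (H / √a) = √(Real.pi * a) * R := by
      rw [hHa]; simp only [R]; field_simp
    rw [h4]
    calc _ ≤ ((√(Real.pi * a))⁻¹ * gaussOne (4 / ε) k) * (√(Real.pi * a) * R) := by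
          gcongr
          exact modeWeight_le hεμ a k
      _ = _ := by field_simp
  have h5 := integral_le_tsum_integral (f := fun k => ‖G k‖ - R * gaussOne (4 / ε) k)
    (hGi.norm.sub (hg1.const_mul R)) hφi hφ0 hφs hpt hφsum
  rw [integral_sub hGi.norm (hg1.const_mul R), integral_const_mul] at h5
  have h6 : ∑' n, ∫ k, φ n k ∂ν ≤ Real.exp (-X) * C2 * C3 := by
    rw [← tsum_mul_left]
    exact hφsum.tsum_le_tsum hφint (hψ.mul_left _)
  rw [neg_div, ← hX]
  have h7 : R * ∫ k, gaussOne (4 / ε) k ∂ν ≤ R * C1 := by gcongr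
  have h8 : 0 ≤ C1 * Real.exp (-X) := by positivity
  have h9 : 0 ≤ C2 * C3 * R := by positivity
  linarith

/-- The boundary term is a constant times (√S/N) exp(-S). If N ≥ S/π, then √S/N is at most of order
1/(1 + √S) and the term has the order of erfc √S. Otherwise the grid is so coarse that the aliasing
exponential is at least exp(-S). -/
lemma exists_cutoff_term_le {s ε : ℝ} (hs : 0 < s) (hε : 0 < ε) :
    ∃ C : ℝ, 0 ≤ C ∧ ∀ (a μ h H S : ℝ) (N : ℕ), 0 < a → ε ≤ μ → μ + a = s ^ 2 →
      0 < h → 0 < H → N * h = H → S = H ^ 2 / a → ε * S ≤ (2 * N) ^ 2 →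
      2 * h * gaussOne a H / √(Real.pi * a) ≤
        C * (Real.exp (-(Real.pi ^ 2 * μ * (2 * N) ^ 2) / (4 * s ^ 2 * S)) + erfc √S) := by
  have hp := Real.pi_pos
  set c₀ := 2 / √Real.pi * Real.exp (-3) with hc₀
  have hc₀p : 0 < c₀ := by positivity
  -- Bounds (√S/N)(1 + √S) on the fine-grid side: √S/N ≤ 2/√ε from the assumption on N, and S/N ≤ π
  -- from the case distinction.
  set A := 2 / √ε + Real.pi
  have hA : 0 < A := by positivity
  refine ⟨2 / √Real.pi * (2 / √ε) + 2 / √Real.pi * A / c₀, by positivity, ?_⟩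
  intro a μ h H S N ha hεμ hμa hh hH hN hS hεS
  have hS0 : 0 < S := by rw [hS]; positivity
  have hsS : 0 < √S := Real.sqrt_pos.2 hS0
  have hN0 : (0 : ℝ) < N := by
    rcases (Nat.cast_nonneg (α := ℝ) N).eq_or_lt with h0 | h0
    · rw [← h0, zero_mul] at hN; exact absurd hN hH.ne
    · exact h0
  have hsa : 0 < √a := Real.sqrt_pos.2 ha
  have hha : h / √a = √S / N := by
    rw [hS, Real.sqrt_div (by positivity), Real.sqrt_sq hH.le, ← hN]
    field_simp
  have hg : gaussOne a H = Real.exp (-S) := by rw [gaussOne, hS, neg_div]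
  have e1 : 2 * h * gaussOne a H / √(Real.pi * a) =
      2 / √Real.pi * (√S / N * Real.exp (-S)) := by
    rw [hg, ← hha, Real.sqrt_mul hp.le]
    ring
  rw [e1]
  have hE : 0 ≤ Real.exp (-(Real.pi ^ 2 * μ * (2 * N) ^ 2) / (4 * s ^ 2 * S)) :=
    (Real.exp_pos _).le
  set E := Real.exp (-(Real.pi ^ 2 * μ * (2 * N) ^ 2) / (4 * s ^ 2 * S)) with hEdef
  have herf := erfc_nonneg √S
  have hb1 : √S / N ≤ 2 / √ε := by
    have : √ε * √S ≤ 2 * N := by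
      rw [← Real.sqrt_mul hε.le, ← Real.sqrt_sq (by positivity : (0 : ℝ) ≤ 2 * N)]
      exact Real.sqrt_le_sqrt hεS
    rw [div_le_div_iff₀ hN0 (Real.sqrt_pos.2 hε)]
    linarith
  rw [add_mul]
  rcases le_total (2 / Real.pi * S) (2 * N) with hc | hc
  · have hb2 : √S / N * √S ≤ Real.pi := by
      rw [div_mul_eq_mul_div, Real.mul_self_sqrt hS0.le, div_le_iff₀ hN0]
      have := mul_le_mul_of_nonneg_left hc hp.le
      field_simp at this
      linarith
    have hb3 : √S / N * Real.exp (-S) ≤ A * (Real.exp (-S) / (1 + √S)) := by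
      rw [← mul_div_assoc, le_div_iff₀ (by positivity)]
      have : √S / N * (1 + √S) ≤ A := by rw [mul_add, mul_one]; exact add_le_add hb1 hb2
      nlinarith [Real.exp_pos (-S)]
    have hb4 : Real.exp (-S) / (1 + √S) ≤ erfc √S / c₀ := by
      rw [le_div_iff₀ hc₀p, mul_comm]
      have := exp_neg_sq_div_le_erfc hsS.le
      rwa [Real.sq_sqrt hS0.le] at this
    have hb5 : 2 / √Real.pi * (√S / N * Real.exp (-S)) ≤
        2 / √Real.pi * A / c₀ * erfc √S := by
      calc _ ≤ 2 / √Real.pi * (A * (erfc √S / c₀)) := by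
            exact mul_le_mul_of_nonneg_left (hb3.trans (by gcongr)) (by positivity)
        _ = _ := by ring
    have h0 : 0 ≤ 2 / √Real.pi * (2 / √ε) * (E + erfc √S) := by positivity
    have h1 : 0 ≤ 2 / √Real.pi * A / c₀ * E := by positivity
    linarith
  · have hX : Real.exp (-S) ≤ E := by
      apply Real.exp_le_exp.2
      rw [neg_div, neg_le_neg_iff, div_le_iff₀ (by positivity)]
      have hμs : μ ≤ s ^ 2 := by linarith
      have h1 : (Real.pi * (2 * N)) ^ 2 ≤ (2 * S) ^ 2 := by
        have := mul_le_mul_of_nonneg_left hc hp.le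
        field_simp at this
        have h3 : Real.pi * (2 * N) ≤ 2 * S := by linarith
        gcongr
      have hμ : 0 ≤ μ := hε.le.trans hεμ
      calc Real.pi ^ 2 * μ * (2 * N) ^ 2 = μ * (Real.pi * (2 * N)) ^ 2 := by ring
        _ ≤ s ^ 2 * (2 * S) ^ 2 := by gcongr
        _ = _ := by ring
    have h1 : 2 / √Real.pi * (√S / N * Real.exp (-S)) ≤ 2 / √Real.pi * (2 / √ε) * E := by
      rw [mul_assoc]
      gcongr
    have h0 : 0 ≤ 2 / √Real.pi * A / c₀ * (E + erfc √S) := by positivity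
    have h2 : 0 ≤ 2 / √Real.pi * (2 / √ε) * erfc √S := by positivity
    linarith

/-- The error of the trapezoidal rule, integrated over the wave numbers of one direction. -/
theorem GaussBounded.exists_trapezoid_error_le' {ν : Measure ℝ} (hν : GaussBounded ν) {s ε : ℝ}
    (hs : 0 < s) (hε : 0 < ε) :
    ∃ C : ℝ, 0 ≤ C ∧ ∀ (a μ h H u S : ℝ) (N : ℕ) (v : ℝ → ℝ), 0 < a → ε ≤ μ → μ + a = s ^ 2 →
      0 < h → 0 < H → N * h = H → S = H ^ 2 / a → ε * S ≤ (2 * N) ^ 2 → |u| ≤ 1 / 2 →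
      IsGaussCutoff a H v →
      ∫ k, ‖(modeWeight μ a k : ℂ) * (trapezoid h u N v k - gaussOneHat a k)‖ ∂ν ≤
        C * (Real.exp (-(Real.pi ^ 2 * μ * (2 * N) ^ 2) / (4 * s ^ 2 * S)) + erfc √S) := by
  obtain ⟨C1, hC1, h1⟩ := hν.exists_trapezoid_error_le hs hε
  obtain ⟨C2, hC2, h2⟩ := exists_cutoff_term_le hs hε
  refine ⟨C1 * (1 + C2), by positivity, ?_⟩
  intro a μ h H u S N v ha hεμ hμa hh hH hN hS hεS hu hv
  refine (h1 a μ h H u S N v ha hεμ hμa hh hH hN hS hεS hu hv).trans ?_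
  rw [mul_assoc C1]
  refine mul_le_mul_of_nonneg_left ?_ hC1
  have := h2 a μ h H S N ha hεμ hμa hh hH hN hS hεS
  linarith

/-! ### The joint measure of wave vectors and separable mode integrals. -/

/-- The joint measure of the wave vectors. -/
def waveMeasure (L : Fin 3 → ℝ) : Measure (Fin 3 → ℝ) := Measure.pi (modeMeasure L)

lemma measurable_waveVec (L : Fin 3 → ℝ) :
    Measurable fun p : (ℤ × ℤ) × ℝ => waveVec L p.1 p.2 := by
  refine measurable_pi_iff.2 fun d => ?_
  fin_cases d <;> simp only [waveVec, Fin.zero_eta, Fin.mk_one, Fin.reduceFinMk, Matrix.cons_val]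
  · exact (measurable_of_countable fun n : ℤ => 2 * Real.pi * (n : ℝ) / L 0).comp
      (measurable_fst.comp measurable_fst)
  · exact (measurable_of_countable fun n : ℤ => 2 * Real.pi * (n : ℝ) / L 1).comp
      (measurable_snd.comp measurable_fst)
  · exact measurable_snd

lemma injective_waveVec {L : Fin 3 → ℝ} (hL : ∀ d, 0 < L d) :
    Function.Injective fun p : (ℤ × ℤ) × ℝ => waveVec L p.1 p.2 := by
  rintro ⟨⟨n1, n2⟩, κ⟩ ⟨⟨m1, m2⟩, κ'⟩ h
  have h0 := congrFun h 0
  have h1 := congrFun h 1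
  have h2 := congrFun h 2
  simp only [waveVec, Matrix.cons_val] at h0 h1 h2
  have e0 := (measurableEmbedding_waveNumber (hL 0)).injective h0
  have e1 := (measurableEmbedding_waveNumber (hL 1)).injective h1
  subst e0 e1 h2
  rfl

lemma measurableEmbedding_waveVec {L : Fin 3 → ℝ} (hL : ∀ d, 0 < L d) :
    MeasurableEmbedding fun p : (ℤ × ℤ) × ℝ => waveVec L p.1 p.2 :=
  (measurable_waveVec L).measurableEmbedding (injective_waveVec hL)

/-- Links the product measure, for which integrals of separable functions factor, with the
parametrization by lattice modes and κ that underlies `mixedSum`. -/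
lemma waveMeasure_eq_map {L : Fin 3 → ℝ} (hL : ∀ d, 0 < L d) :
    waveMeasure L = Measure.map (fun p : (ℤ × ℤ) × ℝ => waveVec L p.1 p.2)
      ((Measure.count.prod Measure.count).prod volume) := by
  have := sigmaFinite_modeMeasure hL
  refine Measure.pi_eq fun t ht => ?_
  have e : (fun p : (ℤ × ℤ) × ℝ => waveVec L p.1 p.2) ⁻¹' (univ.pi t) =
      (((fun n : ℤ => 2 * Real.pi * n / L 0) ⁻¹' t 0) ×ˢ
        ((fun n : ℤ => 2 * Real.pi * n / L 1) ⁻¹' t 1)) ×ˢ t 2 := by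
    ext p
    simp [Fin.forall_fin_succ, waveVec, and_assoc]
  rw [Measure.map_apply (measurable_waveVec L) (MeasurableSet.univ_pi ht), e,
    Measure.prod_prod, Measure.prod_prod, Fin.prod_univ_three]
  simp only [modeMeasure, Fin.reduceEq, if_false, if_true]
  rw [Measure.map_apply (measurable_of_countable _) (ht 0),
    Measure.map_apply (measurable_of_countable _) (ht 1)]

/-- The measure is carried by the admissible wave vectors, and these are the only points where Λ
controls the structure factor or where phases are periodic in x and y. -/
lemma ae_waveMeasure {L : Fin 3 → ℝ} (hL : ∀ d, 0 < L d) {p : (Fin 3 → ℝ) → Prop}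
    (h : ∀ n κ, p (waveVec L n κ)) : ∀ᵐ k ∂waveMeasure L, p k := by
  rw [waveMeasure_eq_map hL]
  filter_upwards [ae_map_mem_range (fun p : (ℤ × ℤ) × ℝ => waveVec L p.1 p.2)
    (measurableEmbedding_waveVec hL).measurableSet_range _]
  rintro _ ⟨q, rfl⟩
  exact h _ _

lemma integral_waveMeasure {L : Fin 3 → ℝ} (hL : ∀ d, 0 < L d) {g : (Fin 3 → ℝ) → ℂ}
    (hg : Integrable g (waveMeasure L)) :
    Integrable (fun n : ℤ × ℤ => ∫ κ : ℝ, g (waveVec L n κ)) (Measure.count.prod Measure.count) ∧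
    ∫ k, g k ∂waveMeasure L =
      ∫ n : ℤ × ℤ, (∫ κ : ℝ, g (waveVec L n κ)) ∂(Measure.count.prod Measure.count) := by
  rw [waveMeasure_eq_map hL] at hg ⊢
  rw [(measurableEmbedding_waveVec hL).integrable_map_iff] at hg
  rw [(measurableEmbedding_waveVec hL).integral_map]
  exact ⟨hg.integral_prod_left, integral_prod _ hg⟩

lemma mixedSum_eq {L : Fin 3 → ℝ} (hL : ∀ d, 0 < L d) {g : (Fin 3 → ℝ) → ℂ}
    (hg : Integrable g (waveMeasure L)) :
    mixedSum L g = 1 / ((2 * Real.pi * L 0 * L 1 : ℝ) : ℂ) * ∫ k, g k ∂waveMeasure L := by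
  obtain ⟨h1, h2⟩ := integral_waveMeasure hL hg
  have e : ∀ n : ℤ × ℤ, ((Measure.count : Measure ℤ).prod (Measure.count : Measure ℤ)).real {n}
      = 1 := by
    rintro ⟨n1, n2⟩
    rw [← Set.singleton_prod_singleton, measureReal_def, Measure.prod_prod]
    simp
  rw [h2, integral_countable h1, mixedSum]
  simp_rw [e, one_smul]

/-- A separable multiplier times the structure factor, integrated over all wave vectors. -/
def modeIntegral (L : Fin 3 → ℝ) (ρ : (Fin 3 → ℝ) → ℂ) (f : Fin 3 → ℝ → ℂ) : ℂ :=
  ∫ k, (∏ d, f d (k d)) * ρ k ∂waveMeasure L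

lemma integrable_mode {L : Fin 3 → ℝ} (hL : ∀ d, 0 < L d) {ρ : (Fin 3 → ℝ) → ℂ}
    (hρ : Continuous ρ) {C : ℝ} (hC : ∀ k, ‖ρ k‖ ≤ C) {f : Fin 3 → ℝ → ℂ}
    (hf : ∀ d, Integrable (f d) (modeMeasure L d)) :
    Integrable (fun k => (∏ d, f d (k d)) * ρ k) (waveMeasure L) := by
  have := sigmaFinite_modeMeasure hL
  have h1 : Integrable (fun k : Fin 3 → ℝ => ∏ d, f d (k d)) (waveMeasure L) :=
    Integrable.fintype_prod hf
  simp_rw [mul_comm _ (ρ _)]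
  exact h1.bdd_mul hρ.aestronglyMeasurable (ae_of_all _ hC)

lemma norm_modeIntegral_le {L : Fin 3 → ℝ} (hL : ∀ d, 0 < L d) {ρ : (Fin 3 → ℝ) → ℂ} {Λ : ℝ}
    (hΛ : ∀ n κ, ‖ρ (waveVec L n κ)‖ ≤ Λ) {f : Fin 3 → ℝ → ℂ}
    (hf : ∀ d, Integrable (f d) (modeMeasure L d)) :
    ‖modeIntegral L ρ f‖ ≤ Λ * ∏ d, ∫ k, ‖f d k‖ ∂modeMeasure L d := by
  have := sigmaFinite_modeMeasure hL
  have h1 : Integrable (fun k : Fin 3 → ℝ => ∏ d, ‖f d (k d)‖) (waveMeasure L) :=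
    Integrable.fintype_prod (f := fun d k => ‖f d k‖) fun d => (hf d).norm
  have h2 : ∫ k, ∏ d, ‖f d (k d)‖ ∂waveMeasure L = ∏ d, ∫ k, ‖f d k‖ ∂modeMeasure L d :=
    integral_fintype_prod_eq_prod (fun d k => ‖f d k‖)
  rw [← h2, ← integral_const_mul]
  refine norm_integral_le_of_norm_le (h1.const_mul Λ) ?_
  filter_upwards [ae_waveMeasure hL (p := fun k => ‖ρ k‖ ≤ Λ) hΛ] with k hk
  rw [norm_mul, norm_prod, mul_comm]
  gcongr

/-- The change of a mode integral under a change of the three factors. -/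
lemma norm_modeIntegral_sub_le {L : Fin 3 → ℝ} (hL : ∀ d, 0 < L d) {ρ : (Fin 3 → ℝ) → ℂ}
    (hρ : Continuous ρ) {C : ℝ} (hC : ∀ k, ‖ρ k‖ ≤ C) {Λ : ℝ}
    (hΛ : ∀ n κ, ‖ρ (waveVec L n κ)‖ ≤ Λ) {f g : Fin 3 → ℝ → ℂ}
    (hf : ∀ d, Integrable (f d) (modeMeasure L d)) (hg : ∀ d, Integrable (g d) (modeMeasure L d)) :
    ‖modeIntegral L ρ f - modeIntegral L ρ g‖ ≤
      Λ * ((∫ k, ‖f 0 k - g 0 k‖ ∂modeMeasure L 0) * (∫ k, ‖f 1 k‖ ∂modeMeasure L 1) *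
          (∫ k, ‖f 2 k‖ ∂modeMeasure L 2) +
        (∫ k, ‖g 0 k‖ ∂modeMeasure L 0) * (∫ k, ‖f 1 k - g 1 k‖ ∂modeMeasure L 1) *
          (∫ k, ‖f 2 k‖ ∂modeMeasure L 2) +
        (∫ k, ‖g 0 k‖ ∂modeMeasure L 0) * (∫ k, ‖g 1 k‖ ∂modeMeasure L 1) *
          (∫ k, ‖f 2 k - g 2 k‖ ∂modeMeasure L 2)) := by
  -- Telescoping of f₀f₁f₂ - g₀g₁g₂: one factor at a time is exchanged.
  set A : Fin 3 → ℝ → ℂ := ![fun k => f 0 k - g 0 k, f 1, f 2]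
  set B : Fin 3 → ℝ → ℂ := ![g 0, fun k => f 1 k - g 1 k, f 2]
  set D : Fin 3 → ℝ → ℂ := ![g 0, g 1, fun k => f 2 k - g 2 k]
  have hA : ∀ d, Integrable (A d) (modeMeasure L d) := by
    intro d; fin_cases d
    · exact (hf 0).sub (hg 0)
    · exact hf 1
    · exact hf 2
  have hB : ∀ d, Integrable (B d) (modeMeasure L d) := by
    intro d; fin_cases d
    · exact hg 0
    · exact (hf 1).sub (hg 1)
    · exact hf 2
  have hD : ∀ d, Integrable (D d) (modeMeasure L d) := by
    intro d; fin_cases d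
    · exact hg 0
    · exact hg 1
    · exact (hf 2).sub (hg 2)
  have e : modeIntegral L ρ f - modeIntegral L ρ g =
      modeIntegral L ρ A + modeIntegral L ρ B + modeIntegral L ρ D := by
    have iA := integrable_mode hL hρ hC hA
    have iB := integrable_mode hL hρ hC hB
    have iD := integrable_mode hL hρ hC hD
    have iAB : Integrable (fun k => (∏ d, A d (k d)) * ρ k + (∏ d, B d (k d)) * ρ k)
      (waveMeasure L) := iA.add iB
    unfold modeIntegral
    rw [← integral_sub (integrable_mode hL hρ hC hf) (integrable_mode hL hρ hC hg),
      ← integral_add iA iB, ← integral_add iAB iD]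
    congr 1
    ext k
    simp only [Fin.prod_univ_three, A, B, D, Matrix.cons_val]
    ring
  have nA := norm_modeIntegral_le hL hΛ hA
  have nB := norm_modeIntegral_le hL hΛ hB
  have nD := norm_modeIntegral_le hL hΛ hD
  simp only [Fin.prod_univ_three, A, B, D, Matrix.cons_val] at nA nB nD
  rw [e, mul_add, mul_add]
  exact (norm_add₃_le).trans (add_le_add_three nA nB nD)

/-! ### The structure factor -/

section StructureFactor
variable {N : ℕ} (q : Fin N → ℝ) (r : Fin N → Fin 3 → ℝ)

lemma norm_planeWave (k x : Fin 3 → ℝ) : ‖planeWave k x‖ = 1 := norm_planePhase _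

lemma continuous_planeWave_left (x : Fin 3 → ℝ) : Continuous fun k => planeWave k x := by
  unfold planeWave; fun_prop

lemma planeWave_eq_prod (k x : Fin 3 → ℝ) :
    planeWave k x = ∏ d, Complex.exp (Complex.I * (k d * x d : ℝ)) := by
  rw [planeWave, ← Complex.exp_sum, Complex.ofReal_sum, Finset.mul_sum]

lemma continuous_structureFactor : Continuous (structureFactor q r) := by
  unfold structureFactor planeWave; fun_prop

lemma norm_structureFactor_le (k : Fin 3 → ℝ) : ‖structureFactor q r k‖ ≤ ∑ j, |q j| := by
  refine (norm_sum_le _ _).trans (Finset.sum_le_sum fun j _ => ?_)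
  rw [norm_mul, norm_planeWave, mul_one, Complex.norm_real, Real.norm_eq_abs]

lemma norm_structureFactor_le_structureSup (L : Fin 3 → ℝ) (n : ℤ × ℤ) (κ : ℝ) :
    ‖structureFactor q r (waveVec L n κ)‖ ≤ structureSup L q r := by
  refine le_ciSup (f := fun p : (ℤ × ℤ) × ℝ => ‖structureFactor q r (waveVec L p.1 p.2)‖)
    ⟨∑ j, |q j|, ?_⟩ (n, κ)
  rintro _ ⟨p, rfl⟩
  exact norm_structureFactor_le q r _

lemma structureSup_nonneg (L : Fin 3 → ℝ) : 0 ≤ structureSup L q r :=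
  (norm_nonneg _).trans (norm_structureFactor_le_structureSup q r L 0 0)

lemma sum_mul_planeWave_sub (k x : Fin 3 → ℝ) :
    ∑ j, (q j : ℂ) * planeWave k (x - r j) = planeWave k x * structureFactor q r k := by
  rw [structureFactor, Finset.mul_sum]
  refine Finset.sum_congr rfl fun j _ => ?_
  rw [mul_left_comm, planeWave, planeWave, planeWave, ← Complex.exp_add, ← mul_add,
    ← Complex.ofReal_add, ← Finset.sum_add_distrib]
  congr 4
  exact_mod_cast Finset.sum_congr rfl fun d _ => by simp; ring

end StructureFactor

/-! ### The mid-range potential and the gathering sum as mode potentials. -/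

/-- Continuous functions with bounded values. -/
def IsBddCont (f : ℝ → ℂ) : Prop := Continuous f ∧ ∃ C : ℝ, ∀ k, ‖f k‖ ≤ C

lemma IsBddCont.mul {f g : ℝ → ℂ} (hf : IsBddCont f) (hg : IsBddCont g) :
    IsBddCont fun k => f k * g k := by
  obtain ⟨hf, C, hC⟩ := hf
  obtain ⟨hg, D, hD⟩ := hg
  refine ⟨hf.mul hg, C * D, fun k => ?_⟩
  rw [norm_mul]
  exact mul_le_mul (hC k) (hD k) (norm_nonneg _) ((norm_nonneg _).trans (hC k))

lemma isBddCont_phase (x : ℝ) : IsBddCont fun k => Complex.exp (Complex.I * (k * x : ℝ)) :=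
  ⟨by fun_prop, 1, fun k => (norm_planePhase _).le⟩

lemma isBddCont_gaussOneHat {a : ℝ} (ha : 0 < a) : IsBddCont fun k => (gaussOneHat a k : ℂ) := by
  refine ⟨Complex.continuous_ofReal.comp (continuous_gaussOneHat a), √(Real.pi * a), fun k => ?_⟩
  rw [Complex.norm_real, Real.norm_of_nonneg (gaussOneHat_nonneg _ _)]
  exact gaussOneHat_le a k ha

lemma isBddCont_trapezoid (h u : ℝ) (N : ℕ) (v : ℝ → ℝ) : IsBddCont (trapezoid h u N v) :=
  ⟨continuous_trapezoid h u N v, _, norm_trapezoid_le h u N v⟩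

section Window
variable {S : ℝ} {H : Fin 3 → ℝ}

lemma gaussWindow_eq_prod (x : Fin 3 → ℝ) :
    gaussWindow S H x = ∏ d, gaussOne (H d ^ 2 / S) (x d) := by
  unfold gaussWindow gaussOne
  refine Finset.prod_congr rfl fun d _ => ?_
  rw [div_pow, div_div_eq_mul_div]
  ring_nf

lemma gaussWindowHat_eq_prod (hS : 0 < S) (hH : ∀ d, 0 < H d) (k : Fin 3 → ℝ) :
    gaussWindowHat S H k = ∏ d, gaussOneHat (H d ^ 2 / S) (k d) := by
  unfold gaussWindowHat gaussOneHat
  refine Finset.prod_congr rfl fun d _ => ?_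
  have h1 : √(Real.pi / S) * H d = √(Real.pi * (H d ^ 2 / S)) := by
    rw [show Real.pi * (H d ^ 2 / S) = Real.pi / S * H d ^ 2 by ring,
      Real.sqrt_mul (by positivity [Real.pi_pos]), Real.sqrt_sq (hH d).le]
  rw [h1]
  congr 2
  field_simp

lemma gaussWindowHat_pos (hS : 0 < S) (hH : ∀ d, 0 < H d) (k : Fin 3 → ℝ) :
    0 < gaussWindowHat S H k := by
  have := Real.pi_pos
  exact Finset.prod_pos fun d _ => by have := hH d; positivity

end Window

section Weight
variable {m : ℕ} (w s : Fin (m + 1) → ℝ) (S : ℝ) (H : Fin 3 → ℝ)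

/-- The quotient of the multiplier of the mid-range potential and the transformed window. -/
def scalWeight (k : Fin 3 → ℝ) : ℝ := midMultiplier w s k / gaussWindowHat S H k

/-- The separable part of `scalWeight` which belongs to one of the Gaussians. -/
def modeFactor (l : Fin (m + 1)) (B : Fin 3 → ℝ → ℂ) (d : Fin 3) (k : ℝ) : ℂ :=
  (modeWeight (mu (s l) S (H d)) (H d ^ 2 / S) k : ℂ) * B d k

/-- The potential belonging to the multiplier `scalWeight · ∏ B_d`. -/
def modePotential (L : Fin 3 → ℝ) (ρ : (Fin 3 → ℝ) → ℂ) (B : Fin 3 → ℝ → ℂ) : ℂ :=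
  ∫ k, (scalWeight w s S H k : ℂ) * ((∏ d, B d (k d)) * ρ k) ∂waveMeasure L

variable {w s S H}

/-- Both |k|² in the exponent and the transformed window split over the directions. Division by the
window lowers the exponent s² to μ = s² - H²/S in each of them. -/
lemma scalWeight_eq_sum (hS : 0 < S) (hH : ∀ d, 0 < H d) (hs : ∀ l, s l ≠ 0) (k : Fin 3 → ℝ) :
    scalWeight w s S H k = ∑ l, √Real.pi / 4 * w l * s l ^ 3 *
      ∏ d, modeWeight (mu (s l) S (H d)) (H d ^ 2 / S) (k d) := by
  rw [scalWeight, div_eq_iff (gaussWindowHat_pos hS hH k).ne', gaussWindowHat_eq_prod hS hH,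
    Finset.sum_mul, midMultiplier, Finset.mul_sum]
  refine Finset.sum_congr rfl fun l _ => ?_
  rw [mul_assoc _ (∏ d, _) (∏ d, _), ← Finset.prod_mul_distrib]
  have e : ∀ d, modeWeight (mu (s l) S (H d)) (H d ^ 2 / S) (k d) *
      gaussOneHat (H d ^ 2 / S) (k d) = Real.exp (-(s l ^ 2 * k d ^ 2) / 4) := by
    intro d
    rw [modeWeight_mul_gaussOneHat_self (s := s l) (div_pos (pow_pos (hH d) 2) hS) (hs l)
      (by unfold mu; ring), gaussOne]
    congr 1
    rw [div_div_eq_mul_div]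
    ring
  simp_rw [e, ← Real.exp_sum, ← Finset.sum_div, Finset.sum_neg_distrib, ← Finset.mul_sum]
  ring

variable {L : Fin 3 → ℝ} {ρ : (Fin 3 → ℝ) → ℂ} {B : Fin 3 → ℝ → ℂ}

lemma integrable_modeFactor (hL : ∀ d, 0 < L d) {l : Fin (m + 1)}
    (hμ : ∀ d, 0 < mu (s l) S (H d)) (hB : ∀ d, IsBddCont (B d)) (d : Fin 3) :
    Integrable (modeFactor s S H l B d) (modeMeasure L d) := by
  obtain ⟨hc, C, hC⟩ := hB d
  exact (gaussBounded_modeMeasure hL d).integrable_modeWeight_mul (hμ d) hc hC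

lemma scalWeight_mul_eq_sum (hS : 0 < S) (hH : ∀ d, 0 < H d) (hs : ∀ l, s l ≠ 0)
    (k : Fin 3 → ℝ) :
    (scalWeight w s S H k : ℂ) * ((∏ d, B d (k d)) * ρ k) =
      ∑ l, ((√Real.pi / 4 * w l * s l ^ 3 : ℝ) : ℂ) *
        ((∏ d, modeFactor s S H l B d (k d)) * ρ k) := by
  rw [scalWeight_eq_sum hS hH hs, Complex.ofReal_sum, Finset.sum_mul]
  refine Finset.sum_congr rfl fun l _ => ?_
  unfold modeFactor
  rw [Finset.prod_mul_distrib, Complex.ofReal_mul, Complex.ofReal_prod]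
  ring

lemma integrable_scalWeight_mul (hL : ∀ d, 0 < L d) (hS : 0 < S) (hH : ∀ d, 0 < H d)
    (hs : ∀ l, s l ≠ 0) (hμ : ∀ d l, 0 < mu (s l) S (H d)) (hρ : Continuous ρ) {C : ℝ}
    (hC : ∀ k, ‖ρ k‖ ≤ C) (hB : ∀ d, IsBddCont (B d)) :
    Integrable (fun k => (scalWeight w s S H k : ℂ) * ((∏ d, B d (k d)) * ρ k))
      (waveMeasure L) := by
  simp_rw [scalWeight_mul_eq_sum hS hH hs]
  exact integrable_finsetSum _ fun l _ => (integrable_mode hL hρ hC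
    (integrable_modeFactor hL (fun d => hμ d l) hB)).const_mul _

lemma modePotential_eq_sum (hL : ∀ d, 0 < L d) (hS : 0 < S) (hH : ∀ d, 0 < H d)
    (hs : ∀ l, s l ≠ 0) (hμ : ∀ d l, 0 < mu (s l) S (H d)) (hρ : Continuous ρ) {C : ℝ}
    (hC : ∀ k, ‖ρ k‖ ≤ C) (hB : ∀ d, IsBddCont (B d)) :
    modePotential w s S H L ρ B =
      ∑ l, ((√Real.pi / 4 * w l * s l ^ 3 : ℝ) : ℂ) *
        modeIntegral L ρ (modeFactor s S H l B) := by
  unfold modePotential modeIntegral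
  simp_rw [scalWeight_mul_eq_sum hS hH hs]
  rw [integral_finsetSum _ fun l _ => (integrable_mode hL hρ hC
    (integrable_modeFactor hL (fun d => hμ d l) hB)).const_mul _]
  simp_rw [integral_const_mul]

end Weight

/-- The normalizing factor of `mixedSum`. -/
def mixedFactor (L : Fin 3 → ℝ) : ℂ := 1 / ((2 * Real.pi * L 0 * L 1 : ℝ) : ℂ)

section Potentials
variable {m : ℕ} {w s : Fin (m + 1) → ℝ} {S : ℝ} {H L : Fin 3 → ℝ} {N : ℕ} (q : Fin N → ℝ)
  (r : Fin N → Fin 3 → ℝ)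

/-- Multiplying and dividing by the transformed window brings the exact potential to the common
form, so that it can be compared factor by factor with the approximations. -/
lemma midPotential_eq (hL : ∀ d, 0 < L d) (hS : 0 < S) (hH : ∀ d, 0 < H d)
    (hs : ∀ l, s l ≠ 0) (hμ : ∀ d l, 0 < mu (s l) S (H d)) (x : Fin 3 → ℝ) :
    midPotential L w s q r x = 4 * Real.pi * (mixedFactor L *
      modePotential w s S H L (structureFactor q r) fun d k =>
        (gaussOneHat (H d ^ 2 / S) k : ℂ) * Complex.exp (Complex.I * (k * x d : ℝ))) := by
  have ha : ∀ d, 0 < H d ^ 2 / S := fun d => div_pos (pow_pos (hH d) 2) hS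
  have hmid : ∀ k, (midMultiplier w s k : ℂ) =
      (scalWeight w s S H k : ℂ) * ∏ d, (gaussOneHat (H d ^ 2 / S) (k d) : ℂ) := by
    intro k
    rw [← Complex.ofReal_prod, ← gaussWindowHat_eq_prod hS hH, ← Complex.ofReal_mul, scalWeight,
      div_mul_cancel₀ _ (gaussWindowHat_pos hS hH k).ne']
  have hint : ∀ j, Integrable (fun k => (midMultiplier w s k : ℂ) * planeWave k (x - r j))
      (waveMeasure L) := by
    intro j
    simp_rw [hmid, mul_assoc]
    exact integrable_scalWeight_mul (B := fun d k => (gaussOneHat (H d ^ 2 / S) k : ℂ)) hL hS hH hs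
      hμ (continuous_planeWave_left _) (fun k => (norm_planeWave k _).le)
      fun d => isBddCont_gaussOneHat (ha d)
  unfold midPotential
  congr 1
  simp_rw [fun j => mixedSum_eq hL (hint j)]
  change ∑ j, (q j : ℂ) * (mixedFactor L * _) = _
  simp_rw [mul_left_comm _ (mixedFactor L), ← Finset.mul_sum, ← integral_const_mul]
  rw [← integral_finsetSum _ fun j _ => (hint j).const_mul _]
  congr 1
  refine integral_congr_ae (ae_of_all _ fun k => ?_)
  simp only [mul_left_comm _ (midMultiplier w s k : ℂ), ← Finset.mul_sum]
  rw [sum_mul_planeWave_sub, hmid, planeWave_eq_prod, Finset.prod_mul_distrib]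
  ring

lemma scalHat_mul_planeWave (hS : 0 < S) (hH : ∀ d, 0 < H d) (k x : Fin 3 → ℝ) :
    scalHat w s S H q r k * planeWave k x = (scalWeight w s S H k : ℂ) *
      ((∏ d, Complex.exp (Complex.I * (k d * x d : ℝ))) * structureFactor q r k) := by
  have h1 : gridHat S H q r k = gaussWindowHat S H k * structureFactor q r k := by
    rw [gridHat, structureFactor, Finset.mul_sum]
    exact Finset.sum_congr rfl fun j _ => by ring
  have h2 := gaussWindowHat_pos hS hH k
  have h3 : (gaussWindowHat S H k : ℂ) ≠ 0 := by exact_mod_cast h2.ne'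
  rw [scalHat, h1, planeWave_eq_prod, scalWeight, abs_of_pos h2]
  push_cast
  field_simp

lemma integrable_scalWeight_mul_phase (hL : ∀ d, 0 < L d) (hS : 0 < S) (hH : ∀ d, 0 < H d)
    (hs : ∀ l, s l ≠ 0) (hμ : ∀ d l, 0 < mu (s l) S (H d)) (x : Fin 3 → ℝ) :
    Integrable (fun k : Fin 3 → ℝ => (scalWeight w s S H k : ℂ) *
      ((∏ d, Complex.exp (Complex.I * (k d * x d : ℝ))) * structureFactor q r k))
      (waveMeasure L) :=
  integrable_scalWeight_mul (B := fun d k => Complex.exp (Complex.I * (k * x d : ℝ))) hL hS hH hs hμ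
    (continuous_structureFactor q r) (norm_structureFactor_le q r) fun d => isBddCont_phase (x d)

lemma scal_eq (hL : ∀ d, 0 < L d) (hS : 0 < S) (hH : ∀ d, 0 < H d)
    (hs : ∀ l, s l ≠ 0) (hμ : ∀ d l, 0 < mu (s l) S (H d)) (x : Fin 3 → ℝ) :
    scal L w s S H q r x = mixedFactor L *
      modePotential w s S H L (structureFactor q r) fun d k =>
        Complex.exp (Complex.I * (k * x d : ℝ)) := by
  unfold scal
  rw [mixedSum_eq hL]
  · simp_rw [scalHat_mul_planeWave q r hS hH]
    rfl
  · simp_rw [scalHat_mul_planeWave q r hS hH]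
    exact integrable_scalWeight_mul_phase q r hL hS hH hs hμ x

/-- The grid points are x + (n - u) ∘ h, so the phase at x factors out and the sum over the index
box is a product of one-dimensional sums. The hypothesis on V is stated at -y because the window is
evaluated at u ∘ h - n ∘ h. -/
lemma gatherSum_eq (hL : ∀ d, 0 < L d) (hS : 0 < S) (hH : ∀ d, 0 < H d)
    (hs : ∀ l, s l ≠ 0) (hμ : ∀ d l, 0 < mu (s l) S (H d)) {V : (Fin 3 → ℝ) → ℝ}
    {v : Fin 3 → ℝ → ℝ} (hV : ∀ y : Fin 3 → ℝ, V (fun d => -y d) = ∏ d, v d (y d)) (h : Fin 3 → ℝ)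
    (P : Fin 3 → ℕ) (u x : Fin 3 → ℝ) :
    gatherSum L w s S H q r V h P u x = 4 * Real.pi * (mixedFactor L *
      modePotential w s S H L (structureFactor q r) fun d k =>
        trapezoid (h d) (u d) ((P d - 1) / 2) (v d) k *
          Complex.exp (Complex.I * (k * x d : ℝ))) := by
  unfold gatherSum
  rw [mul_assoc]
  congr 1
  have e1 : ∀ n : Fin 3 → ℤ, V (fun d => u d * h d - n d * h d) =
      ∏ d, v d ((n d - u d) * h d) := by
    intro n
    rw [← hV]
    congr 1
    ext d
    ring
  have hi := integrable_scalWeight_mul_phase (w := w) q r hL hS hH hs hμ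
  simp_rw [scal_eq q r hL hS hH hs hμ, e1, Finset.mul_sum]
  unfold modePotential
  have e0 : ∀ a b X : ℂ, a * (mixedFactor L * X * b) = mixedFactor L * (a * (X * b)) := by
    intro a b X; ring
  simp_rw [e0, ← Finset.mul_sum]
  congr 1
  simp_rw [← integral_mul_const]
  rw [← integral_finsetSum _ fun n _ => (hi _).mul_const _, ← integral_const_mul]
  refine integral_congr_ae (ae_of_all _ fun k => ?_)
  have e2 : ∏ d, (trapezoid (h d) (u d) ((P d - 1) / 2) (v d) (k d) *
      Complex.exp (Complex.I * (k d * x d : ℝ))) = ∑ n ∈ gridIndices P,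
        ∏ d, ((h d : ℂ) * Complex.exp (Complex.I *
          (k d * (x d - u d * h d + n d * h d) : ℝ)) * (v d ((n d - u d) * h d) : ℂ)) := by
    rw [gridIndices, ← Finset.prod_univ_sum (fun d => Finset.Icc (-(((P d - 1) / 2 : ℕ) : ℤ))
      (((P d - 1) / 2 : ℕ) : ℤ)) (fun d (n : ℤ) => (h d : ℂ) * Complex.exp (Complex.I *
          (k d * (x d - u d * h d + n * h d) : ℝ)) * (v d ((n - u d) * h d) : ℂ))]
    refine Finset.prod_congr rfl fun d _ => ?_
    rw [trapezoid, Finset.mul_sum, Finset.sum_mul]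
    refine Finset.sum_congr rfl fun n _ => ?_
    have : Complex.exp (Complex.I * (k d * (x d - u d * h d + n * h d) : ℝ)) =
        Complex.exp (Complex.I * (k d * ((n - u d) * h d) : ℝ)) *
          Complex.exp (Complex.I * (k d * x d : ℝ)) := by
      rw [← Complex.exp_add]
      congr 1
      push_cast
      ring
    rw [this]
    ring
  simp only [e2, Finset.sum_mul, Finset.mul_sum]
  refine Finset.sum_congr rfl fun n _ => ?_
  simp only [Finset.prod_mul_distrib, Complex.ofReal_prod]
  ring

end Potentials

/-! ### The periodized window and the confined potential as a mode potential. -/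

/-- The one-dimensional Gaussian, made periodic. -/
def periodicGauss (a l t : ℝ) : ℝ := ∑' n : ℤ, gaussOne a (t + n * l)

lemma summable_gaussOne_add {a l : ℝ} (ha : 0 < a) (hl : 0 < l) (t : ℝ) :
    Summable fun n : ℤ => gaussOne a (t + n * l) := by
  refine (summable_gaussOne_grid ha hl (-t / l)).congr fun n => ?_
  congr 1
  field_simp
  ring

lemma measurable_periodicGauss (a l : ℝ) : Measurable (periodicGauss a l) := by
  unfold periodicGauss
  exact Measurable.tsum fun n => ((continuous_gaussOne a).comp
    (continuous_id.add continuous_const)).measurable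

lemma periodicGauss_nonneg (a l t : ℝ) : 0 ≤ periodicGauss a l t :=
  tsum_nonneg fun _ => (gaussOne_pos _ _).le

lemma exists_periodicGauss_le {a l : ℝ} (ha : 0 < a) (hl : 0 < l) :
    ∃ C : ℝ, ∀ t, periodicGauss a l t ≤ C := by
  refine ⟨(2 * l * gaussOne a 0 + √(Real.pi * a) * erfc (0 / √a)) / l, fun t => ?_⟩
  refine le_trans (le_of_eq (tsum_congr fun n => ?_)) (tsum_gaussOne_grid_le ha hl (-t / l))
  congr 1
  field_simp
  ring

lemma integrable_phase_mul_gaussOne {a : ℝ} (ha : 0 < a) (k x : ℝ) :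
    Integrable fun y : ℝ => Complex.exp (Complex.I * (k * y : ℝ)) * (gaussOne a (x - y) : ℂ) := by
  refine Integrable.bdd_mul (c := 1) ((integrable_gaussOne ha).comp_sub_left x).ofReal
    (Continuous.aestronglyMeasurable (by fun_prop)) (ae_of_all _ fun y => (norm_planePhase _).le)

lemma integral_phase_mul_gaussOne {a : ℝ} (ha : 0 < a) (k x : ℝ) :
    ∫ y : ℝ, Complex.exp (Complex.I * (k * y : ℝ)) * (gaussOne a (x - y) : ℂ) =
      gaussOneHat a k * Complex.exp (Complex.I * (k * x : ℝ)) := by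
  rw [← integral_cexp_mul_gaussOne ha k, ← integral_mul_const,
    ← integral_add_right_eq_self _ x]
  refine integral_congr_ae (ae_of_all _ fun y => ?_)
  simp only
  rw [show x - (y + x) = -y by ring, gaussOne_neg, mul_right_comm, ← Complex.exp_add]
  congr 2
  push_cast
  ring

lemma hasSum_intervalIntegral_translate {E : Type*} [NormedAddCommGroup E] [NormedSpace ℝ E]
    {F : ℝ → E} (hF : Integrable F) {l : ℝ} (hl : 0 < l) :
    HasSum (fun j : ℤ => ∫ y in (-(l / 2))..(l / 2), F (y - j * l)) (∫ y, F y) := by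
  have h1 : Integrable fun t => F (l * t) := hF.comp_mul_left' hl.ne'
  have h2 := (h1.hasSum_intervalIntegral (-(1 / 2))).const_smul l
  rw [Measure.integral_comp_mul_left, abs_of_pos (inv_pos.2 hl), smul_inv_smul₀ hl.ne'] at h2
  refine ((Equiv.neg ℤ).hasSum_iff.2 h2).congr_fun fun j => ?_
  simp only [Function.comp, Equiv.neg_apply]
  rw [intervalIntegral.integral_comp_mul_left (fun t => F t) hl.ne',
    intervalIntegral.integral_comp_sub_right (fun t => F t), smul_inv_smul₀ hl.ne']
  push_cast
  congr 1 <;> ring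

/-- Unfolding: a phase with k in (2π/l)ℤ is l-periodic, so one period against the periodized
Gaussian equals the whole line against the Gaussian. Thus the restriction to a box costs nothing in
x and y. -/
lemma integral_phase_mul_periodicGauss {a l : ℝ} (ha : 0 < a) (hl : 0 < l) (n : ℤ) (x : ℝ) :
    ∫ y in Icc (-(l / 2)) (l / 2), Complex.exp (Complex.I * (2 * Real.pi * n / l * y : ℝ)) *
        (periodicGauss a l (x - y) : ℂ) =
      gaussOneHat a (2 * Real.pi * n / l) *
        Complex.exp (Complex.I * (2 * Real.pi * n / l * x : ℝ)) := by
  set k : ℝ := 2 * Real.pi * n / l with hk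
  set F : ℝ → ℂ := fun y => Complex.exp (Complex.I * (k * y : ℝ)) * (gaussOne a (x - y) : ℂ)
  have hF : Integrable F := integrable_phase_mul_gaussOne ha k x
  have hshift : ∀ (j : ℤ) (y : ℝ), F (y - j * l) =
      Complex.exp (Complex.I * (k * y : ℝ)) * (gaussOne a (x - y + j * l) : ℂ) := by
    intro j y
    simp only [F]
    congr 1
    · rw [Complex.exp_eq_exp_iff_exists_int]
      refine ⟨-(n * j), ?_⟩
      rw [hk]
      have : (l : ℂ) ≠ 0 := by exact_mod_cast hl.ne'
      push_cast
      field_simp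
      ring
    · congr 2; ring
  have key := hasSum_intervalIntegral_translate hF hl
  have hle : -(l / 2) ≤ l / 2 := by linarith
  have keyn : Summable fun j : ℤ => ∫ y in Icc (-(l / 2)) (l / 2), ‖F (y - j * l)‖ := by
    simp_rw [integral_Icc_eq_integral_Ioc, ← intervalIntegral.integral_of_le hle]
    exact (hasSum_intervalIntegral_translate hF.norm hl).summable
  have hsw := integral_tsum_of_summable_integral_norm
    (μ := volume.restrict (Icc (-(l / 2)) (l / 2))) (F := fun (j : ℤ) y => F (y - j * l))
    (fun j => (hF.comp_sub_right _).integrableOn) keyn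
  rw [← integral_phase_mul_gaussOne ha k x, ← key.tsum_eq]
  simp_rw [intervalIntegral.integral_of_le hle, ← integral_Icc_eq_integral_Ioc]
  rw [hsw]
  refine integral_congr_ae (ae_of_all _ fun y => ?_)
  simp only [hshift, periodicGauss]
  rw [Complex.ofReal_tsum, tsum_mul_left]

section Window
variable {L : Fin 3 → ℝ} {S : ℝ} {H : Fin 3 → ℝ}

/-- The one-dimensional factors of `periodicWindow`. -/
def windowFactor (L : Fin 3 → ℝ) (S : ℝ) (H : Fin 3 → ℝ) (d : Fin 3) : ℝ → ℝ :=
  if d = 2 then gaussOne (H d ^ 2 / S) else periodicGauss (H d ^ 2 / S) (L d)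

lemma periodicWindow_eq_prod (hL : ∀ d, 0 < L d) (hS : 0 < S) (hH : ∀ d, 0 < H d)
    (x : Fin 3 → ℝ) : periodicWindow L S H x = ∏ d, windowFactor L S H d (x d) := by
  have ha : ∀ d, 0 < H d ^ 2 / S := fun d => div_pos (pow_pos (hH d) 2) hS
  simp only [Fin.prod_univ_three, windowFactor, Fin.reduceEq, if_false, if_true, periodicWindow,
    gaussWindow_eq_prod, periodicGauss]
  rw [tsum_mul_tsum_of_summable_norm (summable_gaussOne_add (ha 0) (hL 0) _).norm
    (summable_gaussOne_add (ha 1) (hL 1) _).norm, ← tsum_mul_right]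
  refine tsum_congr fun n => ?_
  simp

lemma integrable_windowFactor (hL : ∀ d, 0 < L d) (hS : 0 < S) (hH : ∀ d, 0 < H d)
    (d : Fin 3) (x b : ℝ) : Integrable (fun y => (windowFactor L S H d (x - y) : ℂ))
      (volume.restrict (Icc (-b) b)) := by
  have ha : 0 < H d ^ 2 / S := div_pos (pow_pos (hH d) 2) hS
  refine Integrable.ofReal (f := fun y => windowFactor L S H d (x - y)) ?_
  unfold windowFactor
  split_ifs
  · exact ((integrable_gaussOne ha).comp_sub_left x).integrableOn
  · obtain ⟨C, hC⟩ := exists_periodicGauss_le ha (hL d)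
    refine Integrable.mono' (integrable_const C) ((measurable_periodicGauss _ _).comp
      (measurable_const.sub measurable_id)).aestronglyMeasurable (ae_of_all _ fun y => ?_)
    rw [Real.norm_of_nonneg (periodicGauss_nonneg _ _ _)]
    exact hC _

lemma box_eq_pi (b : Fin 3 → ℝ) : box b = univ.pi fun d => Icc (-(b d / 2)) (b d / 2) := by
  ext x
  simp [box, abs_le, Pi.le_def, forall_and]

end Window

/-- The transform of the Gaussian window centered at `x` over `[-b, b]`. -/
def confinedHat (a b x k : ℝ) : ℂ :=
  ∫ z in Icc (-b) b, Complex.exp (Complex.I * (k * z : ℝ)) * (gaussOne a (x - z) : ℂ)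

lemma isBddCont_confinedHat {a : ℝ} (ha : 0 < a) (b x : ℝ) : IsBddCont (confinedHat a b x) := by
  have hg : Integrable (fun z => gaussOne a (x - z)) (volume.restrict (Icc (-b) b)) :=
    ((integrable_gaussOne ha).comp_sub_left x).integrableOn
  have hn : ∀ k z : ℝ, ‖Complex.exp (Complex.I * (k * z : ℝ)) * (gaussOne a (x - z) : ℂ)‖ ≤
      gaussOne a (x - z) := by
    intro k z
    rw [norm_mul, norm_planePhase, one_mul, Complex.norm_real,
      Real.norm_of_nonneg (gaussOne_pos _ _).le]
  refine ⟨?_, _, fun k => norm_integral_le_of_norm_le hg (ae_of_all _ (hn k))⟩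
  refine continuous_of_dominated (fun k => ?_) (fun k => ae_of_all _ (hn k)) hg
    (ae_of_all _ fun z => by fun_prop)
  exact (integrable_phase_mul_gaussOne ha k x).aestronglyMeasurable.restrict

/-- The factors which represent `confinedPotential` as a mode potential. -/
def confinedFactor (S : ℝ) (H : Fin 3 → ℝ) (A : ℝ) (x : Fin 3 → ℝ) (d : Fin 3) : ℝ → ℂ :=
  if d = 2 then confinedHat (H d ^ 2 / S) (A / 2) (x d) else fun k =>
    (gaussOneHat (H d ^ 2 / S) k : ℂ) * Complex.exp (Complex.I * (k * x d : ℝ))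

lemma isBddCont_confinedFactor {S : ℝ} {H : Fin 3 → ℝ} (hS : 0 < S) (hH : ∀ d, 0 < H d) (A : ℝ)
    (x : Fin 3 → ℝ) (d : Fin 3) : IsBddCont (confinedFactor S H A x d) := by
  have ha : 0 < H d ^ 2 / S := div_pos (pow_pos (hH d) 2) hS
  unfold confinedFactor
  split_ifs
  · exact isBddCont_confinedHat ha _ _
  · exact (isBddCont_gaussOneHat ha).mul (isBddCont_phase _)

section Potentials
variable {m : ℕ} {w s : Fin (m + 1) → ℝ} {S : ℝ} {H L : Fin 3 → ℝ} {N : ℕ} (q : Fin N → ℝ)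
  (r : Fin N → Fin 3 → ℝ)

/-- Fubini exchanges space and wave vectors, and the spatial integral then splits over the
directions. The periodic factors are evaluated exactly only at lattice wave numbers, so the
integrands agree almost everywhere rather than everywhere. -/
lemma confinedPotential_eq (hL : ∀ d, 0 < L d) (hS : 0 < S) (hH : ∀ d, 0 < H d)
    (hs : ∀ l, s l ≠ 0) (hμ : ∀ d l, 0 < mu (s l) S (H d)) (A : ℝ) (x : Fin 3 → ℝ) :
    confinedPotential L w s S H q r A x = 4 * Real.pi * (mixedFactor L *
      modePotential w s S H L (structureFactor q r) (confinedFactor S H A x)) := by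
  have := sigmaFinite_modeMeasure hL
  have hsf : SFinite (waveMeasure L) := by unfold waveMeasure; infer_instance
  have ha : ∀ d, 0 < H d ^ 2 / S := fun d => div_pos (pow_pos (hH d) 2) hS
  set b : Fin 3 → ℝ := ![L 0, L 1, A]
  have hbox : (volume : Measure (Fin 3 → ℝ)).restrict (box b) =
      Measure.pi fun d => volume.restrict (Icc (-(b d / 2)) (b d / 2)) := by
    rw [box_eq_pi, volume_pi, Measure.restrict_pi_pi]
  set ρ := structureFactor q r
  set G : (Fin 3 → ℝ) → ℂ := fun k => (scalWeight w s S H k : ℂ) * ρ k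
  have hG : Integrable G (waveMeasure L) := by
    have := integrable_scalWeight_mul (w := w) (B := fun _ _ => 1) hL hS hH hs hμ
      (continuous_structureFactor q r) (norm_structureFactor_le q r)
      fun d => ⟨continuous_const, 1, fun k => by simp⟩
    simpa using this
  set W : (Fin 3 → ℝ) → ℂ := fun y => ∏ d, (windowFactor L S H d (x d - y d) : ℂ)
  have hW : Integrable W (volume.restrict (box b)) := by
    rw [hbox]
    exact Integrable.fintype_prod (f := fun d y => (windowFactor L S H d (x d - y) : ℂ))
      fun d => integrable_windowFactor hL hS hH d _ _
  have hprod : Integrable (Function.uncurry fun y k => planeWave k y * (W y * G k))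
      ((volume.restrict (box b)).prod (waveMeasure L)) := by
    refine Integrable.bdd_mul (c := 1) (hW.mul_prod hG)
      (Continuous.aestronglyMeasurable ?_) (ae_of_all _ fun p => (norm_planeWave _ _).le)
    unfold planeWave
    fun_prop
  unfold confinedPotential
  congr 1
  have e1 : ∀ y, scal L w s S H q r y * (periodicWindow L S H (x - y) : ℂ) =
      mixedFactor L * ∫ k, planeWave k y * (W y * G k) ∂waveMeasure L := by
    intro y
    rw [scal_eq q r hL hS hH hs hμ, periodicWindow_eq_prod hL hS hH, mul_assoc, modePotential,
      ← integral_mul_const]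
    congr 1
    refine integral_congr_ae (ae_of_all _ fun k => ?_)
    simp only [W, G, planeWave_eq_prod, Complex.ofReal_prod, Pi.sub_apply]
    ring
  simp_rw [e1, integral_const_mul]
  rw [integral_integral_swap hprod, modePotential]
  congr 1
  refine integral_congr_ae ?_
  have hae : ∀ᵐ k ∂waveMeasure L, ∀ d : Fin 3, d ≠ 2 → ∃ n : ℤ, k d = 2 * Real.pi * n / L d := by
    refine ae_waveMeasure hL fun n κ d hd => ?_
    fin_cases d
    · exact ⟨n.1, rfl⟩
    · exact ⟨n.2, rfl⟩
    · exact absurd rfl hd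
  filter_upwards [hae] with k hk
  have e2 : ∀ y, planeWave k y * (W y * G k) = (∏ d, Complex.exp (Complex.I * (k d * y d : ℝ)) *
      (windowFactor L S H d (x d - y d) : ℂ)) * G k := by
    intro y
    rw [planeWave_eq_prod, Finset.prod_mul_distrib, mul_assoc]
  simp_rw [e2]
  rw [integral_mul_const, hbox, integral_fintype_prod_eq_prod
    (fun d y => Complex.exp (Complex.I * (k d * y : ℝ)) * (windowFactor L S H d (x d - y) : ℂ))]
  have e3 : ∀ d, ∫ y in Icc (-(b d / 2)) (b d / 2), Complex.exp (Complex.I * (k d * y : ℝ)) *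
      (windowFactor L S H d (x d - y) : ℂ) = confinedFactor S H A x d (k d) := by
    intro d
    unfold windowFactor confinedFactor
    by_cases hd : d = 2
    · subst hd
      simp [b, confinedHat]
    · obtain ⟨n, hn⟩ := hk d hd
      have hb : b d = L d := by
        fin_cases d
        · rfl
        · rfl
        · exact absurd rfl hd
      simp only [hd, if_false, hb, hn]
      exact integral_phase_mul_periodicGauss (ha d) (hL d) n (x d)
  simp_rw [e3]
  simp only [G]
  ring

end Potentials

/-! ### Exponential sums and multipliers of unit mass. -/

lemma integrable_exp_neg_mul_abs {γ : ℝ} (hγ : 0 < γ) :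
    Integrable fun t : ℝ => ((Real.exp (-γ * |t|) : ℝ) : ℂ) := by
  refine Integrable.ofReal (f := fun t => Real.exp (-γ * |t|)) ?_
  rw [← integrableOn_univ, ← Iic_union_Ioi (a := (0 : ℝ)), integrableOn_union]
  constructor
  · refine (integrableOn_exp_mul_Iic hγ 0).congr_fun (fun t ht => ?_) measurableSet_Iic
    simp only [abs_of_nonpos (mem_Iic.1 ht)]
    ring_nf
  · refine (integrableOn_exp_mul_Ioi (neg_lt_zero.2 hγ) 0).congr_fun (fun t ht => ?_)
      measurableSet_Ioi
    simp only [abs_of_pos (mem_Ioi.1 ht)]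

lemma fourier_exp_neg_mul_abs {γ : ℝ} (hγ : 0 < γ) (ξ : ℝ) :
    𝓕 (fun t : ℝ => ((Real.exp (-γ * |t|) : ℝ) : ℂ)) ξ =
      ((2 * γ / (γ ^ 2 + (2 * Real.pi * ξ) ^ 2) : ℝ) : ℂ) := by
  have hint := integrable_exp_neg_mul_abs hγ
  rw [Real.fourier_real_eq_integral_exp_smul]
  have hint2 : Integrable fun t : ℝ => Complex.exp (((-2 * Real.pi * t * ξ : ℝ) : ℂ) * Complex.I) •
      ((Real.exp (-γ * |t|) : ℝ) : ℂ) := by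
    refine Integrable.bdd_mul (c := 1) hint (Continuous.aestronglyMeasurable (by fun_prop))
      (ae_of_all _ fun t => (Complex.norm_exp_ofReal_mul_I _).le)
  rw [← intervalIntegral.integral_Iic_add_Ioi (b := 0) hint2.integrableOn hint2.integrableOn]
  have h1 : ∫ t in Iic (0 : ℝ), Complex.exp (((-2 * Real.pi * t * ξ : ℝ) : ℂ) * Complex.I) •
      ((Real.exp (-γ * |t|) : ℝ) : ℂ) = 1 / (γ - 2 * Real.pi * ξ * Complex.I) := by
    have := integral_exp_mul_complex_Iic (a := γ - 2 * Real.pi * ξ * Complex.I) (by simpa) 0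
    simp only [Complex.ofReal_zero, mul_zero, Complex.exp_zero] at this
    rw [← this]
    refine setIntegral_congr_fun measurableSet_Iic fun t ht => ?_
    simp only [abs_of_nonpos (mem_Iic.1 ht), smul_eq_mul, Complex.ofReal_exp, ← Complex.exp_add]
    congr 1
    push_cast
    ring
  have h2 : ∫ t in Ioi (0 : ℝ), Complex.exp (((-2 * Real.pi * t * ξ : ℝ) : ℂ) * Complex.I) •
      ((Real.exp (-γ * |t|) : ℝ) : ℂ) = 1 / (γ + 2 * Real.pi * ξ * Complex.I) := by
    have := integral_exp_mul_complex_Ioi (a := -γ - 2 * Real.pi * ξ * Complex.I) (by simpa) 0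
    simp only [Complex.ofReal_zero, mul_zero, Complex.exp_zero] at this
    rw [show (1 : ℂ) / (γ + 2 * Real.pi * ξ * Complex.I) =
      -1 / (-γ - 2 * Real.pi * ξ * Complex.I) by
        rw [← neg_add', neg_div_neg_eq], ← this]
    refine setIntegral_congr_fun measurableSet_Ioi fun t ht => ?_
    simp only [abs_of_pos (mem_Ioi.1 ht), smul_eq_mul, Complex.ofReal_exp, ← Complex.exp_add]
    congr 1
    push_cast
    ring
  rw [h1, h2]
  have n1 : (γ - 2 * Real.pi * ξ * Complex.I : ℂ) ≠ 0 := by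
    intro h; have := congrArg Complex.re h; simp at this; exact hγ.ne' this
  have n2 : (γ + 2 * Real.pi * ξ * Complex.I : ℂ) ≠ 0 := by
    intro h; have := congrArg Complex.re h; simp at this; exact hγ.ne' this
  have n3 : ((γ : ℂ) ^ 2 + (2 * Real.pi * ξ) ^ 2) ≠ 0 := by
    have : (0 : ℝ) < γ ^ 2 + (2 * Real.pi * ξ) ^ 2 := by positivity
    exact_mod_cast this.ne'
  push_cast
  rw [div_add_div _ _ n1 n2, div_eq_div_iff (mul_ne_zero n1 n2) n3]
  ring_nf
  simp only [Complex.I_sq]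
  ring

/-- The function `exp (-γ |t|)` is the Fourier transform of a probability density. -/
lemma exists_fourier_exp_neg_mul_abs {γ : ℝ} (hγ : 0 < γ) :
    ∃ φ : ℝ → ℂ, Integrable φ ∧ ∫ ξ, ‖φ ξ‖ = 1 ∧ ∀ t : ℝ,
      ∫ ξ, φ ξ * Complex.exp (Complex.I * ((2 * Real.pi * ξ) * t : ℝ)) =
        ((Real.exp (-γ * |t|) : ℝ) : ℂ) := by
  set f : ℝ → ℂ := fun t => ((Real.exp (-γ * |t|) : ℝ) : ℂ)
  set p : ℝ → ℝ := fun ξ => 2 * γ / (γ ^ 2 + (2 * Real.pi * ξ) ^ 2)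
  have hp : 𝓕 f = fun ξ => (p ξ : ℂ) := funext (fourier_exp_neg_mul_abs hγ)
  have hpi : Integrable p := by
    have h1 := (integrable_inv_one_add_sq.comp_mul_left' (R := 2 * Real.pi / γ)
      (by positivity)).const_mul (2 / γ)
    refine h1.congr (ae_of_all _ fun ξ => ?_)
    simp only [p]
    have : 0 < γ ^ 2 + (2 * Real.pi * ξ) ^ 2 := by positivity
    field_simp
  have hF : Integrable (𝓕 f) := by rw [hp]; exact hpi.ofReal
  have hf : Continuous f := by fun_prop
  have hinv : ∀ t : ℝ, ∫ ξ, (p ξ : ℂ) * Complex.exp (Complex.I * ((2 * Real.pi * ξ) * t : ℝ)) =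
      f t := by
    intro t
    rw [← congrFun (hf.fourierInv_fourier_eq (integrable_exp_neg_mul_abs hγ) hF) t, hp,
      Real.fourierInv_eq']
    refine integral_congr_ae (ae_of_all _ fun ξ => ?_)
    simp only [smul_eq_mul]
    rw [mul_comm]
    congr 2
    simp
    ring
  refine ⟨fun ξ => (p ξ : ℂ), hpi.ofReal, ?_, hinv⟩
  -- Inversion at t = 0 shows that the nonnegative function p has integral 1.
  have h0 := hinv 0
  simp only [mul_zero, Complex.ofReal_zero, Complex.exp_zero, mul_one, f, abs_zero, Real.exp_zero,
    Complex.ofReal_one] at h0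
  rw [integral_complex_ofReal] at h0
  rw [← Complex.ofReal_one, Complex.ofReal_inj] at h0
  rw [← h0]
  refine integral_congr_ae (ae_of_all _ fun ξ => ?_)
  simp only [Complex.norm_real]
  exact Real.norm_of_nonneg (by positivity)

section Exponential
variable {N : ℕ} {t : Fin N → ℝ} {Λ : ℝ}

/-- Multiplication of the coefficients by a Fourier transform changes the supremum of an
exponential sum at most by the `L¹` norm. -/
lemma norm_sum_mul_fourier_le {c : Fin N → ℂ}
    (hc : ∀ κ : ℝ, ‖∑ j, c j * Complex.exp (Complex.I * (κ * t j : ℝ))‖ ≤ Λ)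
    {φ : ℝ → ℂ} (hφ : Integrable φ) (b : ℝ) {ψ : ℝ → ℂ}
    (hψ : ∀ j, ∫ ξ, φ ξ * Complex.exp (Complex.I * ((b * ξ) * t j : ℝ)) = ψ (t j)) (κ : ℝ) :
    ‖∑ j, c j * ψ (t j) * Complex.exp (Complex.I * (κ * t j : ℝ))‖ ≤ (∫ ξ, ‖φ ξ‖) * Λ := by
  have hi : ∀ j, Integrable fun ξ => φ ξ * Complex.exp (Complex.I * ((b * ξ) * t j : ℝ)) := by
    intro j
    simp_rw [mul_comm (φ _)]
    exact hφ.bdd_mul (c := 1) (Continuous.aestronglyMeasurable (by fun_prop))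
      (ae_of_all _ fun ξ => (norm_planePhase _).le)
  have e : ∑ j, c j * ψ (t j) * Complex.exp (Complex.I * (κ * t j : ℝ)) =
      ∫ ξ, φ ξ * ∑ j, c j * Complex.exp (Complex.I * ((b * ξ + κ) * t j : ℝ)) := by
    simp_rw [← hψ, mul_assoc (c _), mul_comm (∫ _, _), ← integral_const_mul]
    rw [← integral_finsetSum _ fun j _ => ((hi j).const_mul _).const_mul _]
    refine integral_congr_ae (ae_of_all _ fun ξ => ?_)
    simp only [Finset.mul_sum]
    refine Finset.sum_congr rfl fun j _ => ?_
    rw [show (((b * ξ + κ) * t j : ℝ) : ℂ) = (κ * t j : ℝ) + ((b * ξ) * t j : ℝ) by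
      push_cast; ring, mul_add, Complex.exp_add]
    ring
  rw [e, ← integral_mul_const]
  refine norm_integral_le_of_norm_le (hφ.norm.mul_const Λ) (ae_of_all _ fun ξ => ?_)
  rw [norm_mul]
  exact mul_le_mul_of_nonneg_left (hc _) (norm_nonneg _)

/-- An exponential sum with frequencies in `[-B, B]` which is bounded on the real line grows at most
like `exp (B |γ|)` in the imaginary direction. -/
lemma norm_sum_mul_exp_le {c : Fin N → ℂ} {B : ℝ} (hB : ∀ j, |t j| ≤ B)
    (hc : ∀ κ : ℝ, ‖∑ j, c j * Complex.exp (Complex.I * (κ * t j : ℝ))‖ ≤ Λ) (γ : ℝ) :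
    ‖∑ j, c j * ((Real.exp (γ * t j) : ℝ) : ℂ)‖ ≤ Real.exp (|γ| * B) * Λ := by
  rcases eq_or_ne γ 0 with rfl | hγ
  · simpa using hc 0
  obtain ⟨φ, hφ, hφ1, hψ⟩ := exists_fourier_exp_neg_mul_abs (abs_pos.2 hγ)
  -- The endpoint of [-B, B] at which γ t is largest. On the interval, exp(γ t) coincides with
  -- exp(|γ|B) exp(-|γ||t - b|), whose second factor is the transform of a Cauchy density modulated
  -- by the shift b.
  set b : ℝ := SignType.sign γ * B
  have hsgn : ∀ j, γ * t j = |γ| * B + -|γ| * |t j - b| := by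
    intro j
    have := abs_le.1 (hB j)
    rcases lt_or_gt_of_ne hγ with h | h
    · simp only [b, sign_neg h, SignType.coe_neg, SignType.coe_one]
      rw [abs_of_neg h, abs_of_nonneg (by linarith)]
      ring
    · simp only [b, sign_pos h, SignType.coe_one]
      rw [abs_of_pos h, abs_of_nonpos (by linarith)]
      ring
  set φ' : ℝ → ℂ := fun ξ => φ ξ * Complex.exp (Complex.I * ((2 * Real.pi * ξ) * (-b) : ℝ))
  have hn : ∀ ξ, ‖φ' ξ‖ = ‖φ ξ‖ := fun ξ => by
    simp only [φ']; rw [norm_mul, norm_planePhase, mul_one]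
  have hφ' : Integrable φ' := by
    simp only [φ']
    simp_rw [mul_comm (φ _)]
    exact hφ.bdd_mul (c := 1) (Continuous.aestronglyMeasurable (by fun_prop))
      (ae_of_all _ fun ξ => (norm_planePhase _).le)
  have h1 := norm_sum_mul_fourier_le hc hφ' (2 * Real.pi)
    (ψ := fun t => ((Real.exp (-|γ| * |t - b|) : ℝ) : ℂ)) (fun j => by
      rw [← hψ]
      refine integral_congr_ae (ae_of_all _ fun ξ => ?_)
      simp only [φ']
      rw [mul_assoc, ← Complex.exp_add]
      congr 2
      push_cast
      ring) 0
  simp_rw [hn, hφ1] at h1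
  simp only [zero_mul, Complex.ofReal_zero, mul_zero, Complex.exp_zero, mul_one, one_mul] at h1
  have e : ∑ j, c j * ((Real.exp (γ * t j) : ℝ) : ℂ) = ((Real.exp (|γ| * B) : ℝ) : ℂ) *
      ∑ j, c j * ((Real.exp (-|γ| * |t j - b|) : ℝ) : ℂ) := by
    rw [Finset.mul_sum]
    refine Finset.sum_congr rfl fun j _ => ?_
    rw [hsgn, Real.exp_add, Complex.ofReal_mul]
    ring
  rw [e, norm_mul, Complex.norm_real, Real.norm_of_nonneg (Real.exp_pos _).le]
  exact mul_le_mul_of_nonneg_left h1 (Real.exp_pos _).le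

end Exponential

/-! ### The loss caused by confining the free direction. -/

/-- The inverse Fourier transform of an exponential sum times `exp (-μ κ² / 4)`. -/
def dampedTransform (μ : ℝ) (σ : ℝ → ℂ) (z : ℝ) : ℂ :=
  ∫ κ : ℝ, Complex.exp (Complex.I * (κ * z : ℝ)) * ((gaussOne (4 / μ) κ : ℂ) * σ κ)

section Damped
variable {μ Λ : ℝ} {σ : ℝ → ℂ}

lemma integrable_gaussOne_mul (hμ : 0 < μ) (hσ : Continuous σ) (hΛ : ∀ κ, ‖σ κ‖ ≤ Λ) :
    Integrable fun κ => (gaussOne (4 / μ) κ : ℂ) * σ κ := by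
  simp_rw [mul_comm _ (σ _)]
  exact (integrable_gaussOne (a := 4 / μ) (by positivity)).ofReal.bdd_mul hσ.aestronglyMeasurable
    (ae_of_all _ hΛ)

lemma norm_dampedTransform_le (hμ : 0 < μ) (hΛ : ∀ κ, ‖σ κ‖ ≤ Λ) (z : ℝ) :
    ‖dampedTransform μ σ z‖ ≤ √(Real.pi * (4 / μ)) * Λ := by
  rw [← integral_gaussOne, ← integral_mul_const]
  refine norm_integral_le_of_norm_le
    ((integrable_gaussOne (a := 4 / μ) (by positivity)).mul_const Λ) (ae_of_all _ fun κ => ?_)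
  rw [norm_mul, norm_planePhase, one_mul, norm_mul, Complex.norm_real,
    Real.norm_of_nonneg (gaussOne_pos _ _).le]
  exact mul_le_mul_of_nonneg_left (hΛ κ) (gaussOne_pos _ _).le

/-- Gaussian decay of the potential outside of the interval which contains the charges. -/
lemma norm_dampedTransform_le_exp (hμ : 0 < μ) {N : ℕ} {c : Fin N → ℂ} {t : Fin N → ℝ} {B : ℝ}
    (hB : ∀ j, |t j| ≤ B) (hσ : ∀ κ, σ κ = ∑ j, c j * Complex.exp (Complex.I * (-κ * t j : ℝ)))
    (hΛ : ∀ κ, ‖σ κ‖ ≤ Λ) (z : ℝ) :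
    ‖dampedTransform μ σ z‖ ≤
      √(Real.pi * (4 / μ)) * Λ * Real.exp (-z ^ 2 / μ + 2 * |z| * B / μ) := by
  have h4 : 0 < 4 / μ := by positivity
  have hs : 0 < √(Real.pi * (4 / μ)) := Real.sqrt_pos.2 (mul_pos Real.pi_pos h4)
  have hc : ∀ κ : ℝ, ‖∑ j, c j * Complex.exp (Complex.I * (κ * t j : ℝ))‖ ≤ Λ := by
    intro κ
    have := hΛ (-κ)
    rwa [hσ, neg_neg] at this
  have e1 : dampedTransform μ σ z = ∑ j, c j * (gaussOneHat (4 / μ) (z - t j) : ℂ) := by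
    simp_rw [← integral_cexp_mul_gaussOne h4, ← integral_const_mul]
    rw [← integral_finsetSum]
    · refine integral_congr_ae (ae_of_all _ fun κ => ?_)
      simp only [hσ, Finset.mul_sum]
      refine Finset.sum_congr rfl fun j _ => ?_
      rw [show (((z - t j) * κ : ℝ) : ℂ) = (κ * z : ℝ) + (-κ * t j : ℝ) by push_cast; ring,
        mul_add, Complex.exp_add]
      ring
    · intro j _
      refine Integrable.const_mul ?_ _
      exact (integrable_gaussOne h4).ofReal.bdd_mul (c := 1)
        (Continuous.aestronglyMeasurable (by fun_prop)) (ae_of_all _ fun κ => (norm_planePhase _).le)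
  set φ : ℝ → ℂ := fun ξ => (gaussOne (4 / μ) ξ : ℂ) / √(Real.pi * (4 / μ))
  have hφ : Integrable φ := (integrable_gaussOne h4).ofReal.div_const _
  have hφ1 : ∫ ξ, ‖φ ξ‖ = 1 := by
    have : ∀ ξ, ‖φ ξ‖ = gaussOne (4 / μ) ξ / √(Real.pi * (4 / μ)) := by
      intro ξ
      simp only [φ]
      rw [norm_div, Complex.norm_real, Complex.norm_real, Real.norm_of_nonneg (gaussOne_pos _ _).le,
        Real.norm_of_nonneg hs.le]
    simp_rw [this]
    rw [integral_div, integral_gaussOne, div_self hs.ne']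
  -- The factor exp(-t²/μ) is the transform of the Gaussian probability density φ, so inserting it
  -- into the coefficients keeps the bound Λ.
  have h1 : ∀ κ : ℝ, ‖∑ j, (c j * ((Real.exp (-t j ^ 2 / μ) : ℝ) : ℂ)) *
      Complex.exp (Complex.I * (κ * t j : ℝ))‖ ≤ Λ := by
    intro κ
    have := norm_sum_mul_fourier_le hc hφ 1
      (ψ := fun t => ((Real.exp (-t ^ 2 / μ) : ℝ) : ℂ)) (fun j => by
        have h := integral_cexp_mul_gaussOne h4 (t j)
        simp only [φ]
        simp_rw [div_mul_eq_mul_div, integral_div, one_mul]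
        rw [div_eq_iff (by exact_mod_cast hs.ne')]
        simp_rw [mul_comm _ (t j), mul_comm (gaussOne _ _ : ℂ)]
        rw [h, gaussOneHat, Complex.ofReal_mul, mul_comm]
        congr 3
        field_simp) κ
    rwa [hφ1, one_mul] at this
  -- Expanding (z - t_j)² leaves the cross term exp(2 z t_j/μ), a real exponential of the
  -- frequencies, at the price of exp(2|z|B/μ).
  have h2 := norm_sum_mul_exp_le hB h1 (2 * z / μ)
  have e2 : dampedTransform μ σ z = ((√(Real.pi * (4 / μ)) * Real.exp (-z ^ 2 / μ) : ℝ) : ℂ) *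
      ∑ j, (c j * ((Real.exp (-t j ^ 2 / μ) : ℝ) : ℂ)) *
        ((Real.exp (2 * z / μ * t j) : ℝ) : ℂ) := by
    rw [e1, Finset.mul_sum]
    refine Finset.sum_congr rfl fun j _ => ?_
    have : gaussOneHat (4 / μ) (z - t j) = √(Real.pi * (4 / μ)) * Real.exp (-z ^ 2 / μ) *
        (Real.exp (-t j ^ 2 / μ) * Real.exp (2 * z / μ * t j)) := by
      rw [gaussOneHat, mul_assoc, ← Real.exp_add, ← Real.exp_add]
      congr 2
      field_simp
      ring
    rw [this]
    push_cast
    ring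
  rw [e2, norm_mul, Complex.norm_real, Real.norm_of_nonneg (by positivity)]
  refine (mul_le_mul_of_nonneg_left h2 (by positivity)).trans (le_of_eq ?_)
  rw [Real.exp_add, abs_div, abs_mul, abs_of_pos hμ, abs_two, div_mul_eq_mul_div]
  ring

/-- The part of the mode which is lost by the confinement of the free direction. -/
lemma norm_integral_confinement_le {a b x : ℝ} (ha : 0 < a) (hμ : 0 < μ) (hσ : Continuous σ)
    (hΛ : ∀ κ, ‖σ κ‖ ≤ Λ) {D : ℝ → ℝ}
    (hD : ∀ z ∈ (Icc (-b) b)ᶜ, gaussOne a (x - z) * ‖dampedTransform μ σ z‖ ≤ D z)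
    (hDi : IntegrableOn D (Icc (-b) b)ᶜ) :
    ‖∫ κ, (modeWeight μ a κ : ℂ) * ((gaussOneHat a κ : ℂ) * Complex.exp (Complex.I * (κ * x : ℝ)) -
        confinedHat a b x κ) * σ κ‖ ≤ (√(Real.pi * a))⁻¹ * ∫ z in (Icc (-b) b)ᶜ, D z := by
  have hg : Integrable (fun z => (gaussOne a (x - z) : ℂ)) (volume.restrict (Icc (-b) b)ᶜ) :=
    ((integrable_gaussOne ha).comp_sub_left x).ofReal.integrableOn
  have hprod : Integrable (Function.uncurry fun κ z => Complex.exp (Complex.I * (κ * z : ℝ)) *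
      (((gaussOne (4 / μ) κ : ℂ) * σ κ) * (gaussOne a (x - z) : ℂ)))
      (volume.prod (volume.restrict (Icc (-b) b)ᶜ)) := by
    refine Integrable.bdd_mul (c := 1) ((integrable_gaussOne_mul hμ hσ hΛ).mul_prod hg)
      (Continuous.aestronglyMeasurable (by fun_prop)) (ae_of_all _ fun p => (norm_planePhase _).le)
  have e : ∫ κ, (modeWeight μ a κ : ℂ) * ((gaussOneHat a κ : ℂ) *
      Complex.exp (Complex.I * (κ * x : ℝ)) - confinedHat a b x κ) * σ κ =
      ((√(Real.pi * a))⁻¹ : ℝ) * ∫ z in (Icc (-b) b)ᶜ, (gaussOne a (x - z) : ℂ) *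
        dampedTransform μ σ z := by
    have e1 : ∀ z, (gaussOne a (x - z) : ℂ) * dampedTransform μ σ z =
        ∫ κ, Complex.exp (Complex.I * (κ * z : ℝ)) * (((gaussOne (4 / μ) κ : ℂ) * σ κ) *
          (gaussOne a (x - z) : ℂ)) := by
      intro z
      rw [dampedTransform, ← integral_const_mul]
      congr 1
      ext κ
      ring
    simp_rw [e1]
    rw [← integral_integral_swap hprod, ← integral_const_mul]
    refine integral_congr_ae (ae_of_all _ fun κ => ?_)
    have h1 := integral_add_compl (measurableSet_Icc (a := -b) (b := b))
      (integrable_phase_mul_gaussOne ha κ x)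
    rw [integral_phase_mul_gaussOne ha κ x] at h1
    simp only [confinedHat]
    rw [← h1, add_sub_cancel_left, modeWeight_eq]
    have e2 : ∀ z : ℝ, Complex.exp (Complex.I * (κ * z : ℝ)) * (((gaussOne (4 / μ) κ : ℂ) * σ κ) *
        (gaussOne a (x - z) : ℂ)) = ((gaussOne (4 / μ) κ : ℂ) * σ κ) *
        (Complex.exp (Complex.I * (κ * z : ℝ)) * (gaussOne a (x - z) : ℂ)) := fun z => by ring
    simp_rw [e2, integral_const_mul]
    push_cast
    ring
  rw [e, norm_mul, Complex.norm_real, Real.norm_of_nonneg (by positivity)]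
  refine mul_le_mul_of_nonneg_left ?_ (by positivity)
  refine norm_integral_le_of_norm_le hDi ?_
  filter_upwards [ae_restrict_mem measurableSet_Icc.compl] with z hz
  rw [norm_mul, Complex.norm_real, Real.norm_of_nonneg (gaussOne_pos _ _).le]
  exact hD z hz

/-- Uses only the decay of the window: the damped transform is bounded by its supremum, and for |z|
> b the distance to x exceeds H. -/
lemma norm_integral_confinement_le_erfc {a b x H : ℝ} (ha : 0 < a) (hμ : 0 < μ)
    (hσ : Continuous σ) (hΛ : ∀ κ, ‖σ κ‖ ≤ Λ) (hH : 0 ≤ H) (hb : |x| + H ≤ b) :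
    ‖∫ κ, (modeWeight μ a κ : ℂ) * ((gaussOneHat a κ : ℂ) * Complex.exp (Complex.I * (κ * x : ℝ)) -
        confinedHat a b x κ) * σ κ‖ ≤ √(Real.pi * (4 / μ)) * Λ * erfc (H / √a) := by
  have hΛ0 : 0 ≤ Λ := (norm_nonneg _).trans (hΛ 0)
  have hg := (integrable_gaussOne ha).comp_sub_left x
  set M := √(Real.pi * (4 / μ)) * Λ with hM
  have hM0 : 0 ≤ M := by positivity
  refine (norm_integral_confinement_le (D := fun z => gaussOne a (x - z) * M) ha hμ hσ hΛ
    (fun z _ => mul_le_mul_of_nonneg_left (norm_dampedTransform_le hμ hΛ z) (gaussOne_pos _ _).le)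
    (hg.mul_const _).integrableOn).trans ?_
  have h1 : ∫ z in (Icc (-b) b)ᶜ, gaussOne a (x - z) ≤ √(Real.pi * a) * erfc (H / √a) := by
    rw [← setIntegral_gaussOne_abs_gt ha hH]
    have hm : MeasurableSet {t : ℝ | H < |t|} := measurableSet_lt measurable_const (by fun_prop)
    rw [← integral_indicator hm, ← integral_indicator measurableSet_Icc.compl,
      ← integral_sub_left_eq_self (indicator {t : ℝ | H < |t|} (gaussOne a)) volume x]
    have hi : Integrable fun z => indicator {t : ℝ | H < |t|} (gaussOne a) (x - z) :=
      ((integrable_gaussOne ha).indicator hm).comp_sub_left x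
    refine integral_mono (hg.indicator measurableSet_Icc.compl) hi fun z => ?_
    simp only [indicator]
    split_ifs with h2 h3 h3
    · exact le_rfl
    · refine absurd ?_ h3
      rw [mem_compl_iff, mem_Icc, ← abs_le, not_le] at h2
      have := abs_sub_abs_le_abs_sub z x
      rw [abs_sub_comm] at this
      change H < |x - z|
      linarith
    · exact (gaussOne_pos _ _).le
    · exact le_rfl
  have hs : 0 < √(Real.pi * a) := Real.sqrt_pos.2 (mul_pos Real.pi_pos ha)
  rw [integral_mul_const]
  calc _ ≤ (√(Real.pi * a))⁻¹ * ((√(Real.pi * a) * erfc (H / √a)) * M) := by gcongr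
    _ = _ := by field_simp

end Damped

/-- The combined decay of the potential and of the window outside of `[-b, b]`. -/
lemma exists_confinement_exponent_le {s ε B : ℝ} (hs : 0 < s) (hε : 0 < ε) (hB : 0 ≤ B) :
    ∃ M : ℝ, ∀ a μ μ' b x z : ℝ, 0 < a → ε ≤ μ → μ + a = s ^ 2 → μ ≤ μ' → |x| ≤ B → 0 ≤ b →
      b ≤ |z| → B ≤ |z| →
      -(x - z) ^ 2 / a + (-z ^ 2 / μ + 2 * |z| * B / μ) ≤
        M + (-(b / √μ' + 1) ^ 2 + -(x - z) ^ 2 / (2 * a)) := by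
  -- The total coefficient of |z| to be absorbed: 2B/ε from the growth of the potential and 2/√ε
  -- from the cross term of (b/√μ' + 1)². Half of the window exponent supplies z²/(4s²) up to a
  -- constant, which dominates T|z| by completing the square at the cost s²T²; the other half is
  -- kept for the integration in z.
  set T := 2 * B / ε + 2 / √ε with hT
  refine ⟨1 + B ^ 2 / (2 * s ^ 2) + s ^ 2 * T ^ 2, ?_⟩
  intro a μ μ' b x z ha hμ hμa hμ' hx hb hbz hBz
  have hμ0 : 0 < μ := hε.trans_le hμ
  have hμ'0 : 0 < μ' := hμ0.trans_le hμ'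
  have hsε : 0 < √ε := Real.sqrt_pos.2 hε
  have hz : 0 ≤ |z| := abs_nonneg z
  have h1 : (b / √μ') ^ 2 ≤ z ^ 2 / μ := by
    rw [div_pow, Real.sq_sqrt hμ'0.le, ← sq_abs z]
    gcongr
  have h2 : b / √μ' ≤ |z| / √ε := by
    have := Real.sqrt_le_sqrt (hμ.trans hμ')
    gcongr
  have h3 : 2 * |z| * B / μ ≤ 2 * |z| * B / ε := by gcongr
  have h4 : (z ^ 2 / 2 - B ^ 2) / (2 * s ^ 2) ≤ (x - z) ^ 2 / (2 * a) := by
    have h5 : |z| - B ≤ |x - z| := by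
      have := abs_sub_abs_le_abs_sub z x
      rw [abs_sub_comm] at this
      linarith
    have h6 : (|z| - B) ^ 2 ≤ (x - z) ^ 2 := by
      rw [← sq_abs (x - z)]
      have : 0 ≤ |z| - B := by linarith
      gcongr
    have h7 : z ^ 2 / 2 - B ^ 2 ≤ (x - z) ^ 2 := by
      refine le_trans ?_ h6
      rw [← sq_abs z]
      nlinarith [sq_nonneg (|z| - 2 * B)]
    calc _ ≤ (x - z) ^ 2 / (2 * s ^ 2) := by gcongr
      _ ≤ _ := by
        have : a ≤ s ^ 2 := by linarith
        gcongr
  have h8 : T * |z| ≤ z ^ 2 / (4 * s ^ 2) + s ^ 2 * T ^ 2 := by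
    have : z ^ 2 / (4 * s ^ 2) + s ^ 2 * T ^ 2 - T * |z| = (|z| / (2 * s) - s * T) ^ 2 := by
      rw [← sq_abs z]
      field_simp
      ring
    nlinarith [sq_nonneg (|z| / (2 * s) - s * T)]
  have h9 : T * |z| = 2 * |z| * B / ε + 2 * (|z| / √ε) := by rw [hT]; ring
  have h10 : (z ^ 2 / 2 - B ^ 2) / (2 * s ^ 2) = z ^ 2 / (4 * s ^ 2) - B ^ 2 / (2 * s ^ 2) := by
    field_simp
    ring
  have h11 : -(x - z) ^ 2 / a = -(x - z) ^ 2 / (2 * a) - (x - z) ^ 2 / (2 * a) := by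
    field_simp
    ring
  have h12 : -z ^ 2 / μ = -(z ^ 2 / μ) := neg_div _ _
  rw [h11, h12]
  nlinarith

/-- The loss by the confinement of the free direction, bounded by `erfc (b / √μ')`. -/
lemma exists_integral_confinement_le {s ε B : ℝ} (hs : 0 < s) (hε : 0 < ε) (hB : 0 ≤ B) :
    ∃ C : ℝ, 0 ≤ C ∧ ∀ (a μ μ' b x Λ : ℝ) (σ : ℝ → ℂ) (N : ℕ) (c : Fin N → ℂ) (t : Fin N → ℝ),
      0 < a → ε ≤ μ → μ + a = s ^ 2 → μ ≤ μ' → |x| ≤ B → B ≤ b → (∀ j, |t j| ≤ B) →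
      (∀ κ, σ κ = ∑ j, c j * Complex.exp (Complex.I * (-κ * t j : ℝ))) → (∀ κ, ‖σ κ‖ ≤ Λ) →
      ‖∫ κ, (modeWeight μ a κ : ℂ) * ((gaussOneHat a κ : ℂ) *
        Complex.exp (Complex.I * (κ * x : ℝ)) - confinedHat a b x κ) * σ κ‖ ≤
        C * Λ * erfc (b / √μ') := by
  obtain ⟨M, hM⟩ := exists_confinement_exponent_le hs hε hB
  have hp := Real.pi_pos
  -- The factor √2 is the ratio of the masses of the Gaussians with parameters 2a and a; √π/2 comes
  -- from the lower bound for erfc.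
  refine ⟨√(Real.pi * (4 / ε)) * Real.exp M * √2 * (√Real.pi / 2), by positivity, ?_⟩
  intro a μ μ' b x Λ σ N c t ha hμ hμa hμ' hx hb ht hσ hΛ
  have hμ0 : 0 < μ := hε.trans_le hμ
  have hΛ0 : 0 ≤ Λ := (norm_nonneg _).trans (hΛ 0)
  have hb0 : 0 ≤ b := hB.trans hb
  have hσc : Continuous σ := by
    rw [funext hσ]; fun_prop
  set X := b / √μ'
  have hX : 0 ≤ X := by positivity
  set D0 := √(Real.pi * (4 / ε)) * Λ * (Real.exp M * Real.exp (-(X + 1) ^ 2)) with hD0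
  have hD00 : 0 ≤ D0 := by positivity
  have h2a : 0 < 2 * a := by positivity
  have hg := (integrable_gaussOne h2a).comp_sub_left x
  refine (norm_integral_confinement_le (D := fun z => gaussOne (2 * a) (x - z) * D0) ha hμ0 hσc hΛ
    ?_ (hg.mul_const _).integrableOn).trans ?_
  · intro z hz
    rw [mem_compl_iff, mem_Icc, ← abs_le, not_le] at hz
    have h1 := norm_dampedTransform_le_exp hμ0 ht hσ hΛ z
    have h2 := hM a μ μ' b x z ha hμ hμa hμ' hx hb0 hz.le (hb.trans hz.le)
    have h3 : √(Real.pi * (4 / μ)) ≤ √(Real.pi * (4 / ε)) := by gcongr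
    calc _ ≤ gaussOne a (x - z) * (√(Real.pi * (4 / μ)) * Λ *
          Real.exp (-z ^ 2 / μ + 2 * |z| * B / μ)) := by
          exact mul_le_mul_of_nonneg_left h1 (gaussOne_pos _ _).le
      _ = √(Real.pi * (4 / μ)) * Λ *
          Real.exp (-(x - z) ^ 2 / a + (-z ^ 2 / μ + 2 * |z| * B / μ)) := by
          rw [Real.exp_add (-(x - z) ^ 2 / a), gaussOne]; ring
      _ ≤ √(Real.pi * (4 / ε)) * Λ *
          Real.exp (M + (-(X + 1) ^ 2 + -(x - z) ^ 2 / (2 * a))) := by gcongr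
      _ = _ := by rw [hD0, Real.exp_add, Real.exp_add, gaussOne]; ring
  · have h4 : ∫ z in (Icc (-b) b)ᶜ, gaussOne (2 * a) (x - z) ≤ √(Real.pi * (2 * a)) := by
      refine (setIntegral_le_integral hg (ae_of_all _ fun z => (gaussOne_pos _ _).le)).trans ?_
      rw [integral_sub_left_eq_self (gaussOne (2 * a)), integral_gaussOne]
    have h5 : √(Real.pi * (2 * a)) = √(Real.pi * a) * √2 := by
      rw [← Real.sqrt_mul (by positivity)]
      congr 1
      ring
    have h6 : Real.exp (-(X + 1) ^ 2) ≤ √Real.pi / 2 * erfc X := by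
      have := exp_neg_add_one_sq_le_erfc hX
      have hsp : 0 < √Real.pi := Real.sqrt_pos.2 hp
      rw [div_mul_eq_mul_div, div_le_iff₀ hsp] at this
      linarith
    have hs : 0 < √(Real.pi * a) := by positivity
    rw [integral_mul_const]
    calc _ ≤ (√(Real.pi * a))⁻¹ * ((√(Real.pi * a) * √2) * D0) := by rw [← h5]; gcongr
      _ = √2 * (√(Real.pi * (4 / ε)) * Λ * (Real.exp M * Real.exp (-(X + 1) ^ 2))) := by
          rw [hD0]; field_simp
      _ ≤ √2 * (√(Real.pi * (4 / ε)) * Λ * (Real.exp M * (√Real.pi / 2 * erfc X))) := by gcongr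
      _ = _ := by ring

/-! ### From estimates for single modes to estimates for potentials. -/

/-- Decay in z rests on cancellation in the κ-integral, so the norm may be taken only after
integrating over κ for each fixed pair of periodic modes. -/
lemma norm_modeIntegral_le_of_inner {L : Fin 3 → ℝ} (hL : ∀ d, 0 < L d) {ρ : (Fin 3 → ℝ) → ℂ}
    (hρ : Continuous ρ) {C : ℝ} (hC : ∀ k, ‖ρ k‖ ≤ C) {f : Fin 3 → ℝ → ℂ}
    (hf : ∀ d, Integrable (f d) (modeMeasure L d)) {D : ℝ}
    (hD : ∀ n, ‖∫ κ : ℝ, f 2 κ * ρ (waveVec L n κ)‖ ≤ D) :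
    ‖modeIntegral L ρ f‖ ≤
      D * ((∫ k, ‖f 0 k‖ ∂modeMeasure L 0) * ∫ k, ‖f 1 k‖ ∂modeMeasure L 1) := by
  have hm : ∀ d : Fin 3, d ≠ 2 → Integrable (fun n : ℤ => ‖f d (2 * Real.pi * n / L d)‖)
      Measure.count ∧ ∫ k, ‖f d k‖ ∂modeMeasure L d =
        ∫ n : ℤ, ‖f d (2 * Real.pi * n / L d)‖ ∂Measure.count := by
    intro d hd
    have h := (hf d).norm
    unfold modeMeasure at h ⊢
    rw [if_neg hd] at h ⊢
    rw [(measurableEmbedding_waveNumber (hL d)).integrable_map_iff] at h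
    exact ⟨h, (measurableEmbedding_waveNumber (hL d)).integral_map _⟩
  have hi := (hm 0 (by decide)).1.mul_prod (hm 1 (by decide)).1
  rw [modeIntegral, (integral_waveMeasure hL (integrable_mode hL hρ hC hf)).2,
    (hm 0 (by decide)).2, (hm 1 (by decide)).2, ← integral_prod_mul, ← integral_const_mul]
  refine norm_integral_le_of_norm_le (hi.const_mul D) (ae_of_all _ fun n => ?_)
  have e : ∀ κ : ℝ, (∏ d, f d (waveVec L n κ d)) * ρ (waveVec L n κ) =
      (f 0 (2 * Real.pi * n.1 / L 0) * f 1 (2 * Real.pi * n.2 / L 1)) *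
        (f 2 κ * ρ (waveVec L n κ)) := by
    intro κ
    rw [Fin.prod_univ_three, ← mul_assoc]
    rfl
  simp_rw [e]
  rw [integral_const_mul, norm_mul, norm_mul, mul_comm]
  exact mul_le_mul_of_nonneg_right (hD n) (by positivity)

/-- For a fixed periodic mode the structure factor is an exponential sum in κ whose frequencies are
the z-coordinates of the charges, as the decay estimate requires. -/
lemma structureFactor_waveVec {N : ℕ} (q : Fin N → ℝ) (r : Fin N → Fin 3 → ℝ) (L : Fin 3 → ℝ)
    (n : ℤ × ℤ) (κ : ℝ) :
    structureFactor q r (waveVec L n κ) = ∑ j, ((q j : ℂ) * planeWave (-waveVec L n 0) (r j)) *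
      Complex.exp (Complex.I * (-κ * r j 2 : ℝ)) := by
  refine Finset.sum_congr rfl fun j _ => ?_
  rw [mul_assoc, planeWave, planeWave, ← Complex.exp_add, ← mul_add, ← Complex.ofReal_add]
  congr 4
  simp [Fin.sum_univ_three, waveVec]
  ring

lemma continuous_waveVec (L : Fin 3 → ℝ) (n : ℤ × ℤ) : Continuous fun κ => waveVec L n κ := by
  refine continuous_pi fun d => ?_
  fin_cases d <;> simp only [waveVec, Fin.zero_eta, Fin.mk_one, Fin.reduceFinMk, Matrix.cons_val]
  · exact continuous_const
  · exact continuous_const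
  · exact continuous_id

section Estimates
variable {m : ℕ} {w s : Fin (m + 1) → ℝ} {S : ℝ} {H L : Fin 3 → ℝ} {ρ : (Fin 3 → ℝ) → ℂ}

/-- The factors which represent `midPotential` as a mode potential. -/
def midFactor (S : ℝ) (H x : Fin 3 → ℝ) (d : Fin 3) (k : ℝ) : ℂ :=
  (gaussOneHat (H d ^ 2 / S) k : ℂ) * Complex.exp (Complex.I * (k * x d : ℝ))

lemma isBddCont_midFactor (hS : 0 < S) (hH : ∀ d, 0 < H d) (x : Fin 3 → ℝ) (d : Fin 3) :
    IsBddCont (midFactor S H x d) :=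
  (isBddCont_gaussOneHat (div_pos (pow_pos (hH d) 2) hS)).mul (isBddCont_phase _)

lemma norm_modeFactor_midFactor (hS : 0 < S) (hH : ∀ d, 0 < H d) {l : Fin (m + 1)}
    (hs : s l ≠ 0) (x : Fin 3 → ℝ) (d : Fin 3) (k : ℝ) :
    ‖modeFactor s S H l (midFactor S H x) d k‖ = gaussOne (4 / s l ^ 2) k := by
  rw [modeFactor, midFactor, norm_mul, norm_mul, norm_planePhase, mul_one, Complex.norm_real,
    Complex.norm_real, Real.norm_of_nonneg (modeWeight_nonneg _ _ _),
    Real.norm_of_nonneg (gaussOneHat_nonneg _ _)]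
  exact modeWeight_mul_gaussOneHat_self (div_pos (pow_pos (hH d) 2) hS) hs
    (by unfold mu; ring) k

/-- The effect of the confinement on the potential in terms of its effect on single modes. -/
lemma norm_modePotential_confined_le (hL : ∀ d, 0 < L d) (hw : ∀ l, 0 < w l) (hS : 0 < S)
    (hH : ∀ d, 0 < H d) (hs : ∀ l, 0 < s l) (hμ : ∀ d l, 0 < mu (s l) S (H d))
    (hρ : Continuous ρ) {C : ℝ} (hC : ∀ k, ‖ρ k‖ ≤ C) (A : ℝ) (x : Fin 3 → ℝ)
    {D : Fin (m + 1) → ℝ}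
    (hD : ∀ l n, ‖∫ κ, (modeWeight (mu (s l) S (H 2)) (H 2 ^ 2 / S) κ : ℂ) *
      ((gaussOneHat (H 2 ^ 2 / S) κ : ℂ) * Complex.exp (Complex.I * (κ * x 2 : ℝ)) -
        confinedHat (H 2 ^ 2 / S) (A / 2) (x 2) κ) * ρ (waveVec L n κ)‖ ≤ D l) :
    ‖modePotential w s S H L ρ (midFactor S H x) -
        modePotential w s S H L ρ (confinedFactor S H A x)‖ ≤
      ∑ l, √Real.pi / 4 * w l * s l ^ 3 * (D l *
        ((∫ k, gaussOne (4 / s l ^ 2) k ∂modeMeasure L 0) *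
          ∫ k, gaussOne (4 / s l ^ 2) k ∂modeMeasure L 1)) := by
  have hs' : ∀ l, s l ≠ 0 := fun l => (hs l).ne'
  have hB1 := isBddCont_midFactor hS hH x
  have hB2 := isBddCont_confinedFactor hS hH A x
  rw [modePotential_eq_sum hL hS hH hs' hμ hρ hC hB1,
    modePotential_eq_sum hL hS hH hs' hμ hρ hC hB2, ← Finset.sum_sub_distrib]
  refine (norm_sum_le _ _).trans (Finset.sum_le_sum fun l _ => ?_)
  have hpre : 0 ≤ √Real.pi / 4 * w l * s l ^ 3 := by have := hw l; have := hs l; positivity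
  rw [← mul_sub, norm_mul, Complex.norm_real, Real.norm_of_nonneg hpre]
  refine mul_le_mul_of_nonneg_left ?_ hpre
  have i1 := integrable_modeFactor (s := s) hL (l := l) (fun d => hμ d l) hB1
  have i2 := integrable_modeFactor (s := s) hL (l := l) (fun d => hμ d l) hB2
  set f1 := modeFactor s S H l (midFactor S H x) with hf1
  set f2 := modeFactor s S H l (confinedFactor S H A x) with hf2
  set g : Fin 3 → ℝ → ℂ := ![f1 0, f1 1, fun k => f1 2 k - f2 2 k]
  have hg : ∀ d, Integrable (g d) (modeMeasure L d) := by
    intro d; fin_cases d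
    · exact i1 0
    · exact i1 1
    · exact (i1 2).sub (i2 2)
  have e : modeIntegral L ρ f1 - modeIntegral L ρ f2 = modeIntegral L ρ g := by
    unfold modeIntegral
    rw [← integral_sub (integrable_mode hL hρ hC i1) (integrable_mode hL hρ hC i2)]
    refine integral_congr_ae (ae_of_all _ fun k => ?_)
    have h0 : f2 0 = f1 0 := by
      funext k; simp only [hf1, hf2, modeFactor, confinedFactor, midFactor]; rfl
    have h1 : f2 1 = f1 1 := by
      funext k; simp only [hf1, hf2, modeFactor, confinedFactor, midFactor]; rfl
    simp only [Fin.prod_univ_three, g, h0, h1, Matrix.cons_val]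
    ring
  rw [e]
  have h := norm_modeIntegral_le_of_inner hL hρ hC hg (D := D l) (fun n => by
    refine le_trans (le_of_eq ?_) (hD l n)
    congr 1
    refine integral_congr_ae (ae_of_all _ fun κ => ?_)
    simp only [g, hf1, hf2, modeFactor, confinedFactor, midFactor, Matrix.cons_val, if_true]
    ring)
  simp only [g, Matrix.cons_val, hf1] at h
  simp_rw [norm_modeFactor_midFactor hS hH (hs' l)] at h
  exact h

/-- The factors which represent `gatherSum` as a mode potential. -/
def gatherFactor (h u : Fin 3 → ℝ) (N : Fin 3 → ℕ) (v : Fin 3 → ℝ → ℝ) (x : Fin 3 → ℝ)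
    (d : Fin 3) (k : ℝ) : ℂ :=
  trapezoid (h d) (u d) (N d) (v d) k * Complex.exp (Complex.I * (k * x d : ℝ))

/-- The exponential part of the aliasing error. -/
def aliasRate (s : Fin (m + 1) → ℝ) (S : ℝ) (H : Fin 3 → ℝ) (N : Fin 3 → ℕ) (l : Fin (m + 1))
    (d : Fin 3) : ℝ :=
  Real.exp (-(Real.pi ^ 2 * mu (s l) S (H d) * (2 * N d) ^ 2) / (4 * s l ^ 2 * S))

/-- Each telescoped product contains one one-dimensional error, which carries the rate, and two
factors bounded independently of the window and the grid. -/
lemma exists_norm_modePotential_gather_le (hL : ∀ d, 0 < L d) (hw : ∀ l, 0 < w l)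
    (hs : ∀ l, 0 < s l) {ε : ℝ} (hε : 0 < ε) :
    ∃ K : ℝ, 0 ≤ K ∧ ∀ (S : ℝ) (h H u : Fin 3 → ℝ) (N : Fin 3 → ℕ) (v : Fin 3 → ℝ → ℝ)
      (x : Fin 3 → ℝ) (ρ : (Fin 3 → ℝ) → ℂ) (C Λ : ℝ), 0 < S → (∀ d, 0 < h d) → (∀ d, 0 < H d) →
      (∀ d, N d * h d = H d) → (∀ d l, ε ≤ mu (s l) S (H d)) →
      (∀ d, ε * S ≤ (2 * N d) ^ 2) → (∀ d, |u d| ≤ 1 / 2) →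
      (∀ d, IsGaussCutoff (H d ^ 2 / S) (H d) (v d)) → Continuous ρ → (∀ k, ‖ρ k‖ ≤ C) →
      (∀ n κ, ‖ρ (waveVec L n κ)‖ ≤ Λ) →
      ‖modePotential w s S H L ρ (midFactor S H x) -
          modePotential w s S H L ρ (gatherFactor h u N v x)‖ ≤
        K * Λ * ((⨆ d, ∑ l, w l * aliasRate s S H N l d) + erfc √S) := by
  have hGB := gaussBounded_modeMeasure hL
  choose C1 hC1 hT using fun (l : Fin (m + 1)) (d : Fin 3) =>
    (hGB d).exists_trapezoid_error_le' (hs l) hε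
  choose G hG0 hG using fun (l : Fin (m + 1)) (d : Fin 3) =>
    hGB d (4 / s l ^ 2) (div_pos four_pos (pow_pos (hs l) 2))
  -- Bounds a full trapezoidal factor: its error, with the rate at most 1 + erfc 0, plus the exact
  -- factor.
  set F : Fin (m + 1) → Fin 3 → ℝ := fun l d => C1 l d * (1 + erfc 0) + G l d
  have he0 := erfc_nonneg 0
  have hF : ∀ l d, 0 ≤ F l d := fun l d => by
    have := hC1 l d; have := hG0 l d; positivity
  set Q : Fin (m + 1) → ℝ := fun l =>
    C1 l 0 * F l 1 * F l 2 + G l 0 * C1 l 1 * F l 2 + G l 0 * G l 1 * C1 l 2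
  have hQ : ∀ l, 0 ≤ Q l := fun l => by
    have := hC1 l; have := hG0 l; have := hF l
    have := hC1 l 0; have := hC1 l 1; have := hC1 l 2; have := hG0 l 0; have := hG0 l 1
    have := hF l 1; have := hF l 2
    positivity
  set Z : ℝ := ∑ l, √Real.pi / 4 * s l ^ 3 * Q l
  have hZl : ∀ l, √Real.pi / 4 * s l ^ 3 * Q l ≤ Z := fun l =>
    Finset.single_le_sum (f := fun l => √Real.pi / 4 * s l ^ 3 * Q l)
      (fun l _ => by have := hs l; have := hQ l; positivity) (Finset.mem_univ l)
  have hZ : 0 ≤ Z := Finset.sum_nonneg fun l _ => by have := hs l; have := hQ l; positivity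
  have hW : 0 ≤ ∑ l, w l := Finset.sum_nonneg fun l _ => (hw l).le
  -- The 3 replaces the sum over directions by the maximum; the sum of the weights accompanies erfc,
  -- which carries no weight in the target rate.
  refine ⟨Z * (3 + ∑ l, w l), by positivity, ?_⟩
  intro S h H u N v x ρ C Λ hS hh hH hN hε' hεS hu hv hρ hC hΛ
  have hΛ0 : 0 ≤ Λ := (norm_nonneg _).trans (hΛ 0 0)
  have hμ : ∀ d l, 0 < mu (s l) S (H d) := fun d l => hε.trans_le (hε' d l)
  have ha : ∀ d, 0 < H d ^ 2 / S := fun d => div_pos (pow_pos (hH d) 2) hS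
  have hs' : ∀ l, s l ≠ 0 := fun l => (hs l).ne'
  have hB1 : ∀ d, IsBddCont (gatherFactor h u N v x d) := fun d =>
    (isBddCont_trapezoid (h d) (u d) (N d) (v d)).mul (isBddCont_phase _)
  have hB2 := isBddCont_midFactor hS hH x
  set E := aliasRate s S H N
  have hE0 : ∀ l d, 0 ≤ E l d := fun l d => (Real.exp_pos _).le
  have hE1 : ∀ l d, E l d ≤ 1 := fun l d => by
    refine Real.exp_le_one_iff.2 (div_nonpos_of_nonpos_of_nonneg (neg_nonpos.2 ?_) ?_)
    · have := hμ d l; positivity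
    · positivity
  have her := erfc_nonneg √S
  have her1 : erfc √S ≤ erfc 0 := erfc_antitone (Real.sqrt_nonneg S)
  have hl : ∀ l, ‖modeIntegral L ρ (modeFactor s S H l (gatherFactor h u N v x)) -
      modeIntegral L ρ (modeFactor s S H l (midFactor S H x))‖ ≤
        Λ * (Q l * ((∑ d, E l d) + erfc √S)) := by
    intro l
    have i1 := integrable_modeFactor (s := s) hL (l := l) (fun d => hμ d l) hB1
    have i2 := integrable_modeFactor (s := s) hL (l := l) (fun d => hμ d l) hB2
    set f := modeFactor s S H l (gatherFactor h u N v x)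
    set g := modeFactor s S H l (midFactor S H x)
    have hgG : ∀ d, ∫ k, ‖g d k‖ ∂modeMeasure L d ≤ G l d := by
      intro d
      simp_rw [g, norm_modeFactor_midFactor hS hH (hs' l)]
      simpa using (hG l d 0).2
    have hdiff : ∀ d, ∫ k, ‖f d k - g d k‖ ∂modeMeasure L d ≤ C1 l d * (E l d + erfc √S) := by
      intro d
      have h1 := hT l d (H d ^ 2 / S) (mu (s l) S (H d)) (h d) (H d) (u d) S (N d) (v d) (ha d)
        (hε' d l) (by unfold mu; ring) (hh d) (hH d) (hN d)
        (by rw [div_div_cancel₀ (pow_pos (hH d) 2).ne']) (hεS d) (hu d) (hv d)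
      refine le_trans (le_of_eq ?_) h1
      refine integral_congr_ae (ae_of_all _ fun k => ?_)
      simp only [f, g, modeFactor, gatherFactor, midFactor]
      rw [← mul_sub, ← sub_mul, ← mul_assoc, norm_mul, norm_planePhase, mul_one]
    have hfF : ∀ d, ∫ k, ‖f d k‖ ∂modeMeasure L d ≤ F l d := by
      intro d
      have h1 : ∫ k, ‖f d k‖ ∂modeMeasure L d ≤
          ∫ k, (‖f d k - g d k‖ + ‖g d k‖) ∂modeMeasure L d := by
        refine integral_mono (i1 d).norm (((i1 d).sub (i2 d)).norm.add (i2 d).norm) fun k => ?_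
        simpa using norm_add_le (f d k - g d k) (g d k)
      have hi : Integrable (fun k => ‖f d k - g d k‖) (modeMeasure L d) :=
        ((i1 d).sub (i2 d)).norm
      rw [integral_add hi (i2 d).norm] at h1
      refine h1.trans (add_le_add ((hdiff d).trans ?_) (hgG d))
      exact mul_le_mul_of_nonneg_left (add_le_add (hE1 l d) her1) (hC1 l d)
    have hdiff' : ∀ d, ∫ k, ‖f d k - g d k‖ ∂modeMeasure L d ≤
        C1 l d * ((∑ d, E l d) + erfc √S) := by
      intro d
      refine (hdiff d).trans (mul_le_mul_of_nonneg_left ?_ (hC1 l d))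
      have := Finset.single_le_sum (f := fun d => E l d) (fun d _ => hE0 l d) (Finset.mem_univ d)
      linarith
    refine (norm_modeIntegral_sub_le hL hρ hC hΛ i1 i2).trans
      (mul_le_mul_of_nonneg_left ?_ hΛ0)
    set R := (∑ d, E l d) + erfc √S
    have hR : 0 ≤ R := add_nonneg (Finset.sum_nonneg fun d _ => hE0 l d) her
    have n0 := hC1 l 0; have n1 := hC1 l 1; have n2 := hG0 l 0; have n3 := hG0 l 1
    have n4 := hF l 1; have n5 := hF l 2
    have p1 : ∀ d, 0 ≤ ∫ k, ‖f d k‖ ∂modeMeasure L d := fun d =>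
      integral_nonneg fun k => norm_nonneg _
    have p2 : ∀ d, 0 ≤ ∫ k, ‖g d k‖ ∂modeMeasure L d := fun d =>
      integral_nonneg fun k => norm_nonneg _
    have p3 : ∀ d, 0 ≤ ∫ k, ‖f d k - g d k‖ ∂modeMeasure L d := fun d =>
      integral_nonneg fun k => norm_nonneg _
    calc _ ≤ (C1 l 0 * R) * F l 1 * F l 2 + G l 0 * (C1 l 1 * R) * F l 2 +
          G l 0 * G l 1 * (C1 l 2 * R) := by
          refine add_le_add_three ?_ ?_ ?_
          · exact mul_le_mul (mul_le_mul (hdiff' 0) (hfF 1) (p1 1) (by positivity)) (hfF 2) (p1 2)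
              (by positivity)
          · exact mul_le_mul (mul_le_mul (hgG 0) (hdiff' 1) (p3 1) n2) (hfF 2) (p1 2)
              (by positivity)
          · exact mul_le_mul (mul_le_mul (hgG 0) (hgG 1) (p2 1) n2) (hdiff' 2) (p3 2)
              (by positivity)
      _ = _ := by simp only [Q]; ring
  rw [norm_sub_rev, modePotential_eq_sum hL hS hH hs' hμ hρ hC hB1,
    modePotential_eq_sum hL hS hH hs' hμ hρ hC hB2, ← Finset.sum_sub_distrib]
  set T := ⨆ d, ∑ l, w l * E l d
  have hT' : ∀ d, ∑ l, w l * E l d ≤ T := fun d =>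
    le_ciSup (f := fun d => ∑ l, w l * E l d) (Set.finite_range _).bddAbove d
  have hsum : ∑ l, w l * ∑ d, E l d ≤ 3 * T := by
    simp_rw [Finset.mul_sum]
    rw [Finset.sum_comm]
    calc _ ≤ ∑ _d : Fin 3, T := Finset.sum_le_sum fun d _ => hT' d
      _ = 3 * T := by simp
  have hT0 : 0 ≤ T := le_trans (Finset.sum_nonneg fun l _ => mul_nonneg (hw l).le (hE0 l 0)) (hT' 0)
  calc _ ≤ ∑ l, √Real.pi / 4 * w l * s l ^ 3 * (Λ * (Q l * ((∑ d, E l d) + erfc √S))) := by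
        refine (norm_sum_le _ _).trans (Finset.sum_le_sum fun l _ => ?_)
        have hpre : 0 ≤ √Real.pi / 4 * w l * s l ^ 3 := by
          have := hw l; have := hs l; positivity
        rw [← mul_sub, norm_mul, Complex.norm_real, Real.norm_of_nonneg hpre]
        exact mul_le_mul_of_nonneg_left (hl l) hpre
    _ ≤ ∑ l, Z * (Λ * (w l * ((∑ d, E l d) + erfc √S))) := by
        refine Finset.sum_le_sum fun l _ => ?_
        have h1 : 0 ≤ Λ * (w l * ((∑ d, E l d) + erfc √S)) := mul_nonneg hΛ0
          (mul_nonneg (hw l).le (add_nonneg (Finset.sum_nonneg fun d _ => hE0 l d) her))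
        refine le_trans (le_of_eq ?_) (mul_le_mul_of_nonneg_right (hZl l) h1)
        ring
    _ = Z * Λ * (∑ l, w l * (∑ d, E l d) + (∑ l, w l) * erfc √S) := by
        rw [Finset.sum_mul Finset.univ w, ← Finset.sum_add_distrib, Finset.mul_sum]
        exact Finset.sum_congr rfl fun l _ => by ring
    _ ≤ Z * Λ * ((3 + ∑ l, w l) * (T + erfc √S)) := by
        refine mul_le_mul_of_nonneg_left ?_ (by positivity)
        have := mul_nonneg hW hT0
        linarith
    _ = _ := by ring

end Estimates

/-! ### Padding and gathering errors of the potentials. -/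

lemma isGaussCutoff_gaussOne (a H : ℝ) : IsGaussCutoff a H (gaussOne a) := fun _ => Or.inl rfl

lemma isGaussCutoff_ite (a H : ℝ) :
    IsGaussCutoff a H fun t => if |t| ≤ H then gaussOne a t else 0 := by
  intro t
  by_cases h : |t| ≤ H
  · simp [h]
  · exact Or.inr ⟨if_neg h, (not_le.1 h).le⟩

lemma exists_window_factors {S : ℝ} {H : Fin 3 → ℝ} {V : (Fin 3 → ℝ) → ℝ}
    (hV : V ∈ ({gaussWindow S H, truncGaussWindow S H} : Set ((Fin 3 → ℝ) → ℝ))) :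
    ∃ v : Fin 3 → ℝ → ℝ, (∀ d, IsGaussCutoff (H d ^ 2 / S) (H d) (v d)) ∧
      ∀ y : Fin 3 → ℝ, V (fun d => -y d) = ∏ d, v d (y d) := by
  rcases hV with rfl | rfl
  · refine ⟨fun d => gaussOne (H d ^ 2 / S), fun d => isGaussCutoff_gaussOne _ _, fun y => ?_⟩
    rw [gaussWindow_eq_prod]
    simp_rw [gaussOne_neg]
  · refine ⟨fun d t => if |t| ≤ H d then gaussOne (H d ^ 2 / S) t else 0,
      fun d => isGaussCutoff_ite _ _, fun y => Finset.prod_congr rfl fun d _ => ?_⟩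
    simp only [abs_neg, gaussOne]
    congr 2
    rw [div_pow, div_div_eq_mul_div]
    ring

/-- Serves both padding bounds, which differ only in the estimate D inserted for the integral over
the free wave number. -/
lemma midPotential_sub_confinedPotential_le {L : Fin 3 → ℝ} (hL : ∀ d, 0 < L d) {m : ℕ}
    {w s : Fin (m + 1) → ℝ} (hw : ∀ l, 0 < w l) (hs : ∀ l, 0 < s l) :
    ∃ K : Fin (m + 1) → ℝ, (∀ l, 0 ≤ K l) ∧ ∀ (N : ℕ) (q : Fin N → ℝ) (r : Fin N → Fin 3 → ℝ)
      (S : ℝ) (H : Fin 3 → ℝ) (A : ℝ) (x : Fin 3 → ℝ) (D : Fin (m + 1) → ℝ), 0 < S →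
      (∀ d, 0 < H d) → (∀ d l, 0 < mu (s l) S (H d)) → (∀ l, 0 ≤ D l) →
      (∀ l n, ‖∫ κ, (modeWeight (mu (s l) S (H 2)) (H 2 ^ 2 / S) κ : ℂ) *
        ((gaussOneHat (H 2 ^ 2 / S) κ : ℂ) * Complex.exp (Complex.I * (κ * x 2 : ℝ)) -
          confinedHat (H 2 ^ 2 / S) (A / 2) (x 2) κ) *
            structureFactor q r (waveVec L n κ)‖ ≤ D l) →
      ‖midPotential L w s q r x - confinedPotential L w s S H q r A x‖ ≤ ∑ l, K l * D l := by
  choose G hG0 hG using fun (l : Fin (m + 1)) (d : Fin 3) =>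
    gaussBounded_modeMeasure hL d (4 / s l ^ 2) (div_pos four_pos (pow_pos (hs l) 2))
  refine ⟨fun l => ‖(4 * Real.pi : ℂ)‖ * (‖mixedFactor L‖ *
    (√Real.pi / 4 * w l * s l ^ 3 * (G l 0 * G l 1))), fun l => ?_, ?_⟩
  · have := hw l; have := hs l; have := hG0 l 0; have := hG0 l 1
    positivity
  intro N q r S H A x D hS hH hμ hD0 hD
  have hs' : ∀ l, s l ≠ 0 := fun l => (hs l).ne'
  have e1 := midPotential_eq (w := w) q r hL hS hH hs' hμ x
  change _ = 4 * Real.pi * (mixedFactor L *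
    modePotential w s S H L (structureFactor q r) (midFactor S H x)) at e1
  rw [e1, confinedPotential_eq q r hL hS hH hs' hμ, ← mul_sub, ← mul_sub,
    norm_mul (4 * Real.pi : ℂ), norm_mul (mixedFactor L)]
  have h := norm_modePotential_confined_le hL hw hS hH hs hμ (continuous_structureFactor q r)
    (norm_structureFactor_le q r) A x hD
  have hG' : ∀ l d, ∫ k, gaussOne (4 / s l ^ 2) k ∂modeMeasure L d ≤ G l d := fun l d => by
    simpa using (hG l d 0).2
  have h2 : ∑ l, √Real.pi / 4 * w l * s l ^ 3 * (D l *
        ((∫ k, gaussOne (4 / s l ^ 2) k ∂modeMeasure L 0) *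
          ∫ k, gaussOne (4 / s l ^ 2) k ∂modeMeasure L 1)) ≤
      ∑ l, √Real.pi / 4 * w l * s l ^ 3 * (D l * (G l 0 * G l 1)) := by
    refine Finset.sum_le_sum fun l _ => ?_
    have := hw l; have := hs l; have := hG0 l 0; have := hD0 l
    have : 0 ≤ ∫ k, gaussOne (4 / s l ^ 2) k ∂modeMeasure L 1 :=
      integral_nonneg fun k => (gaussOne_pos _ _).le
    gcongr
    · exact hG' l 0
    · exact hG' l 1
  calc _ ≤ ‖(4 * Real.pi : ℂ)‖ * (‖mixedFactor L‖ *
        ∑ l, √Real.pi / 4 * w l * s l ^ 3 * (D l * (G l 0 * G l 1))) := by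
        refine mul_le_mul_of_nonneg_left ?_ (norm_nonneg _)
        exact mul_le_mul_of_nonneg_left (h.trans h2) (norm_nonneg _)
    _ = _ := by
        rw [Finset.mul_sum, Finset.mul_sum]
        exact Finset.sum_congr rfl fun l _ => by ring

/-- The error caused by the confinement of the free direction. -/
theorem exists_padding_error_le {L : Fin 3 → ℝ} (hL : ∀ d, 0 < L d) {m : ℕ} {w s : Fin (m + 1) → ℝ}
    (hw : ∀ l, 0 < w l) (hs : ∀ l, 0 < s l) {ε : ℝ} (hε : 0 < ε)
    (hmono : Monotone s) :
    ∃ K : ℝ, 0 ≤ K ∧ ∀ (N : ℕ) (q : Fin N → ℝ) (r : Fin N → Fin 3 → ℝ), (∀ j, r j ∈ box L) →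
      ∀ (S : ℝ) (H : Fin 3 → ℝ), 0 < S → (∀ d, 0 < H d) → (∀ d l, ε ≤ mu (s l) S (H d)) →
      ∀ A : ℝ, L 2 + 2 * H 2 ≤ A → ∀ i : Fin N,
        ‖midPotential L w s q r (r i) - confinedPotential L w s S H q r A (r i)‖ ≤
          K * structureSup L q r * erfc (A / (2 * √(mu (s (Fin.last m)) S (H 2)))) ∧
        ‖midPotential L w s q r (r i) - confinedPotential L w s S H q r A (r i)‖ ≤
          K * structureSup L q r * erfc √S := by
  obtain ⟨K, hK0, hK⟩ := midPotential_sub_confinedPotential_le hL hw hs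
  have hB : 0 ≤ L 2 / 2 := (half_pos (hL 2)).le
  choose P hP0 hP using fun l => exists_integral_confinement_le (hs l) hε hB
  refine ⟨∑ l, K l * (P l + √(Real.pi * (4 / ε))), Finset.sum_nonneg fun l _ =>
    mul_nonneg (hK0 l) (add_nonneg (hP0 l) (Real.sqrt_nonneg _)), ?_⟩
  intro N q r hr S H hS hH hμε A hA i
  have hμ : ∀ d l, 0 < mu (s l) S (H d) := fun d l => hε.trans_le (hμε d l)
  have ha : 0 < H 2 ^ 2 / S := div_pos (pow_pos (hH 2) 2) hS
  set Λ := structureSup L q r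
  have hΛ0 : 0 ≤ Λ := structureSup_nonneg q r L
  have hΛ : ∀ n κ, ‖structureFactor q r (waveVec L n κ)‖ ≤ Λ :=
    norm_structureFactor_le_structureSup q r L
  have hx : ∀ j, |r j 2| ≤ L 2 / 2 := fun j => hr j 2
  -- The widest Gaussian has the largest μ and hence the slowest decay, so its erfc dominates for
  -- every l.
  have hmul : ∀ l, mu (s l) S (H 2) ≤ mu (s (Fin.last m)) S (H 2) := by
    intro l
    unfold mu
    have h1 := hmono (Fin.le_last l)
    have := (hs l).le
    gcongr
  have hsum : ∀ (Q : Fin (m + 1) → ℝ) (R : ℝ), 0 ≤ R → (∀ l, Q l ≤ P l + √(Real.pi * (4 / ε))) →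
      ∑ l, K l * (Q l * Λ * R) ≤ (∑ l, K l * (P l + √(Real.pi * (4 / ε)))) * Λ * R := by
    intro Q R hR hQ
    rw [Finset.sum_mul, Finset.sum_mul]
    refine Finset.sum_le_sum fun l _ => ?_
    rw [mul_assoc (K l * _), mul_assoc (K l), mul_assoc (Q l)]
    have := hK0 l
    gcongr
    exact hQ l
  constructor
  · have he := erfc_nonneg (A / (2 * √(mu (s (Fin.last m)) S (H 2))))
    refine (hK N q r S H A (r i) (fun l => P l * Λ *
      erfc (A / (2 * √(mu (s (Fin.last m)) S (H 2))))) hS hH hμ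
      (fun l => mul_nonneg (mul_nonneg (hP0 l) hΛ0) he) fun l n => ?_).trans
      (hsum P _ he fun l => le_add_of_nonneg_right (Real.sqrt_nonneg _))
    rw [← div_div]
    exact hP l (H 2 ^ 2 / S) (mu (s l) S (H 2)) (mu (s (Fin.last m)) S (H 2)) (A / 2) (r i 2) Λ
      (fun κ => structureFactor q r (waveVec L n κ)) N _ (fun j => r j 2) ha (hμε 2 l)
      (by unfold mu; ring) (hmul l) (hx i) (by linarith [hH 2]) hx
      (structureFactor_waveVec q r L n) (hΛ n)
  · have he := erfc_nonneg √S
    refine (hK N q r S H A (r i) (fun l => √(Real.pi * (4 / mu (s l) S (H 2))) * Λ * erfc √S) hS hH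
      hμ (fun l => mul_nonneg (mul_nonneg (Real.sqrt_nonneg _) hΛ0) he) fun l n => ?_).trans
      (hsum _ _ he fun l => ?_)
    · have h1 : H 2 / √(H 2 ^ 2 / S) = √S := by
        rw [Real.sqrt_div (by positivity), Real.sqrt_sq (hH 2).le, div_div_cancel₀ (hH 2).ne']
      rw [← h1]
      exact norm_integral_confinement_le_erfc ha (hμ 2 l)
        ((continuous_structureFactor q r).comp (continuous_waveVec L n)) (hΛ n) (hH 2).le
        (by linarith [hx i])
    · have h1 : √(Real.pi * (4 / mu (s l) S (H 2))) ≤ √(Real.pi * (4 / ε)) := by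
        have := hμε 2 l
        have := Real.pi_pos
        gcongr
      exact h1.trans (le_add_of_nonneg_left (hP0 l))

/-- The error of the gathering sum against the full potential. -/
theorem exists_gather_error_le {L : Fin 3 → ℝ} (hL : ∀ d, 0 < L d) {m : ℕ} {w s : Fin (m + 1) → ℝ}
    (hw : ∀ l, 0 < w l) (hs : ∀ l, 0 < s l) {ε : ℝ} (hε : 0 < ε) :
    ∃ K : ℝ, 0 ≤ K ∧ ∀ (N : ℕ) (q : Fin N → ℝ) (r : Fin N → Fin 3 → ℝ)
      (S : ℝ) (h H : Fin 3 → ℝ) (P : Fin 3 → ℕ), 0 < S → (∀ d, 0 < h d) → (∀ d, 0 < H d) →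
      (∀ d, Odd (P d)) → (∀ d, (P d : ℝ) = 2 * H d / h d + 1) →
      (∀ d l, ε ≤ mu (s l) S (H d)) → (∀ d, ε * S ≤ ((P d : ℝ) - 1) ^ 2) →
      ∀ u : Fin 3 → ℝ, (∀ d, |u d| ≤ 1 / 2) →
      ∀ V ∈ ({gaussWindow S H, truncGaussWindow S H} : Set ((Fin 3 → ℝ) → ℝ)), ∀ x : Fin 3 → ℝ,
        ‖midPotential L w s q r x - gatherSum L w s S H q r V h P u x‖ ≤
          K * structureSup L q r * gatherRate w s S H P := by
  obtain ⟨K, hK0, hK⟩ := exists_norm_modePotential_gather_le hL hw hs hε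
  refine ⟨‖(4 * Real.pi : ℂ)‖ * (‖mixedFactor L‖ * K), by positivity, ?_⟩
  intro N q r S h H P hS hh hH hodd hP hμε hεS u hu V hV x
  obtain ⟨v, hv, hVv⟩ := exists_window_factors hV
  have hμ : ∀ d l, 0 < mu (s l) S (H d) := fun d l => hε.trans_le (hμε d l)
  have hs' : ∀ l, s l ≠ 0 := fun l => (hs l).ne'
  -- Oddness of P makes the natural-number division exact.
  have h2N : ∀ d, 2 * (((P d - 1) / 2 : ℕ) : ℝ) = (P d : ℝ) - 1 := by
    intro d
    obtain ⟨k, hk⟩ := hodd d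
    have : (P d - 1) / 2 = k := by omega
    rw [this, hk]
    push_cast
    ring
  have hN : ∀ d, (((P d - 1) / 2 : ℕ) : ℝ) * h d = H d := by
    intro d
    have h1 := h2N d
    rw [hP d] at h1
    have h3 := (hh d).ne'
    field_simp at h1
    linarith
  have e1 := midPotential_eq (w := w) q r hL hS hH hs' hμ x
  change _ = 4 * Real.pi * (mixedFactor L *
    modePotential w s S H L (structureFactor q r) (midFactor S H x)) at e1
  have e2 := gatherSum_eq (w := w) q r hL hS hH hs' hμ hVv h P u x
  change _ = 4 * Real.pi * (mixedFactor L * modePotential w s S H L (structureFactor q r)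
    (gatherFactor h u (fun d => (P d - 1) / 2) v x)) at e2
  have hmain := hK S h H u (fun d => (P d - 1) / 2) v x (structureFactor q r) _
    (structureSup L q r) hS hh hH hN hμε (fun d => by rw [h2N]; exact hεS d) hu hv
    (continuous_structureFactor q r) (norm_structureFactor_le q r)
    (norm_structureFactor_le_structureSup q r L)
  simp only [aliasRate, h2N] at hmain
  rw [e1, e2, ← mul_sub, ← mul_sub, norm_mul (4 * Real.pi : ℂ), norm_mul (mixedFactor L), mul_assoc,
    mul_assoc, mul_assoc, ← mul_assoc K]
  refine mul_le_mul_of_nonneg_left ?_ (norm_nonneg _)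
  exact mul_le_mul_of_nonneg_left hmain (norm_nonneg _)

lemma erfc_le_gatherRate {m : ℕ} {w : Fin (m + 1) → ℝ} (hw : ∀ l, 0 < w l)
    (s : Fin (m + 1) → ℝ) (S : ℝ) (H : Fin 3 → ℝ) (P : Fin 3 → ℕ) :
    erfc √S ≤ gatherRate w s S H P := by
  refine le_add_of_nonneg_left (Real.iSup_nonneg fun d => Finset.sum_nonneg fun l _ => ?_)
  exact mul_nonneg (hw l).le (Real.exp_pos _).le

end SpectralSOG

end

theorem mainTheorem2
    (L : Fin 3 → ℝ) (hL : ∀ d, 0 < L d)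
    (m : ℕ) (w s : Fin (m + 1) → ℝ) (hw : ∀ l, 0 < w l) (hs0 : 0 < s 0) (hs : StrictMono s)
    (ε : ℝ) (hε : 0 < ε) :
    ∃ K : ℝ, 0 < K ∧
      ∀ (N : ℕ) (q : Fin N → ℝ) (r : Fin N → Fin 3 → ℝ), (∀ j, r j ∈ SpectralSOG.box L) →
      ∀ (S : ℝ) (h H : Fin 3 → ℝ) (P : Fin 3 → ℕ),
        0 < S → (∀ d, 0 < h d) → (∀ d, 0 < H d) →
        (∀ d, Odd (P d)) → (∀ d, (P d : ℝ) = 2 * H d / h d + 1) →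
        (∀ d l, H d ^ 2 / S < s l ^ 2) →
        (∀ d l, ε ≤ SpectralSOG.mu (s l) S (H d)) →
      ∀ lam δ : ℝ, 1 ≤ lam → 2 * H 2 ≤ δ →
      ∀ i : Fin N,
        -- the zero-padding error
        ‖SpectralSOG.midPotential L w s q r (r i)
            - SpectralSOG.confinedPotential L w s S H q r (lam * (L 2 + δ)) (r i)‖
          ≤ K * SpectralSOG.structureSup L q r *
            SpectralSOG.erfc
              (lam * (L 2 + δ) / (2 * √(SpectralSOG.mu (s (Fin.last m)) S (H 2)))) ∧
        -- the gathering error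
        ((∀ d, ε * S ≤ ((P d : ℝ) - 1) ^ 2) →
          ∀ u : Fin 3 → ℝ, (∀ d, |u d| ≤ 1 / 2) →
          ∀ V ∈ ({SpectralSOG.gaussWindow S H, SpectralSOG.truncGaussWindow S H} :
              Set ((Fin 3 → ℝ) → ℝ)),
            ‖SpectralSOG.confinedPotential L w s S H q r (lam * (L 2 + δ)) (r i)
                - SpectralSOG.gatherSum L w s S H q r V h P u (r i)‖
              ≤ K * SpectralSOG.structureSup L q r * SpectralSOG.gatherRate w s S H P ∧
            ‖SpectralSOG.midPotential L w s q r (r i)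
                - SpectralSOG.gatherSum L w s S H q r V h P u (r i)‖
              ≤ K * SpectralSOG.structureSup L q r * SpectralSOG.gatherRate w s S H P) := by
  have hsp : ∀ l, 0 < s l := fun l => hs0.trans_le (hs.monotone (Fin.zero_le l))
  obtain ⟨K1, hK1, h1⟩ := SpectralSOG.exists_padding_error_le hL hw hsp hε hs.monotone
  obtain ⟨K2, hK2, h2⟩ := SpectralSOG.exists_gather_error_le hL hw hsp hε
  -- The summand 1 only ensures strict positivity.
  refine ⟨K1 + K2 + 1, by positivity, ?_⟩
  intro N q r hr S h H P hS hh hH hodd hP _ hμ lam δ hlam hδ i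
  have hA : L 2 + 2 * H 2 ≤ lam * (L 2 + δ) := by
    have := hL 2
    have := hH 2
    nlinarith
  obtain ⟨p1, p2⟩ := h1 N q r hr S H hS hH hμ _ hA i
  have hΛ := SpectralSOG.structureSup_nonneg q r L
  have hweak : ∀ k R : ℝ, 0 ≤ R → k ≤ K1 + K2 + 1 →
      k * SpectralSOG.structureSup L q r * R ≤
        (K1 + K2 + 1) * SpectralSOG.structureSup L q r * R := by
    intro k R hR hk
    gcongr
  refine ⟨p1.trans (hweak _ _ (SpectralSOG.erfc_nonneg _) (by linarith)), ?_⟩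
  intro hεS u hu V hV
  have hrate := SpectralSOG.erfc_le_gatherRate hw s S H P
  have hrate0 := (SpectralSOG.erfc_nonneg √S).trans hrate
  have p3 := h2 N q r S h H P hS hh hH hodd hP hμ hεS u hu V hV (r i)
  refine ⟨?_, p3.trans (hweak _ _ hrate0 (by linarith))⟩
  rw [norm_sub_rev] at p2
  -- Triangle inequality through the exact potential; the padding contribution enters with erfc √S,
  -- which is part of the gathering rate, so no dependence on the padded length remains.
  refine (norm_sub_le_norm_sub_add_norm_sub _
    (SpectralSOG.midPotential L w s q r (r i)) _).trans ?_
  refine (add_le_add p2 p3).trans (le_trans ?_ (hweak (K1 + K2) _ hrate0 (by linarith)))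
  have : K1 * SpectralSOG.structureSup L q r * SpectralSOG.erfc √S ≤
      K1 * SpectralSOG.structureSup L q r * SpectralSOG.gatherRate w s S H P := by gcongr
  linarith
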